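/- **Setting.** Let $\mathbb F_\epsilon$ be a finite field with $\hat q$ elements and $A_\epsilon=\mathbb F_\epsilon[[z]]$. Let $R$ be a complete discrete valuation ring containing $\mathbb F_\epsilon$, with maximal ideal $\mathfrak m_R$, residue field $k$ and fraction field $K$, let $0\ne\zeta\in\mathfrak m_R$ (the image of $z$ under $A_\epsilon\hookrightarrow R$), and let $K^{\rm sep}$ be a separable closure of $K$. Let $\hat\sigma$ be the endomorphism of $R[[z]]$ (and of $K^{\rm sep}[[z]]$) with $\hat\sigma(z)=z$ and $\hat\sigma(b)=b^{\hat q}$ for coefficients $b$; write $\hat\sigma^*\hat M=\hat M\otimes_{R[[z]],\hat\sigma}R[[z]]$ and $\hat\sigma_{\hat M}^*m=m\otimes1$. A *torsion local shtuka* over $R$ is a pair $\underline{\hat M}=(\hat M,\tau_{\hat M})$ of a finitely presented $z$-power torsion $R[[z]]$-module $\hat M$ which is free over $R$, and an isomorphism $\tau_{\hat M}\colon\hat\sigma^*\hat M[\frac1{z-\zeta}]\to\hat M[\frac1{z-\zeta}]$. Morphisms are the $R[[z]]$-linear maps $F\colon\hat M\to\hat M'$ with $\tau_{\hat M'}\circ\hat\sigma^*F=F\circ\tau_{\hat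 M}$. For an integer $d\ge0$, $\underline{\hat M}$ is *effective of height $\le d$* if $(z-\zeta)^d\hat M\subset\tau_{\hat M}(\hat\sigma^*\hat M)\subset\hat M$. Its (dual) Tate module is the $A_\epsilon[\mathrm{Gal}(K^{\rm sep}/K)]$-module $$\check T_\epsilon\underline{\hat M}=\{m\in\hat M\otimes_{R[[z]]}K^{\rm sep}[[z]]:\ \tau_{\hat M}(\hat\sigma_{\hat M}^*m)=m\}.$$ A *torsion representation* $T$ is a torsion $A_\epsilon$-module of finite length with an $A_\epsilon$-linear discrete action of $\mathrm{Gal}(K^{\rm sep}/K)$. A *torsion local shtuka model* of $T$ is a torsion local shtuka $\underline{\hat M}$ with a Galois-equivariant $A_\epsilon$-isomorphism $T\cong\check T_\epsilon\underline{\hat M}$. For models of $T$ write $\underline{\hat M}\precsim\underline{\hat M}'$ if there is a morphism $\underline{\hat M}\to\underline{\hat M}'$ compatible with $\check T_\epsilon\underline{\hat M}\cong T\cong\check T_\epsilon\underline{\hat M}'$, and call the two models *equivalent* if $\underline{\hat M}\precsim\underline{\hat M}'$ and $\underline{\hat M}'\precsim\underline{\hat M}$. **Lemma.** Fix $d\ge0$.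 1. For every torsion representation $T$, $\precsim$ defines a partial ordering on the set of equivalence classes of torsion local shtuka models of $T$. A compatible morphism between two models of $T$ is unique if it exists, and two models are equivalent if and only if there is a compatible isomorphism between them. 2. If $T$ has an effective torsion local shtuka model of height $\le d$, then the set of equivalence classes of effective torsion local shtuka models of $T$ of height $\le d$ has a unique maximal element and a unique minimal element with respect to $\precsim$. Their formation is functorial: if $f\colon T\to T'$ is a morphism of torsion representations (a Galois-equivariant $A_\epsilon$-linear map) and $\underline{\hat M},\underline{\hat M}'$ are models of $T$, $T'$ that are both maximal (respectively both minimal) among the effective models of height $\le d$, then there is a unique morphism $\underline{\hat M}\to\underline{\hat M}'$ which induces $f$ on Tate modules. 3. If the residue field $k$ of $R$ is finite, then for every $T$ the set of equivalence classes of effective torsion local shtuka models of $T$ of height $\le d$ is finite. -/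

import Mathlib

open scoped PowerSeries TensorProduct

set_option linter.unusedSectionVars false

noncomputable section

namespace LocalShtuka

universe u v w

/-! ### Pullback of modules along a ring endomorphism -/

section Pullback

variable {S : Type u} [CommRing S] (φ : S →+* S)

/-- The ring `S`, regarded as an `S`-algebra through the endomorphism `φ`. -/
def Twist (_φ : S →+* S) : Type u := S

instance : CommRing (Twist φ) := inferInstanceAs (CommRing S)

instance : Algebra S (Twist φ) := RingHom.toAlgebra (S := Twist φ) φ

/-- The identity of `S`, as a ring isomorphism to `Twist φ`. -/
def Twist.of : S ≃+* Twist φ := RingEquiv.refl S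

/-- The pullback `φ^* M = S ⊗_{φ, S} M`. -/
def Pullback (M : Type u) [AddCommGroup M] [Module S M] : Type u := Twist φ ⊗[S] M

variable (M : Type u) [AddCommGroup M] [Module S M]
variable {M' : Type u} [AddCommGroup M'] [Module S M']

instance : AddCommGroup (Pullback φ M) := inferInstanceAs (AddCommGroup (Twist φ ⊗[S] M))

/-- `S` acts on `φ^* M` through the left tensor factor: `s • (b ⊗ m) = (s b) ⊗ m`. -/
instance : Module S (Pullback φ M) :=
  Module.compHom (Twist φ ⊗[S] M) (Twist.of φ : S →+* Twist φ)

variable {M}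

/-- The natural `φ`-semilinear map `M → φ^* M`, `m ↦ 1 ⊗ m`. -/
def Pullback.incl : M →+ Pullback φ M :=
  (TensorProduct.mk S (Twist φ) M 1).toAddMonoidHom


theorem Pullback.incl_smul (s : S) (m : M) :
    Pullback.incl φ (s • m) = φ s • Pullback.incl φ m := by
  change (1 : Twist φ) ⊗ₜ[S] (s • m) =
    ((Twist.of φ (φ s)) • ((1 : Twist φ) ⊗ₜ[S] m) : Twist φ ⊗[S] M)
  rw [TensorProduct.tmul_smul, TensorProduct.smul_tmul', TensorProduct.smul_tmul',
    Algebra.smul_def, smul_eq_mul]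
  rfl

/-- The map `φ^* f = id ⊗ f : φ^* M → φ^* M'` induced by `f : M → M'`. -/
def Pullback.map (f : M →ₗ[S] M') : Pullback φ M →ₗ[S] Pullback φ M' where
  toFun := f.baseChange (Twist φ)
  map_add' := map_add (f.baseChange (Twist φ))
  map_smul' s x := (f.baseChange (Twist φ)).map_smul (Twist.of φ s) x

theorem Pullback.map_id : Pullback.map φ (LinearMap.id : M →ₗ[S] M) = LinearMap.id := by
  ext x
  exact congrArg (fun g : Twist φ ⊗[S] M →ₗ[Twist φ] Twist φ ⊗[S] M => g x)
    (LinearMap.baseChange_id (R := S) (A := Twist φ) (M := M))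

theorem Pullback.map_comp {M'' : Type u} [AddCommGroup M''] [Module S M'']
    (g : M' →ₗ[S] M'') (f : M →ₗ[S] M') :
    Pullback.map φ (g ∘ₗ f) = Pullback.map φ g ∘ₗ Pullback.map φ f := by
  ext x
  exact congrArg (fun h : Twist φ ⊗[S] M →ₗ[Twist φ] Twist φ ⊗[S] M'' => h x)
    (LinearMap.baseChange_comp (A := Twist φ) f g)

end Pullback

/-! ### Localisation of linear maps -/

section Localise

variable {S : Type u} [CommRing S] (P : Submonoid S)
variable {M M' M'' : Type u} [AddCommGroup M] [Module S M] [AddCommGroup M'] [Module S M']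
  [AddCommGroup M''] [Module S M'']

/-- The map `P⁻¹ f : P⁻¹ M → P⁻¹ M'` induced by `f : M → M'`. -/
def locMap (f : M →ₗ[S] M') : LocalizedModule P M →ₗ[S] LocalizedModule P M' :=
  IsLocalizedModule.map P (LocalizedModule.mkLinearMap P M) (LocalizedModule.mkLinearMap P M') f

theorem locMap_id : locMap P (LinearMap.id : M →ₗ[S] M) = LinearMap.id :=
  IsLocalizedModule.map_id P (LocalizedModule.mkLinearMap P M)

theorem locMap_comp (g : M' →ₗ[S] M'') (f : M →ₗ[S] M') :
    locMap P (g ∘ₗ f) = locMap P g ∘ₗ locMap P f :=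
  IsLocalizedModule.map_comp' P (LocalizedModule.mkLinearMap P M)
    (LocalizedModule.mkLinearMap P M') (LocalizedModule.mkLinearMap P M'') f g

end Localise

/-! ### The base ring -/

/-- The image `ζ` in the local ring `R` of the uniformizer `z` of `A_ε = 𝔽⟦z⟧`:
a non-zero element of the maximal ideal. -/
structure CharPoint (R : Type u) [CommRing R] [IsLocalRing R] where
  zeta : R
  ne_zero : zeta ≠ 0
  mem : zeta ∈ IsLocalRing.maximalIdeal R

/-- The endomorphism `σ̂` of `B⟦z⟧` with `σ̂(z) = z` and `σ̂(b) = b ^ #𝔽` for `b ∈ B`. -/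
def sigma (𝔽 : Type w) [Field 𝔽] [Fintype 𝔽] (B : Type u) [CommRing B] [Algebra 𝔽 B] :
    B⟦X⟧ →+* B⟦X⟧ :=
  PowerSeries.map (FiniteField.frobeniusAlgHom 𝔽 B : B →+* B)

/-- The multiplicative set `{(z - ζ)^n}`; inverting it gives `M[1/(z - ζ)]`. -/
def zPowers {R : Type u} [CommRing R] [IsLocalRing R] (c : CharPoint R) : Submonoid R⟦X⟧ :=
  Submonoid.powers (PowerSeries.X - PowerSeries.C c.zeta)

/-! ### Torsion local shtukas -/

section Shtuka

variable (𝔽 : Type w) [Field 𝔽] [Fintype 𝔽] {R : Type u} [CommRing R] [IsLocalRing R]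
  [Algebra 𝔽 R] (c : CharPoint R)

/-- A torsion local shtuka over `R`. -/
structure TorsionLocalShtuka where
  carrier : Type u
  [addCommGroup : AddCommGroup carrier]
  [module : Module R⟦X⟧ carrier]
  finitePresentation : Module.FinitePresentation R⟦X⟧ carrier
  torsion : ∀ m : carrier, ∃ n : ℕ, (PowerSeries.X : R⟦X⟧) ^ n • m = 0
  free : Module.Free R (RestrictScalars R R⟦X⟧ carrier)
  /-- the isomorphism `τ : σ̂^* M [1/(z - ζ)] ≃ M [1/(z - ζ)]` -/
  tau : LocalizedModule (zPowers c) (Pullback (sigma 𝔽 R) carrier) ≃ₗ[R⟦X⟧]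
    LocalizedModule (zPowers c) carrier

attribute [instance] TorsionLocalShtuka.addCommGroup TorsionLocalShtuka.module

variable {𝔽} {c}

namespace TorsionLocalShtuka

/-- The image of `M` in `M[1/(z - ζ)]`. -/
def lattice (M : TorsionLocalShtuka 𝔽 c) :
    Submodule R⟦X⟧ (LocalizedModule (zPowers c) M.carrier) :=
  LinearMap.range (LocalizedModule.mkLinearMap (zPowers c) M.carrier)

/-- The submodule `τ(σ̂^* M)` of `M[1/(z - ζ)]`. -/
def tauLattice (M : TorsionLocalShtuka 𝔽 c) :
    Submodule R⟦X⟧ (LocalizedModule (zPowers c) M.carrier) :=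
  LinearMap.range (M.tau.toLinearMap ∘ₗ
    LocalizedModule.mkLinearMap (zPowers c) (Pullback (sigma 𝔽 R) M.carrier))

/-- `M` is effective: `τ(σ̂^* M) ⊆ M`. -/
def IsEffective (M : TorsionLocalShtuka 𝔽 c) : Prop := M.tauLattice ≤ M.lattice

/-- `M` is effective of height `≤ d`: `(z - ζ)^d M ⊆ τ(σ̂^* M) ⊆ M`. -/
def HasHeightLE (M : TorsionLocalShtuka 𝔽 c) (d : ℕ) : Prop :=
  (∀ x ∈ M.lattice, (PowerSeries.X - PowerSeries.C c.zeta : R⟦X⟧) ^ d • x ∈ M.tauLattice) ∧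
    M.IsEffective

/-- A morphism of torsion local shtukas: a linear map `f` with `τ' ∘ σ̂^* f = f ∘ τ`. -/
@[ext]
structure Hom (M M' : TorsionLocalShtuka 𝔽 c) where
  toLinearMap : M.carrier →ₗ[R⟦X⟧] M'.carrier
  comm : M'.tau.toLinearMap ∘ₗ locMap (zPowers c) (Pullback.map (sigma 𝔽 R) toLinearMap) =
    locMap (zPowers c) toLinearMap ∘ₗ M.tau.toLinearMap

/-- The identity morphism. -/
def Hom.id (M : TorsionLocalShtuka 𝔽 c) : Hom M M where
  toLinearMap := LinearMap.id
  comm := by rw [Pullback.map_id, locMap_id, locMap_id]; rfl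

/-- Composition of morphisms. -/
def Hom.comp {M M' M'' : TorsionLocalShtuka 𝔽 c} (g : Hom M' M'') (f : Hom M M') : Hom M M'' where
  toLinearMap := g.toLinearMap ∘ₗ f.toLinearMap
  comm := by
    rw [Pullback.map_comp, locMap_comp, locMap_comp, ← LinearMap.comp_assoc, g.comm,
      LinearMap.comp_assoc, f.comm, LinearMap.comp_assoc]

end TorsionLocalShtuka

end Shtuka

/-! ### The dual Tate module -/

section Tate

variable {𝔽 : Type w} [Field 𝔽] [Fintype 𝔽] {R : Type u} [CommRing R] [IsLocalRing R]
  [Algebra 𝔽 R] {c : CharPoint R}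
variable (L : Type v) [Field L] [Algebra 𝔽 L] [Algebra R L]

namespace TorsionLocalShtuka

/-- The base change `M ⊗_{R⟦z⟧} L⟦z⟧`, for an overfield `L` of `R`. -/
def Fibre (M : TorsionLocalShtuka 𝔽 c) : Type (max v u) := L⟦X⟧ ⊗[R⟦X⟧] M.carrier

variable (M : TorsionLocalShtuka 𝔽 c)

instance : AddCommGroup (M.Fibre L) := inferInstanceAs (AddCommGroup (L⟦X⟧ ⊗[R⟦X⟧] M.carrier))

instance : Module R⟦X⟧ (M.Fibre L) :=
  inferInstanceAs (Module R⟦X⟧ (L⟦X⟧ ⊗[R⟦X⟧] M.carrier))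

instance : Module L⟦X⟧ (M.Fibre L) :=
  inferInstanceAs (Module L⟦X⟧ (L⟦X⟧ ⊗[R⟦X⟧] M.carrier))

/-- The action of `A_ε = 𝔽⟦z⟧`, through `𝔽⟦z⟧ → R⟦z⟧`. -/
instance : Module 𝔽⟦X⟧ (M.Fibre L) :=
  Module.compHom (M.Fibre L) (PowerSeries.map (algebraMap 𝔽 R))

theorem coeff_smul_def (a : 𝔽⟦X⟧) (x : M.Fibre L) :
    a • x = PowerSeries.map (algebraMap 𝔽 R) a • x := rfl

theorem isUnit_zPowers [FaithfulSMul R L] (s : zPowers c) :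
    IsUnit (algebraMap R⟦X⟧ (Module.End R⟦X⟧ (M.Fibre L)) s) := by
  obtain ⟨s, n, rfl⟩ := s
  have h1 : IsUnit (algebraMap R⟦X⟧ L⟦X⟧ (PowerSeries.X - PowerSeries.C c.zeta)) := by
    rw [PowerSeries.isUnit_iff_constantCoeff]
    have : PowerSeries.constantCoeff
        (algebraMap R⟦X⟧ L⟦X⟧ (PowerSeries.X - PowerSeries.C c.zeta)) =
        - algebraMap R L c.zeta := by
      change PowerSeries.constantCoeff (PowerSeries.map (algebraMap R L) _) = _
      simp
    rw [this]
    refine IsUnit.neg (IsUnit.mk0 _ ?_)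
    rw [Ne, FaithfulSMul.algebraMap_eq_zero_iff]
    exact c.ne_zero
  have h2 := (h1.pow n).map (Algebra.lsmul R⟦X⟧ R⟦X⟧ (L⟦X⟧ ⊗[R⟦X⟧] M.carrier))
  rw [← map_pow, AlgHom.commutes] at h2
  exact h2

/-- The canonical map `M[1/(z - ζ)] → M ⊗ L⟦z⟧`, which exists as `z - ζ` is a unit of `L⟦z⟧`. -/
def toFibre [FaithfulSMul R L] : LocalizedModule (zPowers c) M.carrier →ₗ[R⟦X⟧] M.Fibre L :=
  LocalizedModule.lift (zPowers c) (TensorProduct.mk R⟦X⟧ L⟦X⟧ M.carrier 1)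
    (M.isUnit_zPowers L)

/-- The `σ̂`-semilinear map `m ↦ τ(σ̂^* m)` from `M` to `M[1/(z - ζ)]`. -/
def semilin : M.carrier →+ LocalizedModule (zPowers c) M.carrier :=
  ((M.tau.toLinearMap ∘ₗ LocalizedModule.mkLinearMap (zPowers c)
    (Pullback (sigma 𝔽 R) M.carrier)).toAddMonoidHom).comp (Pullback.incl (sigma 𝔽 R))

theorem semilin_smul (s : R⟦X⟧) (m : M.carrier) :
    M.semilin (s • m) = sigma 𝔽 R s • M.semilin m := by
  simp only [semilin, AddMonoidHom.comp_apply, Pullback.incl_smul]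
  exact map_smul (M.tau.toLinearMap ∘ₗ LocalizedModule.mkLinearMap (zPowers c)
    (Pullback (sigma 𝔽 R) M.carrier)) _ _

theorem sigma_algebraMap (s : R⟦X⟧) :
    sigma 𝔽 L (algebraMap R⟦X⟧ L⟦X⟧ s) = algebraMap R⟦X⟧ L⟦X⟧ (sigma 𝔽 R s) := by
  change sigma 𝔽 L (PowerSeries.map (algebraMap R L) s) =
    PowerSeries.map (algebraMap R L) (sigma 𝔽 R s)
  ext n
  simp [sigma]

/-- The `σ̂`-semilinear endomorphism `m ↦ τ(σ̂^* m)` of `M ⊗ L⟦z⟧`; it sends `l ⊗ m` to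
`σ̂(l) • τ(σ̂^* m)`. -/
def tauFibre [FaithfulSMul R L] : M.Fibre L →+ M.Fibre L :=
  TensorProduct.liftAddHom (R := R⟦X⟧) (M := L⟦X⟧) (N := M.carrier)
    (AddMonoidHom.mk' (fun l => AddMonoidHom.mk'
        (fun m => sigma 𝔽 L l • M.toFibre L (M.semilin m))
        (by intro a b; rw [map_add, map_add, smul_add]))
      (by intro a b; ext m; simp [add_smul]))
    (by
      intro s l m
      change sigma 𝔽 L (s • l) • M.toFibre L (M.semilin m) =
        sigma 𝔽 L l • M.toFibre L (M.semilin (s • m))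
      rw [semilin_smul, LinearMap.map_smul, Algebra.smul_def, RingHom.map_mul, sigma_algebraMap,
        mul_comm, mul_smul]
      congr 1)

theorem tauFibre_tmul [FaithfulSMul R L] (l : L⟦X⟧) (m : M.carrier) :
    M.tauFibre L (l ⊗ₜ[R⟦X⟧] m : L⟦X⟧ ⊗[R⟦X⟧] M.carrier) =
      sigma 𝔽 L l • M.toFibre L (M.semilin m) := rfl

theorem tauFibre_smul [FaithfulSMul R L] (s : R⟦X⟧) (x : M.Fibre L) :
    M.tauFibre L (s • x) = sigma 𝔽 R s • M.tauFibre L x := by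
  induction x using TensorProduct.induction_on with
  | zero =>
    change M.tauFibre L (s • (0 : M.Fibre L)) = sigma 𝔽 R s • M.tauFibre L (0 : M.Fibre L)
    simp
  | tmul l m =>
    change M.tauFibre L ((s • l) ⊗ₜ[R⟦X⟧] m : L⟦X⟧ ⊗[R⟦X⟧] M.carrier) = _
    rw [tauFibre_tmul, tauFibre_tmul, Algebra.smul_def, map_mul, sigma_algebraMap, mul_smul]
    exact algebraMap_smul (M := L⟦X⟧ ⊗[R⟦X⟧] M.carrier) L⟦X⟧ (sigma 𝔽 R s) _
  | add x y hx hy =>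
    have h : s • (x + y : M.Fibre L) = s • (x : M.Fibre L) + s • (y : M.Fibre L) :=
      smul_add _ _ _
    have h' : M.tauFibre L (x + y : M.Fibre L) = M.tauFibre L x + M.tauFibre L y :=
      map_add _ _ _
    exact (congrArg (M.tauFibre L) h).trans ((map_add _ _ _).trans
      ((congrArg₂ (· + ·) hx hy).trans ((smul_add _ _ _).symm.trans
        (congrArg (sigma 𝔽 R s • ·) h'.symm))))

theorem sigma_coeff (a : 𝔽⟦X⟧) :
    sigma 𝔽 R (PowerSeries.map (algebraMap 𝔽 R) a) = PowerSeries.map (algebraMap 𝔽 R) a := by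
  ext n
  simp [sigma]

/-- The (dual) Tate module `{x ∈ M ⊗ L⟦z⟧ : τ(σ̂^* x) = x}`, an `A_ε`-module; it is used for
`L` a separable closure of `Frac R`. -/
def tateModule [FaithfulSMul R L] : Submodule 𝔽⟦X⟧ (M.Fibre L) where
  carrier := {x | M.tauFibre L x = x}
  add_mem' := by
    intro x y hx hy
    rw [Set.mem_ofPred_eq] at *
    rw [map_add, hx, hy]
  zero_mem' := map_zero _
  smul_mem' := by
    intro a x hx
    rw [Set.mem_ofPred_eq] at *
    rw [coeff_smul_def, tauFibre_smul, sigma_coeff, hx]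

/-- The map `M ⊗ L⟦z⟧ → M' ⊗ L⟦z⟧` induced by a morphism `M → M'`. -/
def Hom.fibreMap {M M' : TorsionLocalShtuka 𝔽 c} (f : Hom M M') : M.Fibre L →+ M'.Fibre L :=
  (f.toLinearMap.baseChange L⟦X⟧).toAddMonoidHom

variable {L}

/-- The action of `g ∈ Gal(L/K)` on `M ⊗ L⟦z⟧`, through the coefficients of `L⟦z⟧`. -/
def galAct {K : Type*} [Field K] [Algebra R K] [Algebra K L] [IsScalarTower R K L] (g : L ≃ₐ[K] L) :
    M.Fibre L →+ M.Fibre L :=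
  (LinearMap.rTensor M.carrier
    ({ toFun := PowerSeries.map (g : L →+* L)
       map_add' := map_add _
       map_smul' := by
        intro s l
        have h : PowerSeries.map (g : L →+* L) (algebraMap R⟦X⟧ L⟦X⟧ s) =
            algebraMap R⟦X⟧ L⟦X⟧ s := by
          change PowerSeries.map (g : L →+* L) (PowerSeries.map (algebraMap R L) s) =
            PowerSeries.map (algebraMap R L) s
          ext n
          simp only [PowerSeries.coeff_map]
          rw [IsScalarTower.algebraMap_apply R K L]
          exact g.commutes _
        rw [Algebra.smul_def, map_mul, h, RingHom.id_apply, Algebra.smul_def] } :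
      L⟦X⟧ →ₗ[R⟦X⟧] L⟦X⟧)).toAddMonoidHom

end TorsionLocalShtuka

end Tate

/-! ### Torsion Galois representations and their models -/

/-- A torsion representation of `Gal(L/K)`: a torsion `𝔽⟦z⟧`-module of finite length with an
`𝔽⟦z⟧`-linear discrete action of `Gal(L/K)` (with its Krull topology). -/
structure TorsionRep (𝔽 : Type w) [Field 𝔽] (K : Type*) [Field K] (L : Type v) [Field L]
    [Algebra K L] where
  carrier : Type v
  [addCommGroup : AddCommGroup carrier]
  [module : Module 𝔽⟦X⟧ carrier]
  [action : DistribMulAction (L ≃ₐ[K] L) carrier]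
  [smulComm : SMulCommClass (L ≃ₐ[K] L) 𝔽⟦X⟧ carrier]
  finiteLength : IsFiniteLength 𝔽⟦X⟧ carrier
  torsion : Module.IsTorsion 𝔽⟦X⟧ carrier
  discrete : ∀ t : carrier, IsOpen (MulAction.stabilizer (L ≃ₐ[K] L) t : Set (L ≃ₐ[K] L))

attribute [instance] TorsionRep.addCommGroup TorsionRep.module TorsionRep.action
  TorsionRep.smulComm

/-- A morphism of torsion representations. -/
structure TorsionRep.Hom {𝔽 : Type w} [Field 𝔽] {K : Type*} [Field K] {L : Type v} [Field L]
    [Algebra K L] (T T' : TorsionRep 𝔽 K L) where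
  toLinearMap : T.carrier →ₗ[𝔽⟦X⟧] T'.carrier
  equivariant : ∀ (g : L ≃ₐ[K] L) (t : T.carrier), toLinearMap (g • t) = g • toLinearMap t

section Model

variable {𝔽 : Type w} [Field 𝔽] [Fintype 𝔽] {R : Type u} [CommRing R] [IsLocalRing R]
  [Algebra 𝔽 R] (c : CharPoint R) {K : Type*} [Field K] [Algebra R K]
  {L : Type v} [Field L] [Algebra K L] [Algebra 𝔽 L] [Algebra R L] [IsScalarTower R K L]
  [FaithfulSMul R L]

/-- A torsion local shtuka model of `T`: a torsion local shtuka with a Galois equivariant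
isomorphism from `T` to its Tate module. -/
structure ShtukaModel (T : TorsionRep 𝔽 K L) where
  shtuka : TorsionLocalShtuka 𝔽 c
  iso : T.carrier ≃ₗ[𝔽⟦X⟧] shtuka.tateModule L
  equivariant : ∀ (g : L ≃ₐ[K] L) (t : T.carrier),
    (iso (g • t) : shtuka.Fibre L) = shtuka.galAct g (iso t : shtuka.Fibre L)

variable {c}

namespace ShtukaModel

/-- The morphism `F` of torsion local shtukas induces `f` on Tate modules, under the given
identifications of `T` and `T'` with the Tate modules. -/
def Induces {T T' : TorsionRep 𝔽 K L} (M : ShtukaModel c T) (M' : ShtukaModel c T')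
    (F : TorsionLocalShtuka.Hom M.shtuka M'.shtuka) (f : T.carrier → T'.carrier) : Prop :=
  ∀ t : T.carrier, F.fibreMap L (M.iso t : M.shtuka.Fibre L) =
    (M'.iso (f t) : M'.shtuka.Fibre L)

variable {T : TorsionRep 𝔽 K L}

/-- `M ≾ M'`: there is a morphism `M → M'` which respects the identifications of the Tate
modules with `T`. -/
def Precsim (M M' : ShtukaModel c T) : Prop :=
  ∃ F : TorsionLocalShtuka.Hom M.shtuka M'.shtuka, Induces M M' F id

theorem Precsim.refl (M : ShtukaModel c T) : Precsim M M :=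
  ⟨TorsionLocalShtuka.Hom.id _, fun t =>
    congrArg (fun h : L⟦X⟧ ⊗[R⟦X⟧] M.shtuka.carrier →ₗ[L⟦X⟧] L⟦X⟧ ⊗[R⟦X⟧] M.shtuka.carrier =>
      h (M.iso t : M.shtuka.Fibre L)) LinearMap.baseChange_id⟩

theorem Precsim.trans {M M' M'' : ShtukaModel c T} (h : Precsim M M') (h' : Precsim M' M'') :
    Precsim M M'' := by
  obtain ⟨F, hF⟩ := h
  obtain ⟨G, hG⟩ := h'
  refine ⟨G.comp F, fun t => ?_⟩
  have h1 : (G.comp F).fibreMap L (M.iso t : M.shtuka.Fibre L) =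
      G.fibreMap L (F.fibreMap L (M.iso t : M.shtuka.Fibre L)) :=
    congrArg (fun h : L⟦X⟧ ⊗[R⟦X⟧] M.shtuka.carrier →ₗ[L⟦X⟧]
        L⟦X⟧ ⊗[R⟦X⟧] M''.shtuka.carrier => h (M.iso t : M.shtuka.Fibre L))
      (LinearMap.baseChange_comp F.toLinearMap G.toLinearMap)
  rw [h1, hF t]
  exact hG t

/-- Two models are equivalent if `M ≾ M'` and `M' ≾ M`. -/
instance equivalence (c : CharPoint R) (T : TorsionRep 𝔽 K L) : Setoid (ShtukaModel c T) where
  r M M' := Precsim M M' ∧ Precsim M' M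
  iseqv := ⟨fun M => ⟨.refl M, .refl M⟩, fun h => ⟨h.2, h.1⟩,
    fun h h' => ⟨h.1.trans h'.1, h'.2.trans h.2⟩⟩

end ShtukaModel

/-- The equivalence classes of torsion local shtuka models of `T`. -/
def ModelClass (c : CharPoint R) (T : TorsionRep 𝔽 K L) :=
  Quotient (ShtukaModel.equivalence c T)

variable {T : TorsionRep 𝔽 K L}

/-- The equivalence class of a model. -/
def ShtukaModel.toClass (M : ShtukaModel c T) : ModelClass c T := Quotient.mk _ M

/-- The relation induced by `≾` on equivalence classes. -/
instance : LE (ModelClass c T) where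
  le := Quotient.lift₂ ShtukaModel.Precsim (fun _ _ _ _ h h' =>
    propext ⟨fun H => (h.2.trans H).trans h'.1, fun H => (h.1.trans H).trans h'.2⟩)

/-- The equivalence classes of effective models of height `≤ d`. -/
def boundedClasses (c : CharPoint R) (T : TorsionRep 𝔽 K L) (d : ℕ) : Set (ModelClass c T) :=
  {C | ∃ M : ShtukaModel c T, M.shtuka.HasHeightLE d ∧ M.toClass = C}

/-- The class of `M` is maximal among those of effective models of height `≤ d`. -/
def ShtukaModel.IsMaximal (M : ShtukaModel c T) (d : ℕ) : Prop :=
  Maximal (· ∈ boundedClasses c T d) M.toClass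

/-- The class of `M` is minimal among those of effective models of height `≤ d`. -/
def ShtukaModel.IsMinimal (M : ShtukaModel c T) (d : ℕ) : Prop :=
  Minimal (· ∈ boundedClasses c T d) M.toClass

end Model

end LocalShtuka

end

/-! Write L for the separable closure of K, q = #𝔽, and V = L⟦z⟧ ⊗ T (`TorsionRep.Space`), a
finite-dimensional L-vector space carrying the Frobenius φ = σ̂ ⊗ id, whose fixed vectors are T, and
the diagonal Galois action. The proof replaces models of T by lattices in this one space.

If M is a model, z - ζ is a unit of L⟦z⟧, so τ makes the fibre M ⊗ L⟦z⟧ an étale Frobenius module.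
By Lang's theorem over a separably closed field the fibre is spanned by its fixed vectors, which are
a copy of T; hence the fibre is V (`ShtukaModel.spaceMap_bijective`) and M becomes an R-lattice N in
V. A morphism inducing f : T → T' is then the restriction of id ⊗ f, so it is unique, and it exists
exactly when id ⊗ f carries one lattice into the other. In particular ≾ is inclusion (`precsim_iff`)
and equivalence is equality of lattices. The lattices of effective models of height ≤ d are those of
`IsShtukaLattice`: fixed by Galois, spanned over R by an L-basis of V, φ-stable, with (z - ζ)^d N
inside the span of φ(N). Conversely each of them carries a model (`IsShtukaLattice.exists_model`).

Two facts about these lattices remain.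

Boundedness: if z^m kills V, then ζ^(m+d) N ⊆ N' for any two of them. Coordinates of N in a basis of
T are integral over R, because they fill a finitely generated module stable under q-th powers;
ζ^(m+d) times the coordinates of T in a basis of N' is integral for a similar reason; and a
Galois-fixed vector with integral coordinates in a basis of N' lies in N', as R is integrally
closed. So with r = ζ^(m+d) every lattice is determined by a submodule of N₀/r²N₀, which has finite
length, and is finite when k is. This gives maximal and minimal lattices and the finiteness
statement.

Closure: f(N) + N' and N ∩ f⁻¹(N') are again shtuka lattices (`map_sup`, `inf_comap`). The delicate
point is the height of the intersection, which rests on flatness of the Frobenius of R. With f = id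
closure makes extremal elements unique; for general f it makes them functorial. -/

noncomputable section

namespace LocalShtuka

universe u v w

/-! ### Modules over a power series ring on which the variable is nilpotent -/

section PowerSeriesModule

open PowerSeries

variable {B : Type*} [CommRing B] {M : Type*} [AddCommGroup M] [Module B⟦X⟧ M]

section Nilpotent

variable [Module B M] [IsScalarTower B B⟦X⟧ M]

theorem smul_eq_sum_of_X_pow_smul_eq_zero {n : ℕ} {m : M} (h : (X : B⟦X⟧) ^ n • m = 0) (s : B⟦X⟧) :
    s • m = ∑ k ∈ Finset.range n, coeff k s • (X : B⟦X⟧) ^ k • m := by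
  conv_lhs => rw [eq_X_pow_mul_shift_add_trunc n s, mul_comm, add_smul, mul_smul, h, smul_zero,
    zero_add]
  have : ((trunc n s : Polynomial B) : B⟦X⟧) =
      ∑ k ∈ Finset.range n, coeff k s • (X : B⟦X⟧) ^ k := by
    ext j
    rw [Polynomial.coeff_coe, coeff_trunc, map_sum]
    simp [coeff_X_pow]
  rw [this, Finset.sum_smul]
  simp

theorem powerSeries_smul_mem {n : ℕ} (N : Submodule B M)
    (hX : ∀ x ∈ N, (X : B⟦X⟧) • x ∈ N) {x : M} (hx : x ∈ N) (h : (X : B⟦X⟧) ^ n • x = 0)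
    (s : B⟦X⟧) : s • x ∈ N := by
  rw [smul_eq_sum_of_X_pow_smul_eq_zero h]
  refine N.sum_mem fun k _ => N.smul_mem _ ?_
  clear * - hx hX
  induction k with
  | zero => simpa using hx
  | succ k ih => rw [pow_succ', mul_smul]; exact hX _ ih

/-- Since X is nilpotent on M, a B-submodule stable under X is already stable under B⟦X⟧. This
allows z-torsion modules to be handled through coordinates over B alone. The equality is one of sets
because the two spans are modules over different rings. -/
theorem coe_span_powerSeries_eq {n : ℕ} (h : ∀ x : M, (X : B⟦X⟧) ^ n • x = 0) {s : Set M}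
    (hX : ∀ x ∈ s, (X : B⟦X⟧) • x ∈ Submodule.span B s) :
    (Submodule.span B⟦X⟧ s : Set M) = Submodule.span B s := by
  have hX' : ∀ x ∈ Submodule.span B s, (X : B⟦X⟧) • x ∈ Submodule.span B s := by
    intro x hx
    induction hx using Submodule.span_induction with
    | mem x hx => exact hX x hx
    | zero => simp
    | add x y _ _ hx hy => rw [smul_add]; exact add_mem hx hy
    | smul a x _ hx => rw [smul_comm]; exact Submodule.smul_mem _ _ hx
  apply le_antisymm
  · intro x hx
    rw [SetLike.mem_coe] at hx ⊢
    induction hx using Submodule.span_induction with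
    | mem x hx => exact Submodule.subset_span hx
    | zero => simp
    | add x y _ _ hx hy => exact add_mem hx hy
    | smul a x _ hx => exact powerSeries_smul_mem _ hX' hx (h x) a
  · exact Submodule.span_le_restrictScalars B B⟦X⟧ s

end Nilpotent

variable {L : Type*} [CommRing L] [Algebra B L]

theorem powerSeries_smul_def (s : B⟦X⟧) (l : L⟦X⟧) :
    s • l = PowerSeries.map (algebraMap B L) s * l :=
  Algebra.smul_def (R := B⟦X⟧) (A := L⟦X⟧) s l

variable (B L M) in
/-- The base change `L⟦X⟧ ⊗ M` of a `B⟦X⟧`-module `M`. -/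
def PowerSeriesBaseChange : Type _ := L⟦X⟧ ⊗[B⟦X⟧] M

namespace PowerSeriesBaseChange

instance : AddCommGroup (PowerSeriesBaseChange B M L) :=
  inferInstanceAs (AddCommGroup (L⟦X⟧ ⊗[B⟦X⟧] M))

instance : Module L⟦X⟧ (PowerSeriesBaseChange B M L) :=
  inferInstanceAs (Module L⟦X⟧ (L⟦X⟧ ⊗[B⟦X⟧] M))

instance : Module L (PowerSeriesBaseChange B M L) :=
  Module.compHom (PowerSeriesBaseChange B M L) (C : L →+* L⟦X⟧)

theorem smul_eq_C_smul (l : L) (x : PowerSeriesBaseChange B M L) : l • x = (C l : L⟦X⟧) • x := rfl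

instance : IsScalarTower L L⟦X⟧ (PowerSeriesBaseChange B M L) where
  smul_assoc l s x := by
    rw [smul_eq_C_smul, ← mul_smul, smul_eq_C_mul]

/-- The pure tensor `l ⊗ m`. -/
def tmul (l : L⟦X⟧) (m : M) : PowerSeriesBaseChange B M L := l ⊗ₜ[B⟦X⟧] m

theorem tmul_add (l : L⟦X⟧) (m m' : M) :
    (tmul l (m + m') : PowerSeriesBaseChange B M L) = tmul l m + tmul l m' :=
  TensorProduct.tmul_add _ _ _

theorem tmul_zero (l : L⟦X⟧) : (tmul l 0 : PowerSeriesBaseChange B M L) = 0 :=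
  TensorProduct.tmul_zero _ _

theorem smul_tmul (s l : L⟦X⟧) (m : M) :
    s • (tmul l m : PowerSeriesBaseChange B M L) = tmul (s * l) m := rfl

theorem tmul_eq_smul (l : L⟦X⟧) (m : M) :
    (tmul l m : PowerSeriesBaseChange B M L) = l • tmul 1 m := by
  rw [smul_tmul, mul_one]

theorem tmul_smul (s : B⟦X⟧) (l : L⟦X⟧) (m : M) :
    (tmul l (s • m) : PowerSeriesBaseChange B M L) =
      PowerSeries.map (algebraMap B L) s • tmul l m := by
  rw [smul_tmul, ← powerSeries_smul_def]
  exact (TensorProduct.smul_tmul s l m).symm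

@[elab_as_elim]
theorem induction_on {P : PowerSeriesBaseChange B M L → Prop} (x : PowerSeriesBaseChange B M L)
    (zero : P 0) (tmul : ∀ l m, P (tmul l m)) (add : ∀ x y, P x → P y → P (x + y)) : P x :=
  TensorProduct.induction_on (motive := P) x zero tmul add

theorem X_pow_smul {n : ℕ} (h : ∀ m : M, (X : B⟦X⟧) ^ n • m = 0)
    (x : PowerSeriesBaseChange B M L) : (X : L⟦X⟧) ^ n • x = 0 := by
  induction x using induction_on with
  | zero => rw [smul_zero]
  | tmul l m =>
    have := tmul_smul (L := L) ((X : B⟦X⟧) ^ n) l m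
    rw [h, tmul_zero, map_pow, map_X] at this
    exact this.symm
  | add x y hx hy => rw [smul_add, hx, hy, add_zero]

variable [Module B M] [IsScalarTower B B⟦X⟧ M]

/-- For a `B⟦X⟧`-module `M` killed by `X ^ n`, the map `L⟦X⟧ ⊗ M → L ⊗ M` sending `l ⊗ m` to
`∑ lₖ ⊗ X ^ k m`. -/
def truncTensor {n : ℕ} (h : ∀ m : M, (X : B⟦X⟧) ^ n • m = 0) :
    PowerSeriesBaseChange B M L →+ L ⊗[B] M :=
  TensorProduct.liftAddHom
    (AddMonoidHom.mk' (fun l => AddMonoidHom.mk'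
        (fun m => ∑ k ∈ Finset.range n, coeff k l ⊗ₜ[B] ((X : B⟦X⟧) ^ k • m))
        (by intro a b; simp only [smul_add, TensorProduct.tmul_add, Finset.sum_add_distrib]))
      (by intro a b; ext m; simp [TensorProduct.add_tmul, Finset.sum_add_distrib]))
    (by
      intro s l m
      change ∑ k ∈ Finset.range n, coeff k (s • l) ⊗ₜ[B] ((X : B⟦X⟧) ^ k • m) =
        ∑ k ∈ Finset.range n, coeff k l ⊗ₜ[B] ((X : B⟦X⟧) ^ k • s • m)
      have h0 : ∀ k, n ≤ k → (X : B⟦X⟧) ^ k • m = 0 := by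
        intro k hk
        obtain ⟨j, rfl⟩ := Nat.exists_eq_add_of_le' hk
        rw [pow_add, mul_smul, h, smul_zero]
      have h1 : ∀ k, coeff k (s • l) =
          ∑ p ∈ Finset.HasAntidiagonal.antidiagonal k, coeff p.1 s • coeff p.2 l := by
        intro k
        rw [powerSeries_smul_def, coeff_mul]
        simp [Algebra.smul_def]
      have e1 : ∀ k ∈ Finset.range n, coeff k (s • l) ⊗ₜ[B] ((X : B⟦X⟧) ^ k • m) =
          ∑ p ∈ Finset.HasAntidiagonal.antidiagonal k,
            coeff p.2 l ⊗ₜ[B] (coeff p.1 s • (X : B⟦X⟧) ^ (p.1 + p.2) • m) := by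
        intro k _
        rw [h1, TensorProduct.sum_tmul]
        refine Finset.sum_congr rfl fun p hp => ?_
        rw [TensorProduct.smul_tmul, Finset.HasAntidiagonal.mem_antidiagonal.1 hp]
      have e2 : ∀ k ∈ Finset.range n, coeff k l ⊗ₜ[B] ((X : B⟦X⟧) ^ k • s • m) =
          ∑ j ∈ Finset.range n, coeff k l ⊗ₜ[B] (coeff j s • (X : B⟦X⟧) ^ (j + k) • m) := by
        intro k _
        rw [smul_eq_sum_of_X_pow_smul_eq_zero (h m) s, Finset.smul_sum, TensorProduct.tmul_sum]
        refine Finset.sum_congr rfl fun j _ => ?_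
        rw [smul_comm, ← mul_smul, ← pow_add, add_comm]
      rw [Finset.sum_congr rfl e1, Finset.sum_congr rfl e2, Finset.sum_sigma', ← Finset.sum_product']
      symm
      -- Both sides collect the terms lₖ ⊗ sⱼ X^(j+k) m. On one side k and j are bounded separately
      -- by n, on the other k + j < n; the extra terms vanish because X^n kills M.
      refine Finset.sum_bij_ne_zero (fun p _ _ => ⟨p.1 + p.2, (p.2, p.1)⟩) ?_ ?_ ?_ ?_
      · intro p _ hp
        have : p.1 + p.2 < n := by
          by_contra hn
          exact hp (by rw [h0 _ (by omega), smul_zero, TensorProduct.tmul_zero])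
        simp [this, add_comm]
      · intro p _ _ p' _ _ hpp
        simp only [Sigma.mk.injEq] at hpp
        have := eq_of_heq hpp.2
        grind
      · rintro ⟨k, i, j⟩ hk hne
        simp only [Finset.mem_sigma, Finset.mem_range,
          Finset.HasAntidiagonal.mem_antidiagonal] at hk
        obtain ⟨hk, rfl⟩ := hk
        refine ⟨(j, i), ?_, ?_, ?_⟩
        · simp only [Finset.mem_product, Finset.mem_range]; omega
        · exact hne
        · simp [add_comm]
      · intro p _ _
        rfl)

theorem truncTensor_tmul {n : ℕ} (h : ∀ m : M, (X : B⟦X⟧) ^ n • m = 0) (l : L⟦X⟧) (m : M) :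
    truncTensor h (tmul l m) =
      ∑ k ∈ Finset.range n, coeff k l ⊗ₜ[B] ((X : B⟦X⟧) ^ k • m) := rfl

theorem truncTensor_smul {n : ℕ} (h : ∀ m : M, (X : B⟦X⟧) ^ n • m = 0) (l : L)
    (x : PowerSeriesBaseChange B M L) : truncTensor h (l • x) = l • truncTensor h x := by
  induction x using induction_on with
  | zero => rw [smul_zero, map_zero, smul_zero]
  | tmul a m =>
    rw [smul_eq_C_smul, smul_tmul, truncTensor_tmul, truncTensor_tmul, Finset.smul_sum]
    simp [TensorProduct.smul_tmul']
  | add x y hx hy => rw [smul_add, map_add, map_add, smul_add, hx, hy]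

theorem truncTensor_one_tmul {n : ℕ} (h : ∀ m : M, (X : B⟦X⟧) ^ n • m = 0) (m : M) :
    truncTensor h (tmul (1 : L⟦X⟧) m) = 1 ⊗ₜ[B] m := by
  rw [truncTensor_tmul]
  cases n with
  | zero =>
    have : m = 0 := by simpa using h m
    simp [this]
  | succ n =>
    rw [Finset.sum_range_succ', Finset.sum_eq_zero]
    · simp
    · intro k _
      simp [coeff_one]

theorem span_one_tmul_eq_top {n : ℕ} (h : ∀ m : M, (X : B⟦X⟧) ^ n • m = 0) {ι : Type*}
    (e : ι → M) (he : Submodule.span B (Set.range e) = ⊤) :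
    Submodule.span L (Set.range fun i => (tmul 1 (e i) : PowerSeriesBaseChange B M L)) = ⊤ := by
  have hm : ∀ m : M, (tmul 1 m : PowerSeriesBaseChange B M L) ∈
      Submodule.span L (Set.range fun i => (tmul 1 (e i) : PowerSeriesBaseChange B M L)) := by
    intro m
    have hmem : m ∈ Submodule.span B (Set.range e) := he ▸ Submodule.mem_top
    induction hmem using Submodule.span_induction with
    | mem x hx => obtain ⟨i, rfl⟩ := hx; exact Submodule.subset_span ⟨i, rfl⟩
    | zero => rw [tmul_zero]; exact zero_mem _
    | add x y _ _ hx hy => rw [tmul_add]; exact add_mem hx hy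
    | smul a x _ hx =>
      rw [← smul_one_smul B⟦X⟧ a x, tmul_smul, smul_eq_C_mul, mul_one, map_C, ← smul_eq_C_smul]
      exact Submodule.smul_mem _ _ hx
  rw [eq_top_iff]
  rintro x -
  induction x using induction_on with
  | zero => exact zero_mem _
  | tmul l m =>
    rw [tmul_eq_smul, smul_eq_sum_of_X_pow_smul_eq_zero (X_pow_smul h _)]
    refine Submodule.sum_mem _ fun k _ => Submodule.smul_mem _ _ ?_
    have := tmul_smul (L := L) ((X : B⟦X⟧) ^ k) 1 m
    rw [map_pow, map_X] at this
    rw [← this]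
    exact hm _
  | add x y hx hy => exact add_mem hx hy

/-- If `X ^ n` kills `M` then a `B`-basis of `M` gives an `L`-basis of `L⟦X⟧ ⊗ M`. -/
def basis {n : ℕ} (h : ∀ m : M, (X : B⟦X⟧) ^ n • m = 0) {ι : Type*}
    (b : Module.Basis ι B M) : Module.Basis ι L (PowerSeriesBaseChange B M L) :=
  Module.Basis.mk (v := fun i => tmul 1 (b i))
    (by
      let g : PowerSeriesBaseChange B M L →ₗ[L] L ⊗[B] M :=
        { toFun := truncTensor h
          map_add' := map_add _
          map_smul' := truncTensor_smul h }
      -- The images of 1 ⊗ bᵢ in L ⊗ M form the base-changed basis, so `truncTensor` detects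
      -- independence without being shown to be an isomorphism.
      apply LinearIndependent.of_comp g
      have : g ∘ (fun i => tmul 1 (b i)) = Module.Basis.baseChange L b := by
        ext i
        rw [Module.Basis.baseChange_apply]
        exact truncTensor_one_tmul h (b i)
      rw [this]
      exact Module.Basis.linearIndependent _)
    (span_one_tmul_eq_top h b b.span_eq).ge

theorem basis_apply {n : ℕ} (h : ∀ m : M, (X : B⟦X⟧) ^ n • m = 0) {ι : Type*}
    (b : Module.Basis ι B M) (i : ι) :
    basis (L := L) h b i = tmul 1 (b i) := by
  simp [basis]

end PowerSeriesBaseChange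

end PowerSeriesModule

/-! ### Frobenius-semilinear maps over separably closed fields -/

/-- The spans of initial segments form an ascending chain, which stabilises. It is applied to the
iterates of a semilinear map in Lang's theorem and to iterated q-th powers in the integrality
argument. -/
theorem exists_mem_span_image_Iio {R M : Type*} [Ring R] [AddCommGroup M] [Module R M]
    [IsNoetherian R M] (u : ℕ → M) : ∃ r, u r ∈ Submodule.span R (u '' Set.Iio r) := by
  obtain ⟨n, hn⟩ := monotone_stabilizes_iff_noetherian.2 ‹IsNoetherian R M›
    ⟨fun r => Submodule.span R (u '' Set.Iio r), fun a b hab =>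
      Submodule.span_mono (Set.image_mono (Set.Iio_subset_Iio hab))⟩
  refine ⟨n, ?_⟩
  have h : Submodule.span R (u '' Set.Iio n) = Submodule.span R (u '' Set.Iio (n + 1)) :=
    hn (n + 1) n.le_succ
  rw [h]
  exact Submodule.subset_span ⟨n, Nat.lt_succ_self n, rfl⟩

section FrobeniusSemilinear

variable (𝔽 : Type*) [Field 𝔽] [Fintype 𝔽]

theorem add_pow_fintype_card {B : Type*} [CommRing B] [Algebra 𝔽 B] (a b : B) :
    (a + b) ^ Fintype.card 𝔽 = a ^ Fintype.card 𝔽 + b ^ Fintype.card 𝔽 :=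
  map_add (FiniteField.frobeniusAlgHom 𝔽 B) a b

variable {L : Type*} [Field L] [Algebra 𝔽 L]

/-- X^q - X already splits over 𝔽, so it acquires no new roots in L. -/
theorem exists_algebraMap_eq_of_pow_card_eq {l : L} (h : l ^ Fintype.card 𝔽 = l) :
    ∃ a : 𝔽, algebraMap 𝔽 L a = l := by
  classical
  have h1 := FiniteField.roots_X_pow_card_sub_X 𝔽
  have hsplit : (Polynomial.X ^ Fintype.card 𝔽 - Polynomial.X : Polynomial 𝔽).Splits := by
    rw [Polynomial.splits_iff_card_roots, h1,
      FiniteField.X_pow_card_sub_X_natDegree_eq _ Fintype.one_lt_card]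
    rfl
  have h2 := hsplit.roots_map (algebraMap 𝔽 L)
  have hl : l ∈ ((Polynomial.X ^ Fintype.card 𝔽 - Polynomial.X : Polynomial 𝔽).map
      (algebraMap 𝔽 L)).roots := by
    rw [Polynomial.mem_roots (Polynomial.map_ne_zero
      (FiniteField.X_pow_card_sub_X_ne_zero 𝔽 Fintype.one_lt_card))]
    simp [h]
  rw [h2, Multiset.mem_map] at hl
  obtain ⟨a, -, ha⟩ := hl
  exact ⟨a, ha⟩

variable {V : Type*} [AddCommGroup V] [Module L V]

/-- An additive map `φ` with `φ (l • v) = l ^ #𝔽 • φ v`. -/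
def IsFrobeniusSemilinear (φ : V →+ V) : Prop :=
  ∀ (l : L) (v : V), φ (l • v) = l ^ Fintype.card 𝔽 • φ v

variable {𝔽} {φ : V →+ V}

namespace IsFrobeniusSemilinear

theorem map_sum_smul (hφ : IsFrobeniusSemilinear 𝔽 (L := L) φ) {ι : Type*} (s : Finset ι)
    (c : ι → L) (v : ι → V) :
    φ (∑ i ∈ s, c i • v i) = ∑ i ∈ s, c i ^ Fintype.card 𝔽 • φ (v i) := by
  rw [map_sum]
  exact Finset.sum_congr rfl fun i _ => hφ _ _

/-- Artin's argument: in a relation normalised to have one coefficient 1, subtracting its image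
under φ gives a relation on fewer vectors. By induction the latter is trivial, so all coefficients
satisfy a^q = a, lie in 𝔽, and contradict independence over 𝔽. -/
theorem linearIndependent_of_fixed (hφ : IsFrobeniusSemilinear 𝔽 (L := L) φ)
    [Module 𝔽 V] [IsScalarTower 𝔽 L V] {ι : Type*} {v : ι → V}
    (hfix : ∀ i, φ (v i) = v i) (hv : LinearIndependent 𝔽 v) : LinearIndependent L v := by
  classical
  rw [linearIndependent_iff']
  intro s
  induction s using Finset.induction_on with
  | empty => simp
  | insert i s his ih =>
    intro g hg
    by_cases hgi : g i = 0
    · rw [Finset.sum_insert his, hgi, zero_smul, zero_add] at hg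
      intro j hj
      obtain rfl | hj := Finset.mem_insert.1 hj
      · exact hgi
      · exact ih g hg j hj
    · exfalso
      set g' : ι → L := fun j => (g i)⁻¹ * g j with hg'
      have hsum : ∑ j ∈ insert i s, g' j • v j = 0 := by
        simp only [hg', mul_smul, ← Finset.smul_sum, hg, smul_zero]
      have hg'i : g' i = 1 := inv_mul_cancel₀ hgi
      have hsum' : ∑ j ∈ insert i s, g' j ^ Fintype.card 𝔽 • v j = 0 := by
        have := congrArg φ hsum
        rw [hφ.map_sum_smul, map_zero] at this
        simpa only [hfix] using this
      have hdiff : ∑ j ∈ s, (g' j ^ Fintype.card 𝔽 - g' j) • v j = 0 := by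
        have : ∑ j ∈ insert i s, (g' j ^ Fintype.card 𝔽 - g' j) • v j = 0 := by
          simp only [sub_smul, Finset.sum_sub_distrib, hsum, hsum', sub_zero]
        rwa [Finset.sum_insert his, hg'i, one_pow, sub_self, zero_smul, zero_add] at this
      have hF : ∀ j ∈ insert i s, ∃ a : 𝔽, algebraMap 𝔽 L a = g' j := by
        intro j hj
        apply exists_algebraMap_eq_of_pow_card_eq
        obtain rfl | hj := Finset.mem_insert.1 hj
        · rw [hg'i, one_pow]
        · exact sub_eq_zero.1 (ih _ hdiff j hj)
      choose! a ha using hF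
      have ha0 : ∑ j ∈ insert i s, a j • v j = 0 := by
        rw [← hsum]
        exact Finset.sum_congr rfl fun j hj => by rw [← ha j hj, algebraMap_smul]
      have := linearIndependent_iff'.1 hv _ _ ha0 i (Finset.mem_insert_self i s)
      have h1 := ha i (Finset.mem_insert_self i s)
      rw [this, map_zero, hg'i] at h1
      exact zero_ne_one h1

theorem range_subset_span (hφ : IsFrobeniusSemilinear 𝔽 (L := L) φ) {s : Set V}
    (hs : Submodule.span L s = ⊤) (x : V) : φ x ∈ Submodule.span L (φ '' s) := by
  have hx : x ∈ Submodule.span L s := hs ▸ Submodule.mem_top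
  induction hx using Submodule.span_induction with
  | mem x hx => exact Submodule.subset_span ⟨x, hx, rfl⟩
  | zero => rw [map_zero]; exact zero_mem _
  | add x y _ _ hx hy => rw [map_add]; exact add_mem hx hy
  | smul a x _ hx => rw [hφ]; exact Submodule.smul_mem _ _ hx

/-- Extend the family to a basis. Its image under φ spans the range of φ, hence V, and has dim V
members, so it is again a basis. -/
theorem linearIndependent_comp [FiniteDimensional L V]
    (hφ : IsFrobeniusSemilinear 𝔽 (L := L) φ)
    (hspan : Submodule.span L (Set.range φ) = ⊤) {ι : Type*} {v : ι → V}
    (hv : LinearIndependent L v) : LinearIndependent L (fun i => φ (v i)) := by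
  have hs : LinearIndepOn L id (Set.range v) := hv.linearIndepOn_id
  let b := Module.Basis.extend hs
  have hfin := Module.Finite.finite_basis b
  let := Fintype.ofFinite (hs.extend (Set.subset_univ _))
  have hli : LinearIndependent L (fun i => φ (b i)) := by
    apply linearIndependent_of_top_le_span_of_card_eq_finrank
    · rw [← hspan, Submodule.span_le]
      rintro _ ⟨x, rfl⟩
      have := hφ.range_subset_span b.span_eq x
      rwa [← Set.range_comp] at this
    · exact (Module.finrank_eq_card_basis b).symm
  have hmem : ∀ i, v i ∈ hs.extend (Set.subset_univ _) := fun i =>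
    hs.subset_extend _ ⟨i, rfl⟩
  have hinj : Function.Injective fun i => (⟨v i, hmem i⟩ : hs.extend (Set.subset_univ _)) :=
    fun i j hij => hv.injective (congrArg Subtype.val hij)
  have := hli.comp _ hinj
  simpa [b, Function.comp_def] using this

end IsFrobeniusSemilinear

/-- The polynomials `xᵢ` in the unknown `Y` with `x₀ = a₀ Y ^ q` and `xᵢ₊₁ = xᵢ ^ q + aᵢ₊₁ Y ^ q`. -/
def fixedVectorPoly (q : ℕ) (a : ℕ → L) : ℕ → Polynomial L
  | 0 => Polynomial.C (a 0) * Polynomial.X ^ q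
  | i + 1 => fixedVectorPoly q a i ^ q + Polynomial.C (a (i + 1)) * Polynomial.X ^ q

theorem natDegree_fixedVectorPoly {q : ℕ} (hq : 1 < q) {a : ℕ → L} (h0 : a 0 ≠ 0) (i : ℕ) :
    (fixedVectorPoly q a i).natDegree = q ^ (i + 1) := by
  induction i with
  | zero => simp [fixedVectorPoly, Polynomial.natDegree_C_mul_X_pow q _ h0]
  | succ i ih =>
    rw [fixedVectorPoly, Polynomial.natDegree_add_eq_left_of_natDegree_lt,
      Polynomial.natDegree_pow, ih, pow_succ' q (i + 1)]
    rw [Polynomial.natDegree_pow, ih]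
    refine (Polynomial.natDegree_C_mul_X_pow_le _ _).trans_lt ?_
    rw [← pow_succ']
    exact lt_self_pow₀ hq (by omega)

theorem derivative_fixedVectorPoly {q : ℕ} (hq : (q : L) = 0) (a : ℕ → L) (i : ℕ) :
    Polynomial.derivative (fixedVectorPoly q a i) = 0 := by
  cases i <;> simp [fixedVectorPoly, Polynomial.derivative_pow, hq]

/-- The derivative is -1, since every other term is a q-th power or a multiple of Y^q and q = 0 in
L. Hence over a separably closed field there are as many roots as the degree. -/
theorem separable_fixedVectorPoly_sub_X {q : ℕ} (hq : (q : L) = 0) (a : ℕ → L) (i : ℕ) :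
    (fixedVectorPoly q a i - Polynomial.X).Separable := by
  rw [Polynomial.separable_def]
  simp only [Polynomial.derivative_sub, derivative_fixedVectorPoly hq, Polynomial.derivative_X,
    zero_sub]
  exact isCoprime_one_right.neg_right

/-- **Lang's theorem** for Frobenius-semilinear maps: an étale Frobenius-semilinear map over a
separably closed field has a basis of fixed vectors. -/
theorem IsFrobeniusSemilinear.span_fixed_eq_top [IsSepClosed L] [FiniteDimensional L V]
    (hφ : IsFrobeniusSemilinear 𝔽 (L := L) φ) (hspan : Submodule.span L (Set.range φ) = ⊤) :
    Submodule.span L {v | φ v = v} = ⊤ := by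
  classical
  rw [eq_top_iff]
  rintro v -
  -- With r = s + 1 minimal, v, φ v, ..., φ^s v is a basis of the smallest φ-stable subspace W
  -- containing v. It suffices to span W by fixed vectors.
  have hex := exists_mem_span_image_Iio (R := L) (fun n => φ^[n] v)
  have hmin := fun m => Nat.find_min hex (m := m)
  have hr := Nat.find_spec hex
  set r := Nat.find hex with hrdef
  clear_value r
  cases r with
  | zero =>
    have : v = 0 := by simpa using hr
    rw [this]
    exact zero_mem _
  | succ s =>
  set w : Fin (s + 1) → V := fun i => φ^[i] v with hw
  have himage : ∀ k, (fun n => φ^[n] v) '' Set.Iio k = Set.range fun i : Fin k => φ^[i] v := by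
    intro k
    ext x
    constructor
    · rintro ⟨n, hn, rfl⟩; exact ⟨⟨n, hn⟩, rfl⟩
    · rintro ⟨n, rfl⟩; exact ⟨n, n.2, rfl⟩
  have hli : ∀ k ≤ s + 1, LinearIndependent L (fun i : Fin k => φ^[i] v) := by
    intro k hk
    induction k with
    | zero => exact linearIndependent_empty_type
    | succ k ih =>
      rw [linearIndependent_finSucc']
      refine ⟨ih (by omega), ?_⟩
      have := hmin k (by omega)
      rwa [himage] at this
  have hwli : LinearIndependent L w := hli _ le_rfl
  rw [himage, Submodule.mem_span_range_iff_exists_fun] at hr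
  obtain ⟨a', ha'⟩ := hr
  set a : ℕ → L := fun i => if h : i < s + 1 then a' ⟨i, h⟩ else 0 with ha
  have hrel : φ^[s + 1] v = ∑ i ∈ Finset.range (s + 1), a i • φ^[i] v := by
    rw [Finset.sum_range, ← ha']
    exact Finset.sum_congr rfl fun i _ => by simp only [ha, i.2, dif_pos, Fin.eta]
  -- Otherwise φ(φ^s v) would be a combination of the φ(φ^i v) with i < s, although φ preserves
  -- independence.
  have ha0 : a 0 ≠ 0 := by
    intro h0
    have hφw := hφ.linearIndependent_comp hspan hwli
    rw [linearIndependent_finSucc'] at hφw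
    apply hφw.2
    rw [Submodule.mem_span_range_iff_exists_fun]
    refine ⟨fun i => a (i + 1), ?_⟩
    have h1 : φ (w (Fin.last s)) = φ^[s + 1] v := (Function.iterate_succ_apply' φ s v).symm
    rw [h1, hrel, Finset.sum_range_succ', h0, zero_smul, add_zero, Finset.sum_range]
    exact Finset.sum_congr rfl fun i _ => by
      rw [Function.iterate_succ_apply']
      rfl
  set q := Fintype.card 𝔽 with hq
  have hq1 : 1 < q := Fintype.one_lt_card
  have hq0 : (q : L) = 0 := by
    have := congrArg (algebraMap 𝔽 L) (FiniteField.cast_card_eq_zero 𝔽)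
    rwa [map_natCast, map_zero] at this
  -- For u = ∑ xᵢ φ^i v with xₛ = y, comparing coefficients in φ u = u forces x₀ = a₀ y^q and xᵢ₊₁ =
  -- xᵢ^q + aᵢ₊₁ y^q. The one remaining condition xₛ = y says that y is a root of P, of degree
  -- q^(s+1).
  set P := fixedVectorPoly q a s - Polynomial.X with hP
  have hdeg : P.natDegree = q ^ (s + 1) := by
    rw [hP, Polynomial.natDegree_sub_eq_left_of_natDegree_lt, natDegree_fixedVectorPoly hq1 ha0]
    rw [natDegree_fixedVectorPoly hq1 ha0, Polynomial.natDegree_X]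
    exact Nat.one_lt_pow (by omega) hq1
  have hsep : P.Separable := separable_fixedVectorPoly_sub_X hq0 a s
  have hcard : P.roots.toFinset.card = q ^ (s + 1) := by
    rw [Multiset.toFinset_card_of_nodup (Polynomial.nodup_roots hsep),
      Polynomial.splits_iff_card_roots.1 (IsSepClosed.splits_of_separable P hsep), hdeg]
  let x : L → ℕ → L := fun y i => (fixedVectorPoly q a i).eval y
  let u : L → V := fun y => ∑ i ∈ Finset.range (s + 1), x y i • φ^[i] v
  have hroot : ∀ y ∈ P.roots.toFinset, x y s = y := by
    intro y hy
    rw [Multiset.mem_toFinset] at hy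
    have := Polynomial.isRoot_of_mem_roots hy
    rw [Polynomial.IsRoot.def, hP, Polynomial.eval_sub, Polynomial.eval_X] at this
    exact sub_eq_zero.1 this
  have hfix : ∀ y ∈ P.roots.toFinset, φ (u y) = u y := by
    intro y hy
    have h1 : φ (u y) = ∑ i ∈ Finset.range (s + 1), x y i ^ q • φ^[i + 1] v := by
      rw [hφ.map_sum_smul]
      exact Finset.sum_congr rfl fun i _ => by rw [Function.iterate_succ_apply']
    have h2 : u y = ∑ i ∈ Finset.range s, x y i ^ q • φ^[i + 1] v +
        ∑ i ∈ Finset.range (s + 1), (y ^ q * a i) • φ^[i] v := by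
      change ∑ i ∈ Finset.range (s + 1), x y i • φ^[i] v = _
      rw [Finset.sum_range_succ', Finset.sum_range_succ' _ s, ← add_assoc,
        ← Finset.sum_add_distrib]
      congr 1
      · refine Finset.sum_congr rfl fun i _ => ?_
        rw [← add_smul]
        congr 1
        simp [x, fixedVectorPoly, mul_comm (y ^ q)]
      · simp [x, fixedVectorPoly, mul_comm (y ^ q)]
    rw [h1, h2, Finset.sum_range_succ, hroot y hy, hrel, Finset.smul_sum]
    simp only [mul_smul]
  have huW : ∀ y, u y ∈ Submodule.span L (Set.range w) := fun y =>
    Submodule.sum_mem _ fun i hi => Submodule.smul_mem _ _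
      (Submodule.subset_span ⟨⟨i, Finset.mem_range.1 hi⟩, rfl⟩)
  -- The root is recovered from u y as its coefficient at φ^s v.
  have huinj : ∀ y ∈ P.roots.toFinset, ∀ y' ∈ P.roots.toFinset, u y = u y' → y = y' := by
    intro y hy y' hy' h
    have h' : ∑ i : Fin (s + 1), (x y i - x y' i) • w i = 0 := by
      simp only [sub_smul, Finset.sum_sub_distrib]
      have := sub_eq_zero.2 h
      simpa only [u, Finset.sum_range] using this
    have := Fintype.linearIndependent_iff.1 hwli _ h' (Fin.last s)
    rw [Fin.val_last, hroot y hy, hroot y' hy'] at this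
    exact sub_eq_zero.1 this
  obtain ⟨b, hb, hbspan, hbli⟩ := exists_linearIndependent L (u '' P.roots.toFinset)
  have hbfin : b.Finite := (P.roots.toFinset.finite_toSet.image u).subset hb
  let := hbfin.fintype
  have hbfix : ∀ i : b, φ i = i := by
    intro i
    obtain ⟨y, hy, hyi⟩ := hb i.2
    rw [← hyi]
    exact hfix y hy
  have hcoord : ∀ y ∈ P.roots.toFinset, ∃ c : b → 𝔽,
      u y = ∑ i, algebraMap 𝔽 L (c i) • (i : V) := by
    intro y hy
    have hmem : u y ∈ Submodule.span L (Set.range (Subtype.val : b → V)) := by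
      rw [Subtype.range_coe, hbspan]
      exact Submodule.subset_span ⟨y, hy, rfl⟩
    obtain ⟨c, hc⟩ := (Submodule.mem_span_range_iff_exists_fun L).1 hmem
    have hc' : ∑ i : b, (c i ^ q - c i) • (i : V) = 0 := by
      simp only [sub_smul, Finset.sum_sub_distrib, hc]
      rw [sub_eq_zero, ← hfix y hy, ← hc, hφ.map_sum_smul]
      simp only [hbfix, hq]
    have hci := fun i => sub_eq_zero.1 (Fintype.linearIndependent_iff.1 hbli _ hc' i)
    choose d hd using fun i => exists_algebraMap_eq_of_pow_card_eq 𝔽 (hci i)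
    exact ⟨d, by simp only [hd, hc]⟩
  choose! c hc using hcoord
  -- Counting: the q^(s+1) fixed vectors have coordinates in 𝔽 with respect to the independent fixed
  -- vectors b, so b has at least s + 1 = dim W elements and spans W.
  have hle : q ^ (s + 1) ≤ q ^ Fintype.card b := by
    rw [← hcard]
    have h := Finset.card_le_card_of_injOn c (t := (Finset.univ : Finset (b → 𝔽)))
      (fun _ _ => Finset.mem_univ _) (s := P.roots.toFinset) (fun y hy y' hy' h =>
        huinj y hy y' hy' (by rw [hc y hy, hc y' hy', h]))
    simpa using h
  have hle' := (Nat.pow_le_pow_iff_right hq1).1 hle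
  have hbW : Submodule.span L b ≤ Submodule.span L (Set.range w) := by
    rw [hbspan, Submodule.span_le]
    rintro _ ⟨y, -, rfl⟩
    exact huW y
  have heq : Submodule.span L b = Submodule.span L (Set.range w) := by
    apply Submodule.eq_of_le_of_finrank_le hbW
    rw [finrank_span_eq_card hwli, Fintype.card_fin]
    have := finrank_span_eq_card hbli
    rw [Subtype.range_coe] at this
    rwa [this]
  have hv : v ∈ Submodule.span L (Set.range w) := Submodule.subset_span ⟨0, rfl⟩
  rw [← heq] at hv
  exact Submodule.span_mono (fun z hz => hbfix ⟨z, hz⟩) hv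

end FrobeniusSemilinear

/-! ### Integrality and flatness -/

section Integrality

variable (𝔽 : Type*) [Field 𝔽] [Fintype 𝔽] {R : Type*} [CommRing R] [IsNoetherianRing R]
  {L : Type*} [Field L] [Algebra R L]

/-- All y^(q^k) lie in one Noetherian module, so some y^(q^r) is a combination of earlier ones. This
is a monic equation for y because the exponents q^i increase strictly. -/
theorem isIntegral_of_mem_of_pow_mem {q : ℕ} (hq : 1 < q) (P : Submodule R L) (hP : P.FG)
    (hPq : ∀ y ∈ P, y ^ q ∈ P) {y : L} (hy : y ∈ P) : IsIntegral R y := by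
  have hmem : ∀ k, y ^ q ^ k ∈ P := by
    intro k
    induction k with
    | zero => simpa using hy
    | succ k ih => rw [pow_succ, pow_mul]; exact hPq _ ih
  have : IsNoetherian R P := isNoetherian_of_fg_of_noetherian P hP
  obtain ⟨r, hr⟩ := exists_mem_span_image_Iio (R := R) (fun k => (⟨y ^ q ^ k, hmem k⟩ : P))
  have hr' : y ^ q ^ r ∈ Submodule.span R ((fun k => y ^ q ^ k) '' Set.Iio r) := by
    have := Submodule.mem_map_of_mem (f := P.subtype) hr
    rw [Submodule.map_span, ← Set.image_comp] at this
    exact this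
  rw [Submodule.mem_span_image_iff_exists_fun] at hr'
  obtain ⟨t, ht, c, hc⟩ := hr'
  set p : Polynomial R := Polynomial.X ^ q ^ r -
    ∑ i : t, Polynomial.C (c i) * Polynomial.X ^ q ^ (i : ℕ)
  refine ⟨p, ?_, ?_⟩
  · apply Polynomial.monic_X_pow_sub
    refine (Polynomial.degree_sum_le _ _).trans_lt ((Finset.sup_lt_iff (WithBot.bot_lt_coe _)).2 ?_)
    intro i _
    refine (Polynomial.degree_C_mul_X_pow_le _ _).trans_lt ?_
    exact_mod_cast Nat.pow_lt_pow_right hq (ht i.2)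
  · simp [p, Polynomial.eval₂_finsetSum, ← hc, Algebra.smul_def]

/-- If each `x i ^ q` is an `R`-linear combination of the `x j` then the `x i` are integral. -/
theorem isIntegral_of_pow_mem_span [Algebra 𝔽 L] {ι : Type*} [Finite ι] (x : ι → L)
    (hx : ∀ i, x i ^ Fintype.card 𝔽 ∈ Submodule.span R (Set.range x)) (i : ι) :
    IsIntegral R (x i) := by
  refine isIntegral_of_mem_of_pow_mem (Fintype.one_lt_card (α := 𝔽)) (Submodule.span R (Set.range x))
    (Submodule.fg_span (Set.finite_range x)) ?_ (Submodule.subset_span ⟨i, rfl⟩)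
  intro y hy
  induction hy using Submodule.span_induction with
  | mem y hy => obtain ⟨i, rfl⟩ := hy; exact hx i
  | zero => rw [zero_pow Fintype.card_ne_zero]; exact zero_mem _
  | add y z _ _ hy hz => rw [add_pow_fintype_card]; exact add_mem hy hz
  | smul a y _ hy => rw [smul_pow]; exact Submodule.smul_mem _ _ hy

end Integrality

/-! ### Finiteness of modules on which the variable is nilpotent -/

section Nilpotent

open PowerSeries

theorem exists_X_pow_smul_eq_zero {B : Type*} [CommRing B] {M : Type*} [AddCommGroup M]
    [Module B⟦X⟧ M] [Module.Finite B⟦X⟧ M] (h : ∀ m : M, ∃ n : ℕ, (X : B⟦X⟧) ^ n • m = 0) :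
    ∃ n : ℕ, ∀ m : M, (X : B⟦X⟧) ^ n • m = 0 := by
  obtain ⟨s, hs⟩ := (inferInstance : Module.Finite B⟦X⟧ M).fg_top
  choose k hk using h
  refine ⟨s.sup k, fun m => ?_⟩
  have hm : m ∈ Submodule.span B⟦X⟧ (s : Set M) := hs ▸ Submodule.mem_top
  induction hm using Submodule.span_induction with
  | mem x hx =>
    obtain ⟨j, hj⟩ := Nat.exists_eq_add_of_le' (Finset.le_sup (f := k) hx)
    rw [hj, pow_add, mul_smul, hk, smul_zero]
  | zero => rw [smul_zero]
  | add x y _ _ hx hy => rw [smul_add, hx, hy, add_zero]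
  | smul a x _ hx => rw [smul_comm, hx, smul_zero]

theorem finite_of_X_pow_smul_eq_zero {B : Type*} [CommRing B] {M : Type*} [AddCommGroup M]
    [Module B⟦X⟧ M] [Module B M] [IsScalarTower B B⟦X⟧ M] [Module.Finite B⟦X⟧ M] {n : ℕ}
    (h : ∀ m : M, (X : B⟦X⟧) ^ n • m = 0) : Module.Finite B M := by
  classical
  obtain ⟨s, hs⟩ := (inferInstance : Module.Finite B⟦X⟧ M).fg_top
  let t : Finset M := (Finset.range n ×ˢ s).image fun p => (X : B⟦X⟧) ^ p.1 • p.2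
  refine ⟨⟨t, ?_⟩⟩
  have hX : ∀ x ∈ (t : Set M), (X : B⟦X⟧) • x ∈ Submodule.span B (t : Set M) := by
    intro x hx
    obtain ⟨⟨k, m⟩, hkm, rfl⟩ := Finset.mem_image.1 hx
    rw [Finset.mem_product, Finset.mem_range] at hkm
    simp only [← mul_smul, ← pow_succ']
    by_cases hk : k + 1 < n
    · exact Submodule.subset_span (Finset.mem_image.2
        ⟨(k + 1, m), Finset.mem_product.2 ⟨Finset.mem_range.2 hk, hkm.2⟩, rfl⟩)
    · have : n = k + 1 := by omega
      rw [← this, h]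
      exact zero_mem _
  have h1 := coe_span_powerSeries_eq h hX
  have h2 : Submodule.span B⟦X⟧ (t : Set M) = ⊤ := by
    rw [eq_top_iff, ← hs, Submodule.span_le]
    intro m hm
    -- For n = 0 the set t is empty, and M is zero.
    by_cases hn : n = 0
    · subst hn
      have : m = 0 := by simpa using h m
      rw [this]
      exact zero_mem _
    · exact Submodule.subset_span (Finset.mem_image.2
        ⟨(0, m), Finset.mem_product.2 ⟨Finset.mem_range.2 (by omega), hm⟩, by simp⟩)
  rw [h2] at h1
  exact SetLike.coe_injective h1.symm

end Nilpotent

/-! ### The space `L⟦z⟧ ⊗ T` attached to a torsion representation -/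

namespace TorsionRep

section Space

open PowerSeries

variable {𝔽 : Type w} [Field 𝔽] {K : Type*} [Field K] {L : Type v} [Field L] [Algebra K L]

theorem exists_X_pow_smul (T : TorsionRep 𝔽 K L) :
    ∃ n : ℕ, ∀ t : T.carrier, (X : 𝔽⟦X⟧) ^ n • t = 0 := by
  have : Module.Finite 𝔽⟦X⟧ T.carrier := by
    have := (isFiniteLength_iff_isNoetherian_isArtinian.1 T.finiteLength).1
    infer_instance
  apply exists_X_pow_smul_eq_zero
  intro t
  obtain ⟨⟨s, hs⟩, hst⟩ := T.torsion (x := t)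
  have hs0 : s ≠ 0 := nonZeroDivisors.ne_zero hs
  refine ⟨s.order.toNat, ?_⟩
  -- A nonzero series is a unit times a power of z, so torsion over 𝔽⟦z⟧ means z-power torsion.
  have h1 : (X : 𝔽⟦X⟧) ^ s.order.toNat =
      ((Unit_of_divided_by_X_pow_order s)⁻¹ : 𝔽⟦X⟧ˣ) * s := by
    rw [Units.eq_inv_mul_iff_mul_eq, Unit_of_divided_by_X_pow_order_nonzero hs0, mul_comm,
      X_pow_order_mul_divXPowOrder]
  rw [h1, mul_smul]
  exact (congrArg _ hst).trans (smul_zero _)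

/-- `𝔽` acts on a torsion representation through `𝔽⟦z⟧`. -/
instance (T : TorsionRep 𝔽 K L) : Module 𝔽 T.carrier :=
  Module.compHom T.carrier (C : 𝔽 →+* 𝔽⟦X⟧)

instance (T : TorsionRep 𝔽 K L) : IsScalarTower 𝔽 𝔽⟦X⟧ T.carrier where
  smul_assoc a s t := by
    rw [smul_eq_C_mul, mul_smul]
    rfl

instance (T : TorsionRep 𝔽 K L) : Module.Finite 𝔽 T.carrier := by
  obtain ⟨n, hn⟩ := T.exists_X_pow_smul
  have : Module.Finite 𝔽⟦X⟧ T.carrier := by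
    have := (isFiniteLength_iff_isNoetherian_isArtinian.1 T.finiteLength).1
    infer_instance
  exact finite_of_X_pow_smul_eq_zero hn

variable [Algebra 𝔽 L]

/-- The space `L⟦z⟧ ⊗ T`. -/
def Space (T : TorsionRep 𝔽 K L) : Type v := PowerSeriesBaseChange 𝔽 T.carrier L

variable (T : TorsionRep 𝔽 K L)

instance : AddCommGroup T.Space :=
  inferInstanceAs (AddCommGroup (PowerSeriesBaseChange 𝔽 T.carrier L))

instance : Module L⟦X⟧ T.Space :=
  inferInstanceAs (Module L⟦X⟧ (PowerSeriesBaseChange 𝔽 T.carrier L))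

instance : Module L T.Space :=
  inferInstanceAs (Module L (PowerSeriesBaseChange 𝔽 T.carrier L))

instance : IsScalarTower L L⟦X⟧ T.Space :=
  inferInstanceAs (IsScalarTower L L⟦X⟧ (PowerSeriesBaseChange 𝔽 T.carrier L))

/-- The map `T → L⟦z⟧ ⊗ T`. -/
def incl : T.carrier →+ T.Space where
  toFun t := PowerSeriesBaseChange.tmul 1 t
  map_zero' := PowerSeriesBaseChange.tmul_zero _
  map_add' := PowerSeriesBaseChange.tmul_add _

@[elab_as_elim]
theorem Space.induction_on {T : TorsionRep 𝔽 K L} {P : T.Space → Prop} (x : T.Space)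
    (zero : P 0) (smul_incl : ∀ (l : L⟦X⟧) t, P (l • T.incl t))
    (add : ∀ x y, P x → P y → P (x + y)) : P x :=
  PowerSeriesBaseChange.induction_on (P := P) x zero
    (fun l t => (PowerSeriesBaseChange.tmul_eq_smul (B := 𝔽) l t).symm ▸ smul_incl l t) add

theorem incl_smul (s : 𝔽⟦X⟧) (t : T.carrier) :
    T.incl (s • t) = PowerSeries.map (algebraMap 𝔽 L) s • T.incl t :=
  PowerSeriesBaseChange.tmul_smul s 1 t

theorem incl_field_smul (a : 𝔽) (t : T.carrier) :
    T.incl (a • t) = algebraMap 𝔽 L a • T.incl t := by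
  have := T.incl_smul (C a) t
  rwa [map_C] at this

theorem exists_X_pow_smul_space : ∃ n : ℕ, ∀ x : T.Space, (X : L⟦X⟧) ^ n • x = 0 := by
  obtain ⟨n, hn⟩ := T.exists_X_pow_smul
  exact ⟨n, PowerSeriesBaseChange.X_pow_smul hn⟩

/-- An `L`-basis of `L⟦z⟧ ⊗ T` from an `𝔽`-basis of `T`. -/
def basis : Module.Basis (Module.Free.ChooseBasisIndex 𝔽 T.carrier) L T.Space :=
  PowerSeriesBaseChange.basis T.exists_X_pow_smul.choose_spec (Module.Free.chooseBasis 𝔽 T.carrier)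

theorem basis_apply (i) : T.basis i = T.incl (Module.Free.chooseBasis 𝔽 T.carrier i) :=
  PowerSeriesBaseChange.basis_apply _ _ i

instance : FiniteDimensional L T.Space := Module.Finite.of_basis T.basis

theorem span_range_incl : Submodule.span L (Set.range T.incl) = ⊤ := by
  rw [eq_top_iff, ← T.basis.span_eq]
  apply Submodule.span_mono
  rintro _ ⟨i, rfl⟩
  exact ⟨_, (T.basis_apply i).symm⟩

/-- Additive maps that are semilinear over a ring endomorphism and agree on `T` are equal. -/
theorem Space.hom_ext {T : TorsionRep 𝔽 K L} {A : Type*} [AddCommGroup A] [Module L⟦X⟧ A]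
    (σ : L⟦X⟧ →+* L⟦X⟧) {f g : T.Space →+ A}
    (hf : ∀ (l : L⟦X⟧) x, f (l • x) = σ l • f x) (hg : ∀ (l : L⟦X⟧) x, g (l • x) = σ l • g x)
    (h : ∀ t, f (T.incl t) = g (T.incl t)) (x : T.Space) : f x = g x := by
  induction x using Space.induction_on with
  | zero => rw [map_zero, map_zero]
  | smul_incl l t => rw [hf, hg, h]
  | add x y hx hy => rw [map_add, map_add, hx, hy]

/-- The additive map `L⟦z⟧ ⊗ T → A`, `l ⊗ t ↦ σ l • f t`. -/
def lift {A : Type*} [AddCommGroup A] [Module L⟦X⟧ A] (σ : L⟦X⟧ →+* L⟦X⟧) (f : T.carrier →+ A)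
    (hf : ∀ (s : 𝔽⟦X⟧) (t : T.carrier),
      f (s • t) = σ (PowerSeries.map (algebraMap 𝔽 L) s) • f t) : T.Space →+ A :=
  TensorProduct.liftAddHom (R := 𝔽⟦X⟧) (M := L⟦X⟧) (N := T.carrier)
    (AddMonoidHom.mk' (fun l => AddMonoidHom.mk' (fun t => σ l • f t)
        (by intro a b; rw [map_add, smul_add]))
      (by intro a b; ext m; simp [add_smul]))
    (by
      intro s l t
      change σ (s • l) • f t = σ l • f (s • t)
      rw [hf, powerSeries_smul_def, map_mul, mul_comm, mul_smul])

theorem lift_smul_incl {A : Type*} [AddCommGroup A] [Module L⟦X⟧ A] (σ : L⟦X⟧ →+* L⟦X⟧)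
    (f : T.carrier →+ A) (hf) (l : L⟦X⟧) (t : T.carrier) :
    T.lift σ f hf (l • T.incl t) = σ l • f t := by
  have : l • T.incl t = (PowerSeriesBaseChange.tmul l t : PowerSeriesBaseChange 𝔽 T.carrier L) :=
    (PowerSeriesBaseChange.tmul_eq_smul l t).symm
  rw [this]
  rfl

theorem lift_incl {A : Type*} [AddCommGroup A] [Module L⟦X⟧ A] (σ : L⟦X⟧ →+* L⟦X⟧)
    (f : T.carrier →+ A) (hf) (t : T.carrier) :
    T.lift σ f hf (T.incl t) = f t := by
  have := T.lift_smul_incl σ f hf 1 t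
  rwa [one_smul, map_one, one_smul] at this

theorem lift_smul {A : Type*} [AddCommGroup A] [Module L⟦X⟧ A] (σ : L⟦X⟧ →+* L⟦X⟧)
    (f : T.carrier →+ A) (hf) (l : L⟦X⟧) (x : T.Space) :
    T.lift σ f hf (l • x) = σ l • T.lift σ f hf x := by
  induction x using Space.induction_on with
  | zero => rw [smul_zero, map_zero, smul_zero]
  | smul_incl s t => rw [← mul_smul, lift_smul_incl, lift_smul_incl, map_mul, mul_smul]
  | add x y hx hy => rw [smul_add, map_add, map_add, smul_add, hx, hy]

end Space

end TorsionRep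

section Sigma

open PowerSeries

variable {𝔽 : Type*} [Field 𝔽] [Fintype 𝔽] {B : Type*} [CommRing B] [Algebra 𝔽 B]

theorem sigma_C (b : B) : sigma 𝔽 B (C b) = C (b ^ Fintype.card 𝔽) := by
  simp [sigma]

theorem sigma_X : sigma 𝔽 B X = X := by
  simp [sigma]

theorem sigma_map_algebraMap (s : 𝔽⟦X⟧) :
    sigma 𝔽 B (PowerSeries.map (algebraMap 𝔽 B) s) = PowerSeries.map (algebraMap 𝔽 B) s := by
  ext n
  simp [sigma]

end Sigma

namespace TorsionRep

section Structure

open PowerSeries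

variable {𝔽 : Type w} [Field 𝔽] [Fintype 𝔽] {K : Type*} [Field K] {L : Type v} [Field L]
  [Algebra K L] [Algebra 𝔽 L]

/-- The Frobenius `σ̂ ⊗ id` of `L⟦z⟧ ⊗ T`. -/
def frob (T : TorsionRep 𝔽 K L) : T.Space →+ T.Space :=
  T.lift (sigma 𝔽 L) T.incl (fun s t => by rw [incl_smul, sigma_map_algebraMap])

theorem frob_smul (T : TorsionRep 𝔽 K L) (l : L⟦X⟧) (x : T.Space) :
    T.frob (l • x) = sigma 𝔽 L l • T.frob x := T.lift_smul _ _ _ l x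

theorem frob_incl (T : TorsionRep 𝔽 K L) (t : T.carrier) : T.frob (T.incl t) = T.incl t :=
  T.lift_incl _ _ _ t

theorem isFrobeniusSemilinear_frob (T : TorsionRep 𝔽 K L) :
    IsFrobeniusSemilinear 𝔽 (L := L) T.frob := by
  intro l x
  have := T.frob_smul (C l) x
  rwa [sigma_C] at this

theorem span_range_frob (T : TorsionRep 𝔽 K L) : Submodule.span L (Set.range T.frob) = ⊤ := by
  rw [eq_top_iff, ← T.span_range_incl]
  apply Submodule.span_mono
  rintro _ ⟨t, rfl⟩
  exact ⟨_, T.frob_incl t⟩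

/-- The fixed vectors of the Frobenius are the elements of `T`. -/
theorem frob_eq_self_iff {T : TorsionRep 𝔽 K L} {x : T.Space} :
    T.frob x = x ↔ ∃ t, T.incl t = x := by
  constructor
  · intro h
    have h1 : ∑ i, T.basis.repr x i • T.basis i = x := T.basis.sum_repr x
    have h2 : ∑ i, T.basis.repr x i ^ Fintype.card 𝔽 • T.basis i = x := by
      refine Eq.trans ?_ ((congrArg T.frob h1).trans h)
      rw [T.isFrobeniusSemilinear_frob.map_sum_smul]
      simp only [basis_apply, frob_incl]
    -- The basis consists of elements of T, which are fixed, so the Frobenius raises coordinates to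
    -- the q-th power.
    have h3 : ∀ i, T.basis.repr x i ^ Fintype.card 𝔽 = T.basis.repr x i := by
      intro i
      have h4 : ∑ i, (T.basis.repr x i ^ Fintype.card 𝔽 - T.basis.repr x i) • T.basis i = 0 := by
        simp only [sub_smul, Finset.sum_sub_distrib, h1, h2, sub_self]
      exact sub_eq_zero.1 (Fintype.linearIndependent_iff.1 T.basis.linearIndependent _ h4 i)
    choose a ha using fun i => exists_algebraMap_eq_of_pow_card_eq 𝔽 (h3 i)
    refine ⟨∑ i, a i • Module.Free.chooseBasis 𝔽 T.carrier i, ?_⟩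
    rw [map_sum, ← h1]
    exact Finset.sum_congr rfl fun i _ => by rw [incl_field_smul, ha, basis_apply]
  · rintro ⟨t, rfl⟩
    exact T.frob_incl t

theorem incl_injective (T : TorsionRep 𝔽 K L) : Function.Injective T.incl := by
  rw [injective_iff_map_eq_zero]
  intro t ht
  set b := Module.Free.chooseBasis 𝔽 T.carrier
  have h : ∑ i, algebraMap 𝔽 L (b.repr t i) • T.basis i = 0 := by
    rw [← ht]
    conv_rhs => rw [← b.sum_repr t]
    rw [map_sum]
    exact Finset.sum_congr rfl fun i _ => by rw [incl_field_smul, basis_apply]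
  have h1 := Fintype.linearIndependent_iff.1 T.basis.linearIndependent _ h
  rw [← b.sum_repr t]
  refine Finset.sum_eq_zero fun i _ => ?_
  rw [(map_eq_zero (algebraMap 𝔽 L)).1 (h1 i), zero_smul]

end Structure

section Galois

open PowerSeries

/-- The automorphisms of `L/K` fix the image of `𝔽` in `L`. -/
class GaloisFixes (𝔽 K L : Type*) [Field 𝔽] [Field K] [Field L] [Algebra K L] [Algebra 𝔽 L] :
    Prop where
  commutes : ∀ (g : L ≃ₐ[K] L) (a : 𝔽), g (algebraMap 𝔽 L a) = algebraMap 𝔽 L a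

variable {𝔽 : Type w} [Field 𝔽] {K : Type*} [Field K] {L : Type v} [Field L] [Algebra K L]
  [Algebra 𝔽 L] [GaloisFixes 𝔽 K L]

/-- The diagonal action of `Gal(L/K)` on `L⟦z⟧ ⊗ T`. -/
def gal (T : TorsionRep 𝔽 K L) (g : L ≃ₐ[K] L) : T.Space →+ T.Space :=
  T.lift (PowerSeries.map (g : L →+* L)) (T.incl.comp (DistribSMul.toAddMonoidHom T.carrier g))
    (fun s t => by
      have h : PowerSeries.map (g : L →+* L) (PowerSeries.map (algebraMap 𝔽 L) s) =
          PowerSeries.map (algebraMap 𝔽 L) s := by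
        ext n
        simpa using GaloisFixes.commutes g _
      rw [h, AddMonoidHom.comp_apply, AddMonoidHom.comp_apply, DistribSMul.toAddMonoidHom_apply,
        DistribSMul.toAddMonoidHom_apply, smul_comm, incl_smul])

theorem gal_incl (T : TorsionRep 𝔽 K L) (g : L ≃ₐ[K] L) (t : T.carrier) :
    T.gal g (T.incl t) = T.incl (g • t) :=
  T.lift_incl _ (T.incl.comp (DistribSMul.toAddMonoidHom T.carrier g)) _ t

theorem gal_smul (T : TorsionRep 𝔽 K L) (g : L ≃ₐ[K] L) (l : L⟦X⟧) (x : T.Space) :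
    T.gal g (l • x) = PowerSeries.map (g : L →+* L) l • T.gal g x :=
  T.lift_smul _ (T.incl.comp (DistribSMul.toAddMonoidHom T.carrier g)) _ l x

theorem gal_coeff_smul (T : TorsionRep 𝔽 K L) (g : L ≃ₐ[K] L) (l : L) (x : T.Space) :
    T.gal g (l • x) = g l • T.gal g x := by
  have := T.gal_smul g (C l) x
  rwa [map_C] at this

end Galois

section Map

open PowerSeries

variable {𝔽 : Type w} [Field 𝔽] {K : Type*} [Field K] {L : Type v} [Field L] [Algebra K L]
  [Algebra 𝔽 L] {T T' : TorsionRep 𝔽 K L}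

theorem Hom.incl_map_smul (f : T.Hom T') (s : 𝔽⟦X⟧) (t : T.carrier) :
    (T'.incl.comp f.toLinearMap.toAddMonoidHom) (s • t) =
      RingHom.id L⟦X⟧ (PowerSeries.map (algebraMap 𝔽 L) s) •
        (T'.incl.comp f.toLinearMap.toAddMonoidHom) t := by
  rw [AddMonoidHom.comp_apply, AddMonoidHom.comp_apply, LinearMap.toAddMonoidHom_coe, map_smul,
    incl_smul, RingHom.id_apply]

/-- The map `L⟦z⟧ ⊗ T → L⟦z⟧ ⊗ T'` induced by a morphism `T → T'`. -/
def Hom.spaceMap (f : T.Hom T') : T.Space →ₗ[L⟦X⟧] T'.Space where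
  toFun := T.lift (RingHom.id _) _ f.incl_map_smul
  map_add' := map_add _
  map_smul' := T.lift_smul _ _ f.incl_map_smul

theorem Hom.spaceMap_incl (f : T.Hom T') (t : T.carrier) :
    f.spaceMap (T.incl t) = T'.incl (f.toLinearMap t) :=
  T.lift_incl _ _ f.incl_map_smul t

/-- The identity morphism. -/
def Hom.id (T : TorsionRep 𝔽 K L) : T.Hom T where
  toLinearMap := LinearMap.id
  equivariant _ _ := rfl

theorem Hom.spaceMap_id (x : T.Space) : (Hom.id T).spaceMap x = x := by
  induction x using Space.induction_on with
  | zero => rw [map_zero]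
  | smul_incl l t => rw [map_smul, Hom.spaceMap_incl]; rfl
  | add x y hx hy => rw [map_add, hx, hy]

theorem Hom.spaceMap_gal [GaloisFixes 𝔽 K L] (f : T.Hom T') (g : L ≃ₐ[K] L) (x : T.Space) :
    f.spaceMap (T.gal g x) = T'.gal g (f.spaceMap x) :=
  Space.hom_ext (PowerSeries.map (g : L →+* L)) (f := f.spaceMap.toAddMonoidHom.comp (T.gal g))
    (g := (T'.gal g).comp f.spaceMap.toAddMonoidHom)
    (fun l x => by
      simp only [AddMonoidHom.comp_apply, gal_smul, LinearMap.toAddMonoidHom_coe, map_smul])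
    (fun l x => by
      simp only [AddMonoidHom.comp_apply, gal_smul, LinearMap.toAddMonoidHom_coe, map_smul])
    (fun t => by
      simp only [AddMonoidHom.comp_apply, LinearMap.toAddMonoidHom_coe, gal_incl,
        Hom.spaceMap_incl, f.equivariant]) x

theorem Hom.spaceMap_frob [Fintype 𝔽] (f : T.Hom T') (x : T.Space) :
    f.spaceMap (T.frob x) = T'.frob (f.spaceMap x) :=
  Space.hom_ext (sigma 𝔽 L) (f := f.spaceMap.toAddMonoidHom.comp T.frob)
    (g := T'.frob.comp f.spaceMap.toAddMonoidHom)
    (fun l x => by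
      simp only [AddMonoidHom.comp_apply, frob_smul, LinearMap.toAddMonoidHom_coe, map_smul])
    (fun l x => by
      simp only [AddMonoidHom.comp_apply, frob_smul, LinearMap.toAddMonoidHom_coe, map_smul])
    (fun t => by
      simp only [AddMonoidHom.comp_apply, LinearMap.toAddMonoidHom_coe, frob_incl,
        Hom.spaceMap_incl]) x

end Map

end TorsionRep

/-! ### Full lattices in a vector space -/

section FullLattice

theorem smul_injective_of_tower {R : Type*} [CommRing R] (L : Type*) [Field L] [Algebra R L]
    [FaithfulSMul R L] {V : Type*} [AddCommGroup V] [Module L V] [Module R V]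
    [IsScalarTower R L V] {r : R} (hr : r ≠ 0) : Function.Injective fun x : V => r • x := by
  intro x y h
  have h' : algebraMap R L r • x = algebraMap R L r • y := by
    rw [algebraMap_smul, algebraMap_smul]
    exact h
  exact smul_right_injective V ((FaithfulSMul.algebraMap_eq_zero_iff R L).not.2 hr) h'

variable {R : Type*} [CommRing R] [IsDomain R] [IsPrincipalIdealRing R]
  {L : Type*} [Field L] [Algebra R L] [FaithfulSMul R L]
  {V : Type*} [AddCommGroup V] [Module L V] [Module R V] [IsScalarTower R L V]
  [FiniteDimensional L V]

variable (L) in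
/-- The `R`-submodule `N` is spanned by an `L`-basis of `V`. -/
def IsFullLattice (N : Submodule R V) : Prop :=
  ∃ e : Module.Basis (Fin (Module.finrank L V)) L V, N = Submodule.span R (Set.range e)

theorem IsFullLattice.fg {N : Submodule R V} (h : IsFullLattice L N) : N.FG := by
  obtain ⟨e, rfl⟩ := h
  exact Submodule.fg_span (Set.finite_range e)

/-- Multiplication by r embeds N into N₀, so N is finitely generated, hence free over the principal
ideal domain, of rank at most dim V. Since r N₀ ⊆ N, an R-basis of N spans V over L, so the rank is
exactly dim V and this basis is an L-basis. -/
theorem IsFullLattice.of_smul_mem {N₀ N : Submodule R V} (h : IsFullLattice L N₀) {r : R}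
    (hr : r ≠ 0) (h₁ : ∀ x ∈ N, r • x ∈ N₀) (h₂ : ∀ x ∈ N₀, r • x ∈ N) : IsFullLattice L N := by
  have hN₀ := h.fg
  obtain ⟨e, rfl⟩ := h
  have hinj := smul_injective_of_tower L (V := V) hr
  have hfg : N.FG := by
    apply Submodule.fg_of_fg_map_injective (LinearMap.lsmul R V r) hinj
    refine hN₀.of_le ?_
    rintro _ ⟨x, hx, rfl⟩
    exact h₁ x hx
  have : Module.Finite R N := Module.Finite.iff_fg.2 hfg
  have : Module.IsTorsionFree R V :=
    ⟨fun r hr => smul_injective_of_tower L (V := V) hr.ne_zero⟩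
  let b := Module.finBasis R N
  have heli : LinearIndependent R e := e.linearIndependent.restrict_scalars' R
  have hk : Module.finrank R N ≤ Module.finrank L V := by
    have h1 : Module.finrank R (Submodule.span R (Set.range e)) = Module.finrank L V := by
      rw [finrank_span_eq_card heli, Fintype.card_fin]
    have : Module.Finite R (Submodule.span R (Set.range e)) := Module.Finite.iff_fg.2 hN₀
    rw [← h1]
    exact LinearMap.finrank_le_finrank_of_injective
      (f := (LinearMap.lsmul R V r).restrict (p := N) (q := Submodule.span R (Set.range e)) h₁)
      (fun x y hxy => Subtype.ext (hinj (congrArg Subtype.val hxy)))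
  have hspanR : Submodule.span R (Set.range fun i => (b i : V)) = N := by
    have := congrArg (Submodule.map N.subtype) b.span_eq
    rw [Submodule.map_span, Submodule.map_top, Submodule.range_subtype, ← Set.range_comp] at this
    exact this
  have hspan : ⊤ ≤ Submodule.span L (Set.range fun i => (b i : V)) := by
    rw [← e.span_eq, Submodule.span_le]
    rintro _ ⟨i, rfl⟩
    have h3 : r • e i ∈ Submodule.span L (Set.range fun i => (b i : V)) := by
      apply Submodule.span_le_restrictScalars R L
      rw [hspanR]
      exact h₂ _ (Submodule.subset_span ⟨i, rfl⟩)
    rw [← algebraMap_smul L r] at h3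
    exact (Submodule.smul_mem_iff _ ((FaithfulSMul.algebraMap_eq_zero_iff R L).not.2 hr)).1 h3
  have hn : Module.finrank R N = Module.finrank L V := by
    apply le_antisymm hk
    have := finrank_range_le_card (R := L) (fun i => (b i : V))
    rw [Set.finrank, top_le_iff.1 hspan, finrank_top, Fintype.card_fin] at this
    exact this
  let e' : Module.Basis (Fin (Module.finrank R N)) L V :=
    basisOfTopLeSpanOfCardEqFinrank (fun i => (b i : V)) hspan (by rw [Fintype.card_fin, hn])
  refine ⟨e'.reindex (finCongr hn), ?_⟩
  rw [Module.Basis.range_reindex]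
  refine hspanR.symm.trans ?_
  congr 2
  exact (coe_basisOfTopLeSpanOfCardEqFinrank _ _ _).symm

end FullLattice

/-! ### Flatness of the Frobenius -/

section Flat

variable (𝔽 : Type*) [Field 𝔽] [Fintype 𝔽] {R : Type*} [CommRing R] [IsDomain R]
  [IsPrincipalIdealRing R] [Algebra 𝔽 R]

/-- Flatness of the Frobenius of a principal ideal domain, in terms of equations: a solution `c` of
a system of congruences with coefficients `aᵢⱼ ^ q` modulo `r ^ q` is a linear combination of `q`-th
powers of solutions of the system with coefficients `aᵢⱼ` modulo `r`. -/
theorem exists_frobenius_factorization {m n : ℕ} (a : Fin n → Fin m → R) (r : R) (c : Fin n → R)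
    (h : ∀ j, r ^ Fintype.card 𝔽 ∣ ∑ i, c i * a i j ^ Fintype.card 𝔽) :
    ∃ (k : ℕ) (b : Fin k → Fin n → R) (y : Fin k → R),
      (∀ i, c i = ∑ l, y l * b l i ^ Fintype.card 𝔽) ∧ ∀ l j, r ∣ ∑ i, b l i * a i j := by
  let φ : R →+* R := FiniteField.frobeniusAlgHom 𝔽 R
  have hφ : ∀ x : R, φ x = x ^ Fintype.card 𝔽 := fun x => rfl
  have hsmul : ∀ (x : R) (y : Twist φ), x • y = (Twist.of φ (φ x)) * y := fun x y => rfl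
  -- R is torsion-free as a module over itself through the Frobenius, hence flat because R is a
  -- principal ideal domain.
  have : Module.IsTorsionFree R (Twist φ) := ⟨fun x hx y z hyz => by
    have h1 : φ x * (Twist.of φ).symm y = φ x * (Twist.of φ).symm z :=
      congrArg (Twist.of φ).symm hyz
    rw [hφ] at h1
    exact (Twist.of φ).symm.injective (mul_left_cancel₀ (pow_ne_zero _ hx.ne_zero) h1)⟩
  choose d hd using h
  -- The columns of f encode the equations ∑ bᵢ aᵢⱼ = r sⱼ in unknowns (b, s): a linear form that
  -- kills f is a solution. The form x below is the solution (c, d) with values in `Twist φ`, where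
  -- the coefficients aᵢⱼ and r act through their q-th powers.
  let f : (Fin m → R) →ₗ[R] (Fin n → R) × (Fin m → R) :=
    LinearMap.prod (Matrix.mulVecLin (Matrix.of a)) (-(LinearMap.lsmul R _ r))
  let x : (Fin n → R) × (Fin m → R) →ₗ[R] Twist φ :=
    LinearMap.coprod (Fintype.linearCombination R (fun i => Twist.of φ (c i)))
      (Fintype.linearCombination R (fun j => Twist.of φ (d j)))
  have hxf : x ∘ₗ f = 0 := by
    have hj : ∀ j, x (f (Pi.single j 1)) = 0 := by
      intro j
      have h1 : f (Pi.single j 1) = (fun i => a i j, -(r • Pi.single j 1)) :=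
        Prod.ext (Matrix.mulVec_single_one (Matrix.of a) j) rfl
      have h2 : ∑ i, a i j • Twist.of φ (c i) = r • Twist.of φ (d j) := by
        simp only [hsmul, ← map_mul, ← map_sum, hφ]
        rw [← hd j]
        exact congrArg _ (Finset.sum_congr rfl fun i _ => mul_comm _ _)
      rw [h1]
      rw [LinearMap.coprod_apply, map_neg, map_smul, Fintype.linearCombination_apply_single,
        one_smul, Fintype.linearCombination_apply, h2, add_neg_cancel]
    apply LinearMap.pi_ext
    intro j t
    have h3 : (Pi.single j t : Fin m → R) = t • Pi.single j 1 := by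
      rw [← Pi.single_smul, smul_eq_mul, mul_one]
    rw [h3, map_smul, LinearMap.comp_apply, hj, smul_zero, LinearMap.zero_apply]
  -- Equational criterion for flatness: x = y ∘ α with α f = 0, so each coordinate of α is a
  -- solution over R itself and y supplies the coefficients.
  obtain ⟨k, α, y, hxy, hα⟩ := Module.Flat.exists_factorization_of_comp_eq_zero_of_free hxf
  refine ⟨k, fun l i => α (Pi.single i 1, 0) l, fun l => (Twist.of φ).symm (y (Finsupp.single l 1)),
    fun i => ?_, fun l j => ?_⟩
  · have h1 := congrArg (fun g => g (Pi.single i 1, 0)) hxy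
    simp only [x, LinearMap.coprod_apply, map_zero, add_zero, LinearMap.comp_apply,
      Fintype.linearCombination_apply_single, one_smul] at h1
    have h2 : y (α (Pi.single i 1, 0)) =
        ∑ l, α (Pi.single i 1, 0) l • y (Finsupp.single l 1) := by
      conv_lhs => rw [← Finsupp.univ_sum_single (α (Pi.single i 1, 0)), map_sum]
      refine Finset.sum_congr rfl fun l _ => ?_
      rw [← map_smul, Finsupp.smul_single, smul_eq_mul, mul_one]
    rw [h2] at h1
    have h3 := congrArg (Twist.of φ).symm h1
    rw [RingEquiv.symm_apply_apply, map_sum] at h3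
    rw [h3]
    refine Finset.sum_congr rfl fun l _ => ?_
    rw [hsmul, map_mul, RingEquiv.symm_apply_apply, hφ, mul_comm]
  · have h1 := congrArg (fun g => g (Pi.single j 1)) hα
    refine ⟨α (0, Pi.single j 1) l, ?_⟩
    have h2 : f (Pi.single j 1) =
        ∑ i, a i j • ((Pi.single i 1, 0) : (Fin n → R) × (Fin m → R)) - r • (0, Pi.single j 1) := by
      refine (Prod.ext (Matrix.mulVec_single_one (Matrix.of a) j) rfl :
        f (Pi.single j 1) = (fun i => a i j, -(r • Pi.single j 1))).trans ?_
      ext i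
      · simp [Prod.fst_sum, Finset.sum_apply, Pi.single_apply]
      · simp [Prod.snd_sum]
    simp only [LinearMap.comp_apply, h2, LinearMap.zero_apply, map_sub, map_sum, map_smul] at h1
    have h3 := DFunLike.congr_fun (sub_eq_zero.1 h1) l
    simp only [Finsupp.coe_finsetSum, Finset.sum_apply, Finsupp.smul_apply, smul_eq_mul] at h3
    rw [← h3]
    exact Finset.sum_congr rfl fun i _ => mul_comm _ _

end Flat

/-! ### Shtuka lattices in `L⟦z⟧ ⊗ T` -/

namespace TorsionRep

open PowerSeries

section RStructure

variable {𝔽 : Type w} [Field 𝔽] {R : Type u} [CommRing R]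
  {K : Type*} [Field K] {L : Type v} [Field L] [Algebra K L] [Algebra R L] [Algebra 𝔽 L]
  (T : TorsionRep 𝔽 K L)

instance (priority := 50) : Module R T.Space := Module.compHom T.Space (algebraMap R L)

instance (priority := 50) : Module R⟦X⟧ T.Space :=
  Module.compHom T.Space (PowerSeries.map (algebraMap R L))

theorem base_smul_def (r : R) (x : T.Space) : r • x = algebraMap R L r • x := rfl

theorem base_powerSeries_smul_def (s : R⟦X⟧) (x : T.Space) :
    s • x = PowerSeries.map (algebraMap R L) s • x := rfl

instance : IsScalarTower R L T.Space where
  smul_assoc r l x := by rw [Algebra.smul_def, mul_smul, base_smul_def (R := R)]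

instance : IsScalarTower R⟦X⟧ L⟦X⟧ T.Space where
  smul_assoc r l x := by rw [powerSeries_smul_def, mul_smul, base_powerSeries_smul_def]

theorem C_smul (r : R) (x : T.Space) : (C r : R⟦X⟧) • x = r • x := by
  rw [base_powerSeries_smul_def, map_C]
  rfl

theorem X_smul (x : T.Space) : (X : R⟦X⟧) • x = (X : L⟦X⟧) • x := by
  rw [base_powerSeries_smul_def, map_X]

instance : IsScalarTower R R⟦X⟧ T.Space where
  smul_assoc r s x := by rw [smul_eq_C_mul, mul_smul, C_smul]

theorem exists_base_X_pow_smul_space (R : Type u) [CommRing R] [Algebra R L] :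
    ∃ n : ℕ, ∀ x : T.Space, (X : R⟦X⟧) ^ n • x = 0 := by
  obtain ⟨n, hn⟩ := T.exists_X_pow_smul_space
  refine ⟨n, fun x => ?_⟩
  rw [base_powerSeries_smul_def, map_pow, map_X]
  exact hn x

theorem frob_base_powerSeries_smul [Fintype 𝔽] [Algebra 𝔽 R] (s : R⟦X⟧) (x : T.Space) :
    T.frob (s • x) = sigma 𝔽 R s • T.frob x := by
  rw [base_powerSeries_smul_def, frob_smul, base_powerSeries_smul_def]
  congr 1
  ext n
  simp [sigma]

theorem frob_base_smul [Fintype 𝔽] (r : R) (x : T.Space) :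
    T.frob (r • x) = r ^ Fintype.card 𝔽 • T.frob x := by
  rw [base_smul_def, T.isFrobeniusSemilinear_frob, ← map_pow, ← base_smul_def]

theorem frob_X_smul [Fintype 𝔽] (x : T.Space) :
    T.frob ((X : R⟦X⟧) • x) = (X : R⟦X⟧) • T.frob x := by
  rw [X_smul, frob_smul, sigma_X, X_smul]

variable {T} in
theorem Hom.spaceMap_base_powerSeries_smul {T' : TorsionRep 𝔽 K L} (f : T.Hom T') (s : R⟦X⟧)
    (x : T.Space) : f.spaceMap (s • x) = s • f.spaceMap x := by
  rw [base_powerSeries_smul_def, map_smul, ← base_powerSeries_smul_def]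

variable {T} in
theorem Hom.spaceMap_base_smul {T' : TorsionRep 𝔽 K L} (f : T.Hom T') (r : R)
    (x : T.Space) : f.spaceMap (r • x) = r • f.spaceMap x := by
  rw [← C_smul, f.spaceMap_base_powerSeries_smul, C_smul]

variable {T} in
theorem Hom.spaceMap_coeff_smul {T' : TorsionRep 𝔽 K L} (f : T.Hom T') (l : L)
    (x : T.Space) : f.spaceMap (l • x) = l • f.spaceMap x :=
  f.spaceMap.map_smul (C l) x

variable (R) in
/-- The map on spaces induced by a morphism, as an `R⟦z⟧`-linear map. -/
def Hom.baseSpaceMap {T T' : TorsionRep 𝔽 K L} (f : T.Hom T') : T.Space →ₗ[R⟦X⟧] T'.Space where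
  toFun := f.spaceMap
  map_add' := map_add _
  map_smul' := f.spaceMap_base_powerSeries_smul

end RStructure

variable {𝔽 : Type w} [Field 𝔽] [Fintype 𝔽] {R : Type u} [CommRing R] [IsDomain R]
  [IsDiscreteValuationRing R] [Algebra 𝔽 R] {K : Type*} [Field K] [Algebra R K]
  [IsFractionRing R K] {L : Type v} [Field L] [Algebra K L] [IsSepClosure K L] [Algebra R L]
  [IsScalarTower R K L] [FaithfulSMul R L] [Algebra 𝔽 L] [GaloisFixes 𝔽 K L]
  (c : CharPoint R) (d : ℕ) {T T' : TorsionRep 𝔽 K L}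

/-- The `R⟦z⟧`-submodules of `L⟦z⟧ ⊗ T` that come from effective models of `T` of height `≤ d`. -/
structure IsShtukaLattice (N : Submodule R⟦X⟧ T.Space) : Prop where
  fixed : ∀ (g : L ≃ₐ[K] L), ∀ x ∈ N, T.gal g x = x
  full : IsFullLattice L (N.restrictScalars R)
  frob_mem : ∀ x ∈ N, T.frob x ∈ N
  height : ∀ x ∈ N, (X - C c.zeta : R⟦X⟧) ^ d • x ∈ Submodule.span R⟦X⟧ (T.frob '' N)

variable {c d}

theorem linearIndependent_frob {ι : Type*} {e : ι → T.Space} (he : LinearIndependent L e) :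
    LinearIndependent L (fun i => T.frob (e i)) :=
  T.isFrobeniusSemilinear_frob.linearIndependent_comp T.span_range_frob he

/-- φ(∑ rᵢ eᵢ) = ∑ rᵢ^q φ(eᵢ) and φ commutes with z, so the R-span of the φ(eᵢ) contains φ(N) and is
z-stable. The height condition thereby becomes a statement about coordinates over R. -/
theorem coe_span_frob_image {N : Submodule R⟦X⟧ T.Space} {ι : Type*} (e : ι → T.Space)
    (he : N.restrictScalars R = Submodule.span R (Set.range e)) :
    (Submodule.span R⟦X⟧ (T.frob '' N) : Set T.Space) =
      Submodule.span R (Set.range fun i => T.frob (e i)) := by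
  obtain ⟨n, hn⟩ := T.exists_base_X_pow_smul_space R
  have h1 : ∀ x ∈ N, T.frob x ∈ Submodule.span R (Set.range fun i => T.frob (e i)) := by
    intro x hx
    have hx' : x ∈ Submodule.span R (Set.range e) := he ▸ hx
    clear hx
    induction hx' using Submodule.span_induction with
    | mem x hx => obtain ⟨i, rfl⟩ := hx; exact Submodule.subset_span ⟨i, rfl⟩
    | zero => rw [map_zero]; exact zero_mem _
    | add x y _ _ hx hy => rw [map_add]; exact add_mem hx hy
    | smul a x _ hx => rw [frob_base_smul]; exact Submodule.smul_mem _ _ hx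
  have h2 : ∀ i, e i ∈ N := fun i => by
    have : e i ∈ N.restrictScalars R := he ▸ Submodule.subset_span ⟨i, rfl⟩
    exact this
  have hX : ∀ x ∈ Set.range fun i => T.frob (e i),
      (X : R⟦X⟧) • x ∈ Submodule.span R (Set.range fun i => T.frob (e i)) := by
    rintro _ ⟨i, rfl⟩
    simp only [← frob_X_smul]
    exact h1 _ (N.smul_mem _ (h2 i))
  have h3 := coe_span_powerSeries_eq hn hX
  rw [← h3]
  congr 1
  apply le_antisymm
  · rw [Submodule.span_le, h3]
    rintro _ ⟨x, hx, rfl⟩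
    exact h1 x hx
  · apply Submodule.span_mono
    rintro _ ⟨i, rfl⟩
    exact ⟨e i, h2 i, rfl⟩

theorem repr_frob (x : T.Space) (i) :
    T.basis.repr (T.frob x) i = T.basis.repr x i ^ Fintype.card 𝔽 := by
  have h : T.frob x = ∑ j, T.basis.repr x j ^ Fintype.card 𝔽 • T.basis j := by
    refine (congrArg T.frob (T.basis.sum_repr x).symm).trans ?_
    rw [T.isFrobeniusSemilinear_frob.map_sum_smul]
    simp only [basis_apply, frob_incl]
  rw [h, Module.Basis.repr_sum_self]

namespace IsShtukaLattice

/-- The i-th coordinates of elements of N form a finitely generated R-module, and φ-stability of N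
makes it stable under q-th powers. -/
theorem isIntegral_repr {N : Submodule R⟦X⟧ T.Space} (hN : IsShtukaLattice c d N) {x : T.Space}
    (hx : x ∈ N) (i) : IsIntegral R (T.basis.repr x i) := by
  let P : Submodule R L := (N.restrictScalars R).map ((T.basis.coord i).restrictScalars R)
  refine isIntegral_of_mem_of_pow_mem (Fintype.one_lt_card (α := 𝔽)) P (hN.full.fg.map _) ?_
    ⟨x, hx, rfl⟩
  rintro _ ⟨y, hy, rfl⟩
  exact ⟨T.frob y, hN.frob_mem y hy, repr_frob y i⟩

/-- ζ = z - (z - ζ), so every term of the binomial expansion of ζ^(m+d) is divisible by z^m, which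
acts as zero, or by (z - ζ)^d, which the height condition controls. -/
theorem zeta_pow_smul_mem {N : Submodule R⟦X⟧ T.Space} (hN : IsShtukaLattice c d N) {m : ℕ}
    (hm : ∀ x : T.Space, (X : R⟦X⟧) ^ m • x = 0) {x : T.Space} (hx : x ∈ N) :
    c.zeta ^ (m + d) • x ∈ Submodule.span R⟦X⟧ (T.frob '' N) := by
  set I : Ideal R⟦X⟧ := Ideal.span {X ^ m, (X - C c.zeta) ^ d}
  have h1 : (X : R⟦X⟧) ^ m ∈ I := Ideal.subset_span (by simp)
  have h2 : (-(X - C c.zeta) : R⟦X⟧) ^ d ∈ I := by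
    rw [neg_pow]
    exact I.mul_mem_left _ (Ideal.subset_span (by simp))
  have h3 := I.add_pow_mem_of_pow_mem_of_le h1 h2 (Nat.le_succ (m + d))
  rw [neg_sub, add_sub_cancel, Ideal.mem_span_pair] at h3
  obtain ⟨a, b, hab⟩ := h3
  rw [← C_smul, map_pow, ← hab, add_smul, mul_smul, mul_smul, hm, smul_zero, zero_add]
  exact Submodule.smul_mem _ _ (hN.height x hx)

/-- Put r = ζ^(m+d) and t = ∑ bᵢ eᵢ, and write r eᵢ = ∑ Bᵢⱼ φ(eⱼ). Comparing r t with r φ(t) in the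
basis φ(eⱼ) gives r bⱼ^q = ∑ bᵢ Bᵢⱼ. After rescaling, the q-th powers of the r bⱼ are R-combinations
of the r bᵢ. -/
theorem isIntegral_repr_incl {N : Submodule R⟦X⟧ T.Space} (hN : IsShtukaLattice c d N) {m : ℕ}
    (hm : ∀ x : T.Space, (X : R⟦X⟧) ^ m • x = 0) {n : ℕ} (e : Module.Basis (Fin n) L T.Space)
    (he : N.restrictScalars R = Submodule.span R (Set.range e)) (t : T.carrier) (i : Fin n) :
    IsIntegral R (algebraMap R L (c.zeta ^ (m + d)) * e.repr (T.incl t) i) := by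
  set r := c.zeta ^ (m + d) with hr
  set b : Fin n → L := fun i => e.repr (T.incl t) i with hb
  have hmem : ∀ i, r • e i ∈ Submodule.span R (Set.range fun i => T.frob (e i)) := by
    intro i
    have hi : e i ∈ N := by
      have : e i ∈ N.restrictScalars R := he ▸ Submodule.subset_span ⟨i, rfl⟩
      exact this
    have := hN.zeta_pow_smul_mem hm hi
    rwa [← SetLike.mem_coe, coe_span_frob_image e he] at this
  clear_value r
  choose B hB using fun i => (Submodule.mem_span_range_iff_exists_fun R).1 (hmem i)
  have ht : ∑ i, b i • e i = T.incl t := e.sum_repr _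
  have ht' : ∑ i, b i ^ Fintype.card 𝔽 • T.frob (e i) = T.incl t := by
    refine Eq.trans ?_ ((congrArg T.frob ht).trans (T.frob_incl t))
    rw [T.isFrobeniusSemilinear_frob.map_sum_smul]
  have hrel : ∀ j, algebraMap R L r * b j ^ Fintype.card 𝔽 = ∑ i, b i * algebraMap R L (B i j) := by
    have h1 : ∑ j, (∑ i, b i * algebraMap R L (B i j)) • T.frob (e j) =
        ∑ j, (algebraMap R L r * b j ^ Fintype.card 𝔽) • T.frob (e j) := by
      calc _ = ∑ i, b i • r • e i := by
            simp only [← hB, Finset.sum_smul, Finset.smul_sum]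
            rw [Finset.sum_comm]
            exact Finset.sum_congr rfl fun i _ => Finset.sum_congr rfl fun j _ => by
              rw [mul_smul, base_smul_def (R := R)]
        _ = r • T.incl t := by
            rw [← ht, Finset.smul_sum]
            exact Finset.sum_congr rfl fun i _ => smul_comm _ _ _
        _ = _ := by
            rw [← ht', Finset.smul_sum]
            exact Finset.sum_congr rfl fun i _ => by rw [mul_smul, base_smul_def]
    intro j
    have h2 : ∑ j, (algebraMap R L r * b j ^ Fintype.card 𝔽 -
        ∑ i, b i * algebraMap R L (B i j)) • T.frob (e j) = 0 := by
      simp only [sub_smul, Finset.sum_sub_distrib, h1, sub_self]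
    exact sub_eq_zero.1
      (Fintype.linearIndependent_iff.1 (linearIndependent_frob e.linearIndependent) _ h2 j)
  refine isIntegral_of_pow_mem_span 𝔽 (R := R) (fun i => algebraMap R L r * b i) ?_ i
  intro j
  -- Here q' = q - 2: of the q factors r in (r bⱼ)^q, one is absorbed by the relation for r bⱼ^q and
  -- one turns each bᵢ into r bᵢ.
  obtain ⟨q', hq'⟩ := Nat.exists_eq_add_of_le (Fintype.one_lt_card (α := 𝔽))
  have : (algebraMap R L r * b j) ^ Fintype.card 𝔽 =
      ∑ i, (r ^ q' * B i j) • (algebraMap R L r * b i) := by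
    have h3 : algebraMap R L r ^ Fintype.card 𝔽 =
        algebraMap R L r ^ q' * algebraMap R L r * algebraMap R L r := by
      rw [hq']; ring
    rw [mul_pow, h3, mul_assoc, hrel, Finset.mul_sum]
    refine Finset.sum_congr rfl fun i _ => ?_
    rw [Algebra.smul_def, map_mul, map_pow]
    ring
  rw [this]
  exact Submodule.sum_mem _ fun i _ => Submodule.smul_mem _ _ (Submodule.subset_span ⟨i, rfl⟩)

/-- Galois descent: a basis of N is Galois-fixed, so the coordinates of a fixed vector are fixed and
lie in K; being integral, they lie in the integrally closed ring R. -/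
theorem mem_of_isIntegral_repr {N : Submodule R⟦X⟧ T.Space} (hN : IsShtukaLattice c d N)
    {n : ℕ} (e : Module.Basis (Fin n) L T.Space)
    (he : N.restrictScalars R = Submodule.span R (Set.range e)) {x : T.Space}
    (hx : ∀ g : L ≃ₐ[K] L, T.gal g x = x) (hint : ∀ i, IsIntegral R (e.repr x i)) : x ∈ N := by
  have hmem : x ∈ Submodule.span R (Set.range e) := by
    rw [Module.Basis.mem_span_iff_repr_mem]
    intro i
    have hK : e.repr x i ∈ Set.range (algebraMap K L) := by
      rw [InfiniteGalois.mem_range_algebraMap_iff_fixed]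
      intro g
      have h1 : ∑ i, g (e.repr x i) • e i = x := by
        refine Eq.trans ?_ ((congrArg (T.gal g) (e.sum_repr x)).trans (hx g))
        rw [map_sum]
        refine Finset.sum_congr rfl fun i _ => ?_
        rw [gal_coeff_smul, hN.fixed g (e i)]
        have : e i ∈ N.restrictScalars R := he ▸ Submodule.subset_span ⟨i, rfl⟩
        exact this
      have h2 := congrArg (fun y => e.repr y i) h1
      simp only [Module.Basis.repr_sum_self] at h2
      exact h2
    obtain ⟨k, hk⟩ := hK
    have hk' : IsIntegral R k := by
      have := hint i
      rw [← hk] at this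
      exact (isIntegral_algebraMap_iff (algebraMap K L).injective).1 this
    obtain ⟨r, hr⟩ := IsIntegrallyClosed.isIntegral_iff.1 hk'
    exact ⟨r, by rw [IsScalarTower.algebraMap_apply R K L, hr, hk]⟩
  rw [← he] at hmem
  exact hmem

/-- Two shtuka lattices of height `≤ d` are commensurable up to a power of `ζ` that does not depend
on the lattices. -/
theorem zeta_pow_smul_map_mem {N : Submodule R⟦X⟧ T.Space} {N' : Submodule R⟦X⟧ T'.Space}
    (hN : IsShtukaLattice c d N) (hN' : IsShtukaLattice c d N') (f : T.Hom T') {m : ℕ}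
    (hm : ∀ x : T'.Space, (X : R⟦X⟧) ^ m • x = 0) {x : T.Space} (hx : x ∈ N) :
    c.zeta ^ (m + d) • f.spaceMap x ∈ N' := by
  obtain ⟨e, he⟩ := hN'.full
  apply hN'.mem_of_isIntegral_repr e he
  · intro g
    rw [base_smul_def, gal_coeff_smul, ← f.spaceMap_gal, hN.fixed g x hx,
      IsScalarTower.algebraMap_apply R K L, g.commutes]
  · intro i
    -- Passing through the basis of T separates the two bounds: the coordinates of x are integral,
    -- and the power of ζ makes the coordinates of T' in the basis of N' integral.
    have h1 : c.zeta ^ (m + d) • f.spaceMap x = ∑ j, T.basis.repr x j •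
        (algebraMap R L (c.zeta ^ (m + d)) •
          T'.incl (f.toLinearMap (Module.Free.chooseBasis 𝔽 T.carrier j))) := by
      conv_lhs => rw [← T.basis.sum_repr x, map_sum, Finset.smul_sum]
      refine Finset.sum_congr rfl fun j _ => ?_
      rw [f.spaceMap_coeff_smul, basis_apply, f.spaceMap_incl, base_smul_def, smul_comm]
    rw [h1, map_sum, Finsupp.finsetSum_apply]
    refine IsIntegral.sum _ fun j _ => ?_
    rw [map_smul, map_smul, Finsupp.smul_apply, Finsupp.smul_apply, smul_eq_mul, smul_eq_mul]
    exact (hN.isIntegral_repr hx j).mul (hN'.isIntegral_repr_incl hm e he _ i)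

end IsShtukaLattice

end TorsionRep

theorem CharPoint.pow_ne_zero {R : Type*} [CommRing R] [IsDomain R] [IsLocalRing R]
    (c : CharPoint R) (n : ℕ) : c.zeta ^ n ≠ 0 :=
  _root_.pow_ne_zero n c.ne_zero

/-! ### Sums, intersections and extremal shtuka lattices -/

namespace TorsionRep

open PowerSeries

variable {𝔽 : Type w} [Field 𝔽] [Fintype 𝔽] {R : Type u} [CommRing R] [IsDomain R]
  [IsDiscreteValuationRing R] [Algebra 𝔽 R] {K : Type*} [Field K] [Algebra R K]
  [IsFractionRing R K] {L : Type v} [Field L] [Algebra K L] [IsSepClosure K L] [Algebra R L]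
  [IsScalarTower R K L] [FaithfulSMul R L] [Algebra 𝔽 L] [GaloisFixes 𝔽 K L]
  {c : CharPoint R} {d : ℕ} {T T' : TorsionRep 𝔽 K L}

namespace IsShtukaLattice

/-- The sum f(N) + N' is full because the uniform bound makes it commensurable with N'. The other
conditions are additive and id ⊗ f commutes with φ and Galois. Maximality of N' will force f(N) ⊆
N'. -/
theorem map_sup {N : Submodule R⟦X⟧ T.Space} {N' : Submodule R⟦X⟧ T'.Space}
    (hN : IsShtukaLattice c d N) (hN' : IsShtukaLattice c d N') (f : T.Hom T') :
    IsShtukaLattice c d (N.map (f.baseSpaceMap R) ⊔ N') where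
  fixed g x hx := by
    obtain ⟨_, ⟨y, hy, rfl⟩, z, hz, rfl⟩ := Submodule.mem_sup.1 hx
    rw [map_add, hN'.fixed g z hz]
    change T'.gal g (f.spaceMap y) + z = _
    rw [← f.spaceMap_gal, hN.fixed g y hy]
    rfl
  full := by
    obtain ⟨m, hm⟩ := T'.exists_base_X_pow_smul_space R
    refine hN'.full.of_smul_mem (c.pow_ne_zero (m + d)) (fun x hx => ?_) (fun x hx => ?_)
    · obtain ⟨_, ⟨y, hy, rfl⟩, z, hz, rfl⟩ := Submodule.mem_sup.1 hx
      rw [smul_add]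
      exact add_mem (hN.zeta_pow_smul_map_mem hN' f hm hy) (Submodule.smul_mem _ _ hz)
    · exact Submodule.mem_sup_right (Submodule.smul_mem (N'.restrictScalars R) _ hx)
  frob_mem x hx := by
    obtain ⟨_, ⟨y, hy, rfl⟩, z, hz, rfl⟩ := Submodule.mem_sup.1 hx
    rw [map_add]
    refine add_mem (Submodule.mem_sup_left ⟨T.frob y, hN.frob_mem y hy, ?_⟩)
      (Submodule.mem_sup_right (hN'.frob_mem z hz))
    exact f.spaceMap_frob y
  height x hx := by
    obtain ⟨_, ⟨y, hy, rfl⟩, z, hz, rfl⟩ := Submodule.mem_sup.1 hx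
    rw [smul_add]
    refine add_mem ?_ ?_
    · rw [← map_smul]
      have h1 := Submodule.mem_map_of_mem (f := f.baseSpaceMap R) (hN.height y hy)
      rw [Submodule.map_span] at h1
      refine Submodule.span_mono ?_ h1
      rintro _ ⟨_, ⟨w, hw, rfl⟩, rfl⟩
      exact ⟨f.baseSpaceMap R w, Submodule.mem_sup_left ⟨w, hw, rfl⟩, (f.spaceMap_frob w).symm⟩
    · exact Submodule.span_mono (Set.image_mono fun w hw => Submodule.mem_sup_right hw)
        (hN'.height z hz)

/-- The Frobenius twist must commute with the intersection N ∩ f⁻¹(N'). With r f(eᵢ) = ∑ aᵢⱼ e'ⱼ, a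
vector ∑ bᵢ eᵢ lies in it exactly when r divides ∑ bᵢ aᵢⱼ for all j. The coefficients γ of (z - ζ)^d
x in the φ(eᵢ) satisfy the same congruences with q-th powers of aᵢⱼ and r; flatness writes γ through
q-th powers of genuine solutions b, giving a combination of φ(∑ bᵢ eᵢ). -/
theorem inf_comap_height {N : Submodule R⟦X⟧ T.Space} {N' : Submodule R⟦X⟧ T'.Space}
    (hN : IsShtukaLattice c d N) (hN' : IsShtukaLattice c d N') (f : T.Hom T') {x : T.Space}
    (hx : x ∈ N) (hfx : f.spaceMap x ∈ N') :
    (X - C c.zeta : R⟦X⟧) ^ d • x ∈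
      Submodule.span R⟦X⟧ (T.frob '' ↑(N ⊓ N'.comap (f.baseSpaceMap R))) := by
  obtain ⟨m, hm⟩ := T'.exists_base_X_pow_smul_space R
  obtain ⟨e, he⟩ := hN.full
  obtain ⟨e', he'⟩ := hN'.full
  have heN : ∀ i, e i ∈ N := fun i => by
    have : e i ∈ N.restrictScalars R := he ▸ Submodule.subset_span ⟨i, rfl⟩
    exact this
  have heN' : ∀ i, e' i ∈ N' := fun i => by
    have : e' i ∈ N'.restrictScalars R := he' ▸ Submodule.subset_span ⟨i, rfl⟩
    exact this
  have hr := c.pow_ne_zero (m + d)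
  have hrf : ∀ i, c.zeta ^ (m + d) • f.spaceMap (e i) ∈ Submodule.span R (Set.range e') :=
    fun i => he' ▸ hN.zeta_pow_smul_map_mem hN' f hm (heN i)
  generalize c.zeta ^ (m + d) = r at hr hrf
  choose a ha using fun i => (Submodule.mem_span_range_iff_exists_fun R).1 (hrf i)
  have hy := hN.height x hx
  rw [← SetLike.mem_coe, coe_span_frob_image e he, SetLike.mem_coe,
    Submodule.mem_span_range_iff_exists_fun] at hy
  obtain ⟨γ, hγ⟩ := hy
  have hy' := hN'.height _ hfx
  rw [← SetLike.mem_coe, coe_span_frob_image e' he', SetLike.mem_coe,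
    Submodule.mem_span_range_iff_exists_fun] at hy'
  obtain ⟨δ, hδ⟩ := hy'
  have hfrob : ∀ i, r ^ Fintype.card 𝔽 • f.spaceMap (T.frob (e i)) =
      ∑ j, a i j ^ Fintype.card 𝔽 • T'.frob (e' j) := by
    intro i
    rw [f.spaceMap_frob, ← frob_base_smul, ← ha, map_sum]
    exact Finset.sum_congr rfl fun j _ => frob_base_smul _ _ _
  have hli : LinearIndependent R fun j => T'.frob (e' j) :=
    (linearIndependent_frob e'.linearIndependent).restrict_scalars' R
  have hdvd : ∀ j, r ^ Fintype.card 𝔽 ∣ ∑ i, γ i * a i j ^ Fintype.card 𝔽 := by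
    have h1 : ∑ j, (∑ i, γ i * a i j ^ Fintype.card 𝔽) • T'.frob (e' j) =
        ∑ j, (r ^ Fintype.card 𝔽 * δ j) • T'.frob (e' j) := by
      calc _ = ∑ i, γ i • r ^ Fintype.card 𝔽 • f.spaceMap (T.frob (e i)) := by
            simp only [hfrob, Finset.sum_smul, Finset.smul_sum, mul_smul]
            exact Finset.sum_comm
        _ = r ^ Fintype.card 𝔽 • f.spaceMap (∑ i, γ i • T.frob (e i)) := by
            rw [map_sum, Finset.smul_sum]
            exact Finset.sum_congr rfl fun i _ => by rw [f.spaceMap_base_smul, smul_comm]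
        _ = _ := by
            rw [hγ, f.spaceMap_base_powerSeries_smul, ← hδ, Finset.smul_sum]
            exact Finset.sum_congr rfl fun i _ => by rw [mul_smul]
    intro j
    have h2 : ∑ j, (∑ i, γ i * a i j ^ Fintype.card 𝔽 - r ^ Fintype.card 𝔽 * δ j) •
        T'.frob (e' j) = 0 := by
      simp only [sub_smul, Finset.sum_sub_distrib, h1, sub_self]
    exact ⟨δ j, sub_eq_zero.1 (Fintype.linearIndependent_iff.1 hli _ h2 j)⟩
  obtain ⟨k, b, y, hby, hba⟩ := exists_frobenius_factorization 𝔽 a r γ hdvd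
  have hsum : (X - C c.zeta : R⟦X⟧) ^ d • x = ∑ l, y l • T.frob (∑ i, b l i • e i) := by
    rw [← hγ]
    simp only [hby, Finset.sum_smul, map_sum, Finset.smul_sum, frob_base_smul, mul_smul]
    exact Finset.sum_comm
  rw [hsum]
  refine Submodule.sum_mem _ fun l _ => ?_
  rw [← C_smul]
  refine Submodule.smul_mem _ _ (Submodule.subset_span ⟨_, ⟨?_, ?_⟩, rfl⟩)
  · exact (N.restrictScalars R).sum_mem fun i _ => Submodule.smul_mem _ _ (heN i)
  · choose s hs using hba l
    have h3 : r • f.spaceMap (∑ i, b l i • e i) = r • ∑ j, s j • e' j := by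
      calc _ = ∑ i, b l i • r • f.spaceMap (e i) := by
            rw [map_sum, Finset.smul_sum]
            exact Finset.sum_congr rfl fun i _ => by rw [f.spaceMap_base_smul, smul_comm]
        _ = ∑ j, (∑ i, b l i * a i j) • e' j := by
            simp only [← ha, Finset.sum_smul, Finset.smul_sum, mul_smul]
            exact Finset.sum_comm
        _ = _ := by
            rw [Finset.smul_sum]
            exact Finset.sum_congr rfl fun j _ => by rw [hs, mul_smul]
    have h4 : f.spaceMap (∑ i, b l i • e i) = ∑ j, s j • e' j := smul_injective_of_tower L hr h3
    change f.spaceMap (∑ i, b l i • e i) ∈ N'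
    rw [h4]
    exact (N'.restrictScalars R).sum_mem fun i _ => Submodule.smul_mem _ _ (heN' i)

theorem inf_comap {N : Submodule R⟦X⟧ T.Space} {N' : Submodule R⟦X⟧ T'.Space}
    (hN : IsShtukaLattice c d N) (hN' : IsShtukaLattice c d N') (f : T.Hom T') :
    IsShtukaLattice c d (N ⊓ N'.comap (f.baseSpaceMap R)) where
  fixed g x hx := hN.fixed g x hx.1
  full := by
    obtain ⟨m, hm⟩ := T'.exists_base_X_pow_smul_space R
    refine hN.full.of_smul_mem (c.pow_ne_zero (m + d))
      (fun x hx => Submodule.smul_mem (N.restrictScalars R) _ hx.1) (fun x hx => ⟨?_, ?_⟩)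
    · exact Submodule.smul_mem (N.restrictScalars R) _ hx
    · change f.spaceMap _ ∈ N'
      rw [f.spaceMap_base_smul]
      exact hN.zeta_pow_smul_map_mem hN' f hm hx
  frob_mem x hx := by
    refine ⟨hN.frob_mem x hx.1, ?_⟩
    change f.spaceMap _ ∈ N'
    rw [f.spaceMap_frob]
    exact hN'.frob_mem _ hx.2
  height x hx := hN.inf_comap_height hN' f hx.1 hx.2

theorem zeta_pow_smul_mem_of_mem {N N' : Submodule R⟦X⟧ T.Space} (hN : IsShtukaLattice c d N)
    (hN' : IsShtukaLattice c d N') {m : ℕ} (hm : ∀ x : T.Space, (X : R⟦X⟧) ^ m • x = 0)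
    {x : T.Space} (hx : x ∈ N) : c.zeta ^ (m + d) • x ∈ N' := by
  have := hN.zeta_pow_smul_map_mem hN' (Hom.id T) hm hx
  rwa [Hom.spaceMap_id] at this

theorem sup {N N' : Submodule R⟦X⟧ T.Space} (hN : IsShtukaLattice c d N)
    (hN' : IsShtukaLattice c d N') : IsShtukaLattice c d (N ⊔ N') := by
  have := hN.map_sup hN' (Hom.id T)
  have h : (Hom.id T).baseSpaceMap R = LinearMap.id := LinearMap.ext Hom.spaceMap_id
  rwa [h, Submodule.map_id] at this

theorem inf {N N' : Submodule R⟦X⟧ T.Space} (hN : IsShtukaLattice c d N)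
    (hN' : IsShtukaLattice c d N') : IsShtukaLattice c d (N ⊓ N') := by
  have := hN.inf_comap hN' (Hom.id T)
  have h : (Hom.id T).baseSpaceMap R = LinearMap.id := LinearMap.ext Hom.spaceMap_id
  rwa [h, Submodule.comap_id] at this

/-- The quotient of a shtuka lattice by `r ^ 2`. -/
abbrev ReductionModSq (N : Submodule R⟦X⟧ T.Space) (r : R) : Type v :=
  N.restrictScalars R ⧸ (LinearMap.range (LinearMap.lsmul R (N.restrictScalars R) (r ^ 2)))

/-- The image of `r • N` in the quotient of `N₀` by `r ^ 2`. -/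
def reduction (N₀ : Submodule R⟦X⟧ T.Space) (r : R) (N : Submodule R⟦X⟧ T.Space) :
    Submodule R (ReductionModSq N₀ r) :=
  (((N.restrictScalars R).map (LinearMap.lsmul R T.Space r)).comap
    (N₀.restrictScalars R).subtype).map (Submodule.mkQ _)

theorem reduction_mono (N₀ : Submodule R⟦X⟧ T.Space) (r : R) : Monotone (reduction N₀ r) :=
  fun _ _ h => Submodule.map_mono (Submodule.comap_mono (Submodule.map_mono h))

/-- If r x ≡ r z modulo r² N₀ with z ∈ N', cancelling r gives x ∈ z + r N₀, and r N₀ ⊆ N'. Thus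
reduction reflects inclusions among mutually bounded lattices. -/
theorem le_of_reduction_le {N₀ N N' : Submodule R⟦X⟧ T.Space} {r : R} (hr : r ≠ 0)
    (hN : ∀ x ∈ N, r • x ∈ N₀) (hN' : ∀ x ∈ N₀, r • x ∈ N')
    (h : reduction N₀ r N ≤ reduction N₀ r N') : N ≤ N' := by
  intro x hx
  have h1 : Submodule.mkQ _ ⟨r • x, hN x hx⟩ ∈ reduction N₀ r N := ⟨_, ⟨x, hx, rfl⟩, rfl⟩
  obtain ⟨y, ⟨z, hz, hzy⟩, hy⟩ := h h1
  obtain ⟨w, hw⟩ := (Submodule.Quotient.eq _).1 hy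
  have h2 : r ^ 2 • (w : T.Space) = y - r • x := congrArg Subtype.val hw
  have h3 : r • x = r • (z - r • (w : T.Space)) := by
    rw [smul_sub, ← mul_smul, ← sq, h2, ← (show r • z = y from hzy)]
    abel
  have h4 : x = z - r • (w : T.Space) := smul_injective_of_tower L hr h3
  rw [h4]
  exact sub_mem hz (hN' _ w.2)

/-- A basis of N₀ presents the quotient as an image of a finite power of R/(r²), from which it
inherits chain conditions and finiteness. -/
theorem exists_surjective_reductionModSq {N₀ : Submodule R⟦X⟧ T.Space}
    (hN₀ : IsFullLattice L (N₀.restrictScalars R)) (r : R) :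
    ∃ g : (Fin (Module.finrank L T.Space) → R ⧸ Ideal.span {r ^ 2}) →ₗ[R] ReductionModSq N₀ r,
      Function.Surjective g := by
  obtain ⟨e, he⟩ := hN₀
  have heN : ∀ i, e i ∈ N₀.restrictScalars R := fun i => he ▸ Submodule.subset_span ⟨i, rfl⟩
  let q : N₀.restrictScalars R →ₗ[R] ReductionModSq N₀ r := Submodule.mkQ _
  let h : ∀ i, (R ⧸ Ideal.span {r ^ 2}) →ₗ[R] ReductionModSq N₀ r := fun i =>
    Submodule.liftQ (Ideal.span {r ^ 2}) (LinearMap.toSpanSingleton R _ (q ⟨e i, heN i⟩)) (by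
      rw [Ideal.span, Submodule.span_le, Set.singleton_subset_iff, SetLike.mem_coe,
        LinearMap.mem_ker, LinearMap.toSpanSingleton_apply, ← map_smul]
      exact (Submodule.Quotient.mk_eq_zero _).2 ⟨_, rfl⟩)
  refine ⟨LinearMap.lsum R _ R h, fun y => ?_⟩
  obtain ⟨⟨x, hx⟩, rfl⟩ := Submodule.mkQ_surjective _ y
  have hx' : x ∈ Submodule.span R (Set.range e) := he ▸ hx
  obtain ⟨a, ha⟩ := (Submodule.mem_span_range_iff_exists_fun R).1 hx'
  refine ⟨fun i => Submodule.Quotient.mk (a i), ?_⟩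
  have h1 : (⟨x, hx⟩ : N₀.restrictScalars R) = ∑ i, a i • ⟨e i, heN i⟩ := by
    apply Subtype.ext
    refine ha.symm.trans ?_
    simp only [AddSubmonoidClass.coe_finsetSum, SetLike.val_smul]
  change _ = q ⟨x, hx⟩
  rw [h1, map_sum, LinearMap.lsum_apply, LinearMap.sum_apply]
  exact Finset.sum_congr rfl fun i _ => (map_smul q (a i) _).symm

/-- With r = ζ^(m+d), inclusions among shtuka lattices are visible on their reductions, which are
submodules of the finite length module N₀/r²N₀; there both chain conditions hold. -/
theorem exists_extremal {N₀ : Submodule R⟦X⟧ T.Space} (hN₀ : IsShtukaLattice c d N₀) :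
    (∃ N : Submodule R⟦X⟧ T.Space, Maximal (IsShtukaLattice c d) N) ∧
      (∃ N : Submodule R⟦X⟧ T.Space, Minimal (IsShtukaLattice c d) N) := by
  obtain ⟨m, hm⟩ := T.exists_base_X_pow_smul_space R
  have hr := c.pow_ne_zero (m + d)
  have h1 : ∀ {N : Submodule R⟦X⟧ T.Space}, IsShtukaLattice c d N →
      (∀ x ∈ N, c.zeta ^ (m + d) • x ∈ N₀) ∧ ∀ x ∈ N₀, c.zeta ^ (m + d) • x ∈ N := fun hN =>
    ⟨fun x hx => hN.zeta_pow_smul_mem_of_mem hN₀ hm hx,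
      fun x hx => hN₀.zeta_pow_smul_mem_of_mem hN hm hx⟩
  generalize c.zeta ^ (m + d) = r at hr h1
  have hle : ∀ {N N' : Submodule R⟦X⟧ T.Space}, IsShtukaLattice c d N → IsShtukaLattice c d N' →
      reduction N₀ r N ≤ reduction N₀ r N' → N ≤ N' := fun hN hN' =>
    le_of_reduction_le hr (h1 hN).1 (h1 hN').2
  obtain ⟨g, hg⟩ := exists_surjective_reductionModSq hN₀.full r
  have hfl := isFiniteLength_iff_isNoetherian_isArtinian.1
    (isFiniteLength_quotient_span_singleton R (mem_nonZeroDivisors_of_ne_zero (pow_ne_zero 2 hr)))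
  have := hfl.1
  have := hfl.2
  have : IsNoetherian R (ReductionModSq N₀ r) := isNoetherian_of_surjective g
    (LinearMap.range_eq_top.2 hg)
  have : IsArtinian R (ReductionModSq N₀ r) := isArtinian_of_surjective _ g hg
  set S := reduction N₀ r '' {N | IsShtukaLattice c d N} with hS
  have hne : S.Nonempty := ⟨_, N₀, hN₀, rfl⟩
  constructor
  · obtain ⟨_, ⟨N, hN, rfl⟩, hmax⟩ :=
      (wellFounded_gt (α := Submodule R (ReductionModSq N₀ r))).has_min S hne
    exact ⟨N, hN, fun N' hN' hNN' => hle hN' hN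
      (not_lt_iff_le_imp_ge.1 (hmax _ ⟨N', hN', rfl⟩) (reduction_mono N₀ r hNN'))⟩
  · obtain ⟨_, ⟨N, hN, rfl⟩, hmin⟩ :=
      (wellFounded_lt (α := Submodule R (ReductionModSq N₀ r))).has_min S hne
    exact ⟨N, hN, fun N' hN' hNN' => hle hN hN'
      (not_lt_iff_le_imp_ge.1 (hmin _ ⟨N', hN', rfl⟩) (reduction_mono N₀ r hNN'))⟩

theorem finite_setOf [Finite (IsLocalRing.ResidueField R)] (c : CharPoint R) (d : ℕ)
    (T : TorsionRep 𝔽 K L) : {N : Submodule R⟦X⟧ T.Space | IsShtukaLattice c d N}.Finite := by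
  obtain hS | ⟨N₀, hN₀⟩ := {N : Submodule R⟦X⟧ T.Space | IsShtukaLattice c d N}.eq_empty_or_nonempty
  · rw [hS]
    exact Set.finite_empty
  obtain ⟨m, hm⟩ := T.exists_base_X_pow_smul_space R
  have hr := c.pow_ne_zero (m + d)
  have h1 : ∀ {N : Submodule R⟦X⟧ T.Space}, IsShtukaLattice c d N →
      (∀ x ∈ N, c.zeta ^ (m + d) • x ∈ N₀) ∧ ∀ x ∈ N₀, c.zeta ^ (m + d) • x ∈ N := fun hN =>
    ⟨fun x hx => hN.zeta_pow_smul_mem_of_mem hN₀ hm hx,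
      fun x hx => hN₀.zeta_pow_smul_mem_of_mem hN hm hx⟩
  generalize c.zeta ^ (m + d) = r at hr h1
  have hle : ∀ {N N' : Submodule R⟦X⟧ T.Space}, IsShtukaLattice c d N → IsShtukaLattice c d N' →
      reduction N₀ r N ≤ reduction N₀ r N' → N ≤ N' := fun hN hN' =>
    le_of_reduction_le hr (h1 hN).1 (h1 hN').2
  obtain ⟨g, hg⟩ := exists_surjective_reductionModSq hN₀.full r
  have hart := (isFiniteLength_iff_isNoetherian_isArtinian.1 (isFiniteLength_quotient_span_singleton
    R (mem_nonZeroDivisors_of_ne_zero (pow_ne_zero 2 hr)))).2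
  have : IsArtinianRing (R ⧸ Ideal.span {r ^ 2}) := isArtinian_of_tower R hart
  -- The quotient is Artinian, so (r²) contains a power of the maximal ideal; a finite residue field
  -- then makes it finite.
  have : Finite (R ⧸ Ideal.span {r ^ 2}) := IsLocalRing.finite_quotient_iff.2
    (IsLocalRing.exists_maximalIdeal_pow_le_of_isArtinianRing_quotient _)
  have : Finite (ReductionModSq N₀ r) := Finite.of_surjective g hg
  have : Finite (Submodule R (ReductionModSq N₀ r)) :=
    Finite.of_injective (fun N => (N : Set (ReductionModSq N₀ r))) SetLike.coe_injective
  refine Set.Finite.of_finite_image (f := reduction N₀ r) (Set.toFinite _) ?_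
  intro N hN N' hN' h
  exact le_antisymm (hle hN hN' h.le) (hle hN' hN h.ge)

end IsShtukaLattice

end TorsionRep

theorem Pullback.mem_span_range_incl {S : Type u} [CommRing S] {φ : S →+* S} {M : Type u}
    [AddCommGroup M] [Module S M] (y : Pullback φ M) :
    y ∈ Submodule.span S (Set.range (Pullback.incl φ (M := M))) := by
  induction y using TensorProduct.induction_on with
  | zero => exact zero_mem _
  | tmul s m =>
    have h : (s ⊗ₜ[S] m : Twist φ ⊗[S] M) = (Twist.of φ).symm s • Pullback.incl φ m := by
      change _ = s • ((1 : Twist φ) ⊗ₜ[S] m : Twist φ ⊗[S] M)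
      rw [TensorProduct.smul_tmul', smul_eq_mul, mul_one]
    rw [h]
    exact Submodule.smul_mem _ _ (Submodule.subset_span ⟨m, rfl⟩)
  | add x y hx hy => exact add_mem hx hy

/-! ### The fibre of a torsion local shtuka -/

namespace TorsionLocalShtuka

open PowerSeries

section Carrier

variable {𝔽 : Type w} [Field 𝔽] [Fintype 𝔽] {R : Type u} [CommRing R] [IsLocalRing R]
  [Algebra 𝔽 R] {c : CharPoint R} (M : TorsionLocalShtuka 𝔽 c)

instance : Module R M.carrier := inferInstanceAs (Module R (RestrictScalars R R⟦X⟧ M.carrier))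

instance : IsScalarTower R R⟦X⟧ M.carrier where
  smul_assoc r s m := by
    rw [Algebra.smul_def, mul_smul]
    rfl

instance : Module.Free R M.carrier := M.free

instance : Module.Finite R⟦X⟧ M.carrier :=
  have := M.finitePresentation
  inferInstance

theorem exists_X_pow_smul : ∃ n : ℕ, ∀ m : M.carrier, (X : R⟦X⟧) ^ n • m = 0 :=
  exists_X_pow_smul_eq_zero M.torsion

instance : Module.Finite R M.carrier :=
  finite_of_X_pow_smul_eq_zero M.exists_X_pow_smul.choose_spec

end Carrier

variable {𝔽 : Type w} [Field 𝔽] [Fintype 𝔽] {R : Type u} [CommRing R] [IsLocalRing R]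
  [Algebra 𝔽 R] {c : CharPoint R} {L : Type v} [Field L] [Algebra 𝔽 L] [Algebra R L]
  (M : TorsionLocalShtuka 𝔽 c)

instance : Module L (M.Fibre L) := Module.compHom (M.Fibre L) (C : L →+* L⟦X⟧)

theorem fibre_smul_eq_C_smul (l : L) (x : M.Fibre L) : l • x = (C l : L⟦X⟧) • x := rfl

instance : IsScalarTower L L⟦X⟧ (M.Fibre L) where
  smul_assoc l s x := by
    rw [fibre_smul_eq_C_smul, ← mul_smul, smul_eq_C_mul]

variable (L) in
/-- The map `m ↦ 1 ⊗ m` from `M` to its fibre. -/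
def fibreIncl : M.carrier →+ M.Fibre L := (TensorProduct.mk R⟦X⟧ L⟦X⟧ M.carrier 1).toAddMonoidHom

theorem base_smul_fibre_def (s : R⟦X⟧) (x : M.Fibre L) :
    s • x = PowerSeries.map (algebraMap R L) s • x :=
  (algebraMap_smul (M := L⟦X⟧ ⊗[R⟦X⟧] M.carrier) L⟦X⟧ s x).symm

theorem fibreIncl_base_smul (s : R⟦X⟧) (m : M.carrier) :
    M.fibreIncl L (s • m) = s • M.fibreIncl L m :=
  (TensorProduct.mk R⟦X⟧ L⟦X⟧ M.carrier 1).map_smul s m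

theorem smul_fibreIncl (l : L⟦X⟧) (m : M.carrier) :
    l • M.fibreIncl L m = (l ⊗ₜ[R⟦X⟧] m : L⟦X⟧ ⊗[R⟦X⟧] M.carrier) :=
  (PowerSeriesBaseChange.tmul_eq_smul l m).symm

variable {M} in
@[elab_as_elim]
theorem fibre_induction_on {P : M.Fibre L → Prop} (x : M.Fibre L)
    (zero : P 0) (smul_incl : ∀ (l : L⟦X⟧) m, P (l • M.fibreIncl L m))
    (add : ∀ x y, P x → P y → P (x + y)) : P x :=
  PowerSeriesBaseChange.induction_on (P := P) x zero
    (fun l m => by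
      have := smul_incl l m
      rw [smul_fibreIncl] at this
      exact this) add

theorem X_pow_smul_fibre {n : ℕ} (hn : ∀ m : M.carrier, (X : R⟦X⟧) ^ n • m = 0)
    (x : M.Fibre L) : (X : L⟦X⟧) ^ n • x = 0 :=
  PowerSeriesBaseChange.X_pow_smul (B := R) (M := M.carrier) hn x

variable (L) in
/-- An `L`-basis of the fibre from an `R`-basis of `M`. -/
def fibreBasis : Module.Basis (Module.Free.ChooseBasisIndex R M.carrier) L (M.Fibre L) :=
  PowerSeriesBaseChange.basis M.exists_X_pow_smul.choose_spec (Module.Free.chooseBasis R M.carrier)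

theorem fibreBasis_apply (i) :
    M.fibreBasis L i = M.fibreIncl L (Module.Free.chooseBasis R M.carrier i) :=
  PowerSeriesBaseChange.basis_apply _ _ i

instance : FiniteDimensional L (M.Fibre L) := Module.Finite.of_basis (M.fibreBasis L)

theorem fibreIncl_coeff_smul (r : R) (m : M.carrier) :
    M.fibreIncl L (r • m) = algebraMap R L r • M.fibreIncl L m := by
  rw [← smul_one_smul R⟦X⟧ r m, fibreIncl_base_smul, base_smul_fibre_def, smul_eq_C_mul, mul_one,
    map_C]
  rfl

theorem fibreIncl_injective [FaithfulSMul R L] : Function.Injective (M.fibreIncl L) := by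
  rw [injective_iff_map_eq_zero]
  intro m hm
  set b := Module.Free.chooseBasis R M.carrier
  have h : ∑ i, algebraMap R L (b.repr m i) • M.fibreBasis L i = 0 := by
    rw [← hm]
    refine Eq.trans ?_ (congrArg (M.fibreIncl L) (b.sum_repr m))
    rw [map_sum]
    exact Finset.sum_congr rfl fun i _ => by rw [fibreIncl_coeff_smul, fibreBasis_apply]
  have h1 := Fintype.linearIndependent_iff.1 (M.fibreBasis L).linearIndependent _ h
  rw [← b.sum_repr m]
  refine Finset.sum_eq_zero fun i _ => ?_
  rw [(FaithfulSMul.algebraMap_eq_zero_iff R L).1 (h1 i), zero_smul]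

section Tau

variable [FaithfulSMul R L]

theorem toFibre_mk (m : M.carrier) :
    M.toFibre L (LocalizedModule.mkLinearMap (zPowers c) M.carrier m) = M.fibreIncl L m := by
  have := LocalizedModule.lift_comp (zPowers c) (TensorProduct.mk R⟦X⟧ L⟦X⟧ M.carrier 1)
    (M.isUnit_zPowers L)
  exact congrArg (fun g : M.carrier →ₗ[R⟦X⟧] L⟦X⟧ ⊗[R⟦X⟧] M.carrier => g m) this

/-- After clearing denominators this reduces to M → M ⊗ L⟦z⟧, injective since M is free over R and R
embeds in L. Identities in M[1/(z - ζ)] may therefore be checked in the fibre. -/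
theorem toFibre_injective : Function.Injective (M.toFibre L) := by
  rw [injective_iff_map_eq_zero]
  intro x hx
  obtain ⟨⟨m, s⟩, hs⟩ := IsLocalizedModule.surj (zPowers c)
    (LocalizedModule.mkLinearMap (zPowers c) M.carrier) x
  have h1 : M.fibreIncl L m = 0 := by
    rw [← toFibre_mk]
    refine (congrArg (M.toFibre L) hs).symm.trans ?_
    exact (LinearMap.map_smul (M.toFibre L) (s : R⟦X⟧) x).trans (by rw [hx, smul_zero])
  have h2 : m = 0 := M.fibreIncl_injective (h1.trans (map_zero _).symm)
  rw [h2, map_zero] at hs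
  exact IsLocalizedModule.smul_injective (LocalizedModule.mkLinearMap (zPowers c) M.carrier) s
    (hs.trans (smul_zero s).symm)

theorem tauFibre_smul_fibreIncl (l : L⟦X⟧) (m : M.carrier) :
    M.tauFibre L (l • M.fibreIncl L m) = sigma 𝔽 L l • M.toFibre L (M.semilin m) := by
  rw [smul_fibreIncl]
  exact M.tauFibre_tmul L l m

theorem tauFibre_fibreIncl (m : M.carrier) :
    M.tauFibre L (M.fibreIncl L m) = M.toFibre L (M.semilin m) := by
  have := M.tauFibre_smul_fibreIncl (L := L) 1 m
  rwa [one_smul, map_one, one_smul] at this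

theorem tauFibre_powerSeries_smul (l : L⟦X⟧) (x : M.Fibre L) :
    M.tauFibre L (l • x) = sigma 𝔽 L l • M.tauFibre L x := by
  induction x using fibre_induction_on with
  | zero => rw [smul_zero, map_zero, smul_zero]
  | smul_incl s m =>
    rw [← mul_smul, tauFibre_smul_fibreIncl, tauFibre_smul_fibreIncl, map_mul, mul_smul]
  | add x y hx hy => rw [smul_add, map_add, map_add, smul_add, hx, hy]

theorem isFrobeniusSemilinear_tauFibre : IsFrobeniusSemilinear 𝔽 (L := L) (M.tauFibre L) := by
  intro l x
  have := M.tauFibre_powerSeries_smul (C l) x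
  rwa [sigma_C] at this

theorem toFibre_tau_mem (y : Pullback (sigma 𝔽 R) M.carrier) :
    M.toFibre L (M.tau (LocalizedModule.mkLinearMap (zPowers c) _ y)) ∈
      Submodule.span R⟦X⟧ (Set.range fun m => M.tauFibre L (M.fibreIncl L m)) := by
  have hy := Pullback.mem_span_range_incl y
  induction hy using Submodule.span_induction with
  | mem y hy =>
    obtain ⟨m, rfl⟩ := hy
    exact Submodule.subset_span ⟨m, M.tauFibre_fibreIncl m⟩
  | zero => rw [map_zero, map_zero, map_zero]; exact zero_mem _
  | add x y _ _ hx hy => rw [map_add, map_add, map_add]; exact add_mem hx hy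
  | smul s x _ hx =>
    rw [map_smul, map_smul, LinearMap.map_smul]; exact Submodule.smul_mem _ _ hx

/-- This is the étaleness required by Lang's theorem: τ is onto after inverting z - ζ, and z - ζ is
a unit of L⟦z⟧ because ζ ≠ 0. -/
theorem span_range_tauFibre : Submodule.span L (Set.range (M.tauFibre L)) = ⊤ := by
  obtain ⟨n, hn⟩ := M.exists_X_pow_smul
  have h1 := coe_span_powerSeries_eq (B := L) (M := M.Fibre L) (M.X_pow_smul_fibre hn)
    (s := Set.range (M.tauFibre L)) (by
      rintro _ ⟨x, rfl⟩
      refine Submodule.subset_span ⟨(X : L⟦X⟧) • x, ?_⟩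
      rw [tauFibre_powerSeries_smul, sigma_X])
  suffices h : Submodule.span L⟦X⟧ (Set.range (M.tauFibre L)) = ⊤ by
    rw [h] at h1
    exact SetLike.coe_injective h1.symm
  have h2 : ∀ m, M.fibreIncl L m ∈ Submodule.span L⟦X⟧ (Set.range (M.tauFibre L)) := by
    intro m
    -- Write τ⁻¹(m) = y / s, so that s m = τ(y); the denominator s is removed at the end as a unit
    -- of L⟦z⟧.
    obtain ⟨⟨y, s⟩, hs⟩ := IsLocalizedModule.surj (zPowers c)
      (LocalizedModule.mkLinearMap (zPowers c) (Pullback (sigma 𝔽 R) M.carrier))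
      (M.tau.symm (LocalizedModule.mkLinearMap (zPowers c) M.carrier m))
    have h3 : (s : R⟦X⟧) • M.fibreIncl L m ∈
        Submodule.span R⟦X⟧ (Set.range fun m => M.tauFibre L (M.fibreIncl L m)) := by
      have h4 := M.toFibre_tau_mem (L := L) y
      have h5 : M.toFibre L (M.tau (LocalizedModule.mkLinearMap (zPowers c) _ y)) =
          (s : R⟦X⟧) • M.fibreIncl L m := by
        rw [← toFibre_mk, ← LinearMap.map_smul]
        congr 1
        refine (congrArg M.tau hs).symm.trans ?_
        refine (M.tau.map_smul (s : R⟦X⟧) _).trans ?_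
        rw [LinearEquiv.apply_symm_apply]
      rwa [h5] at h4
    have h6 : (s : R⟦X⟧) • M.fibreIncl L m ∈
        Submodule.span L⟦X⟧ (Set.range (M.tauFibre L)) := by
      generalize (s : R⟦X⟧) • M.fibreIncl L m = z at h3
      induction h3 using Submodule.span_induction with
      | mem y hy => obtain ⟨m, rfl⟩ := hy; exact Submodule.subset_span ⟨_, rfl⟩
      | zero => exact zero_mem _
      | add x y _ _ hx hy => exact add_mem hx hy
      | smul s x _ hx => rw [base_smul_fibre_def]; exact Submodule.smul_mem _ _ hx
    rw [base_smul_fibre_def] at h6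
    obtain ⟨s, k, rfl⟩ := s
    have hunit : IsUnit (PowerSeries.map (algebraMap R L) ((X - C c.zeta) ^ k)) := by
      rw [map_pow]
      refine IsUnit.pow _ ?_
      rw [PowerSeries.isUnit_iff_constantCoeff]
      simpa using c.ne_zero
    exact (Submodule.smul_mem_iff_of_isUnit _ hunit).1 h6
  rw [eq_top_iff]
  rintro x -
  induction x using fibre_induction_on with
  | zero => exact zero_mem _
  | smul_incl l m => exact Submodule.smul_mem _ _ (h2 m)
  | add x y hx hy => exact add_mem hx hy

theorem span_tateModule [IsSepClosed L] :
    Submodule.span L (M.tateModule L : Set (M.Fibre L)) = ⊤ :=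
  M.isFrobeniusSemilinear_tauFibre.span_fixed_eq_top M.span_range_tauFibre

end Tau

section Hom

variable {M} {M' : TorsionLocalShtuka 𝔽 c}

theorem Hom.fibreMap_powerSeries_smul (F : Hom M M') (l : L⟦X⟧) (x : M.Fibre L) :
    F.fibreMap L (l • x) = l • F.fibreMap L x :=
  (F.toLinearMap.baseChange L⟦X⟧).map_smul l x

theorem Hom.fibreMap_fibreIncl (F : Hom M M') (m : M.carrier) :
    F.fibreMap L (M.fibreIncl L m) = M'.fibreIncl L (F.toLinearMap m) := rfl

end Hom

section Galois

variable {K : Type*} [Field K] [Algebra R K] [Algebra K L] [IsScalarTower R K L]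

theorem galAct_smul_fibreIncl (g : L ≃ₐ[K] L) (l : L⟦X⟧) (m : M.carrier) :
    M.galAct g (l • M.fibreIncl L m) = PowerSeries.map (g : L →+* L) l • M.fibreIncl L m := by
  rw [smul_fibreIncl, smul_fibreIncl]
  rfl

theorem galAct_fibreIncl (g : L ≃ₐ[K] L) (m : M.carrier) :
    M.galAct g (M.fibreIncl L m) = M.fibreIncl L m := by
  have := M.galAct_smul_fibreIncl g 1 m
  rwa [one_smul, map_one, one_smul] at this

theorem galAct_powerSeries_smul (g : L ≃ₐ[K] L) (l : L⟦X⟧) (x : M.Fibre L) :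
    M.galAct g (l • x) = PowerSeries.map (g : L →+* L) l • M.galAct g x := by
  induction x using fibre_induction_on with
  | zero => rw [smul_zero, map_zero, smul_zero]
  | smul_incl s m =>
    rw [← mul_smul, galAct_smul_fibreIncl, galAct_smul_fibreIncl, map_mul, mul_smul]
  | add x y hx hy => rw [smul_add, map_add, map_add, smul_add, hx, hy]

end Galois

theorem coeff_smul_eq [IsScalarTower 𝔽 R L] (a : 𝔽⟦X⟧) (x : M.Fibre L) :
    a • x = PowerSeries.map (algebraMap 𝔽 L) a • x := by
  rw [coeff_smul_def, base_smul_fibre_def]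
  congr 1
  ext n
  simp [← IsScalarTower.algebraMap_apply]

end TorsionLocalShtuka

/-! ### The lattice of a model -/

open PowerSeries

section LocMap

variable {S : Type u} [CommRing S] (P : Submonoid S) {M M' : Type u} [AddCommGroup M] [Module S M]
  [AddCommGroup M'] [Module S M']

theorem locMap_mk (f : M →ₗ[S] M') (m : M) :
    locMap P f (LocalizedModule.mkLinearMap P M m) = LocalizedModule.mkLinearMap P M' (f m) :=
  IsLocalizedModule.map_apply P _ _ f m

end LocMap

/-! ### Morphisms of shtukas, tested on fibres -/

namespace TorsionLocalShtuka

variable {𝔽 : Type w} [Field 𝔽] [Fintype 𝔽] {R : Type u} [CommRing R] [IsLocalRing R]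
  [Algebra 𝔽 R] {c : CharPoint R} (L : Type v) [Field L] [Algebra 𝔽 L] [Algebra R L]
  [FaithfulSMul R L] {M M' : TorsionLocalShtuka 𝔽 c}

theorem semilin_def (m : M.carrier) : M.semilin m =
    M.tau (LocalizedModule.mkLinearMap (zPowers c) _ (Pullback.incl (sigma 𝔽 R) m)) := rfl

theorem toFibre_locMap (F : M.carrier →ₗ[R⟦X⟧] M'.carrier)
    (x : LocalizedModule (zPowers c) M.carrier) :
    M'.toFibre L (locMap (zPowers c) F x) =
      F.baseChange L⟦X⟧ (M.toFibre L x : L⟦X⟧ ⊗[R⟦X⟧] M.carrier) := by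
  let G : M.Fibre L →ₗ[R⟦X⟧] M'.Fibre L := F.lTensor L⟦X⟧
  have h : M'.toFibre L ∘ₗ locMap (zPowers c) F = G ∘ₗ M.toFibre L := by
    refine IsLocalizedModule.ext (zPowers c) (LocalizedModule.mkLinearMap (zPowers c) M.carrier)
      (M'.isUnit_zPowers L) (LinearMap.ext fun m => ?_)
    change M'.toFibre L (locMap _ F (LocalizedModule.mkLinearMap _ _ m)) =
      G (M.toFibre L (LocalizedModule.mkLinearMap _ _ m))
    rw [locMap_mk, toFibre_mk, toFibre_mk]
    rfl
  exact congrArg (fun g => g x) h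

/-- A linear map of torsion local shtukas is a morphism if its base change commutes with the
Frobenius of the fibres. -/
theorem comm_of_tauFibre (F : M.carrier →ₗ[R⟦X⟧] M'.carrier)
    (h : ∀ m, M'.tauFibre L (M'.fibreIncl L (F m)) =
      F.baseChange L⟦X⟧ (M.tauFibre L (M.fibreIncl L m) : L⟦X⟧ ⊗[R⟦X⟧] M.carrier)) :
    M'.tau.toLinearMap ∘ₗ locMap (zPowers c) (Pullback.map (sigma 𝔽 R) F) =
      locMap (zPowers c) F ∘ₗ M.tau.toLinearMap := by
  refine IsLocalizedModule.ext (zPowers c)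
    (LocalizedModule.mkLinearMap (zPowers c) (Pullback (sigma 𝔽 R) M.carrier))
    (IsLocalizedModule.map_units (LocalizedModule.mkLinearMap (zPowers c) M'.carrier))
    (LinearMap.ext fun y => ?_)
  have hy := Pullback.mem_span_range_incl y
  induction hy using Submodule.span_induction with
  | mem y hy =>
    obtain ⟨m, rfl⟩ := hy
    -- On the generators 1 ⊗ m the identity can be compared inside the fibre, where it becomes the
    -- hypothesis.
    apply M'.toFibre_injective (L := L)
    change M'.toFibre L (M'.tau (locMap _ (Pullback.map _ F) (LocalizedModule.mkLinearMap _ _ _))) =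
      M'.toFibre L (locMap (zPowers c) F (M.semilin m))
    rw [locMap_mk, toFibre_locMap]
    have h1 : Pullback.map (sigma 𝔽 R) F (Pullback.incl (sigma 𝔽 R) m) =
      Pullback.incl (sigma 𝔽 R) (F m) := rfl
    rw [h1, ← semilin_def, ← tauFibre_fibreIncl, h, tauFibre_fibreIncl]
  | zero => rw [map_zero, map_zero]
  | add x y _ _ hx hy => rw [map_add, map_add, hx, hy]
  | smul s x _ hx => rw [map_smul, map_smul, hx]

end TorsionLocalShtuka

namespace ShtukaModel

variable {𝔽 : Type w} [Field 𝔽] [Fintype 𝔽] {R : Type u} [CommRing R] [IsDomain R]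
  [IsDiscreteValuationRing R] [Algebra 𝔽 R] {K : Type*} [Field K] [Algebra R K]
  [IsFractionRing R K] {L : Type v} [Field L] [Algebra K L] [IsSepClosure K L] [Algebra R L]
  [IsScalarTower R K L] [FaithfulSMul R L] [Algebra 𝔽 L] [IsScalarTower 𝔽 R L]
  [TorsionRep.GaloisFixes 𝔽 K L] {c : CharPoint R} {d : ℕ} {T T' : TorsionRep 𝔽 K L}

theorem iso_smul (M : ShtukaModel c T) (s : 𝔽⟦X⟧) (t : T.carrier) :
    ((M.shtuka.tateModule L).subtype.comp M.iso.toLinearMap).toAddMonoidHom (s • t) =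
      RingHom.id L⟦X⟧ (PowerSeries.map (algebraMap 𝔽 L) s) •
        ((M.shtuka.tateModule L).subtype.comp M.iso.toLinearMap).toAddMonoidHom t := by
  rw [LinearMap.toAddMonoidHom_coe, map_smul, M.shtuka.coeff_smul_eq]
  rfl

/-- The map from `L⟦z⟧ ⊗ T` to the fibre of a model of `T`. -/
def spaceMap (M : ShtukaModel c T) : T.Space →ₗ[L⟦X⟧] M.shtuka.Fibre L where
  toFun := T.lift (RingHom.id _) _ M.iso_smul
  map_add' := map_add _
  map_smul' := T.lift_smul _ _ M.iso_smul

theorem spaceMap_incl (M : ShtukaModel c T) (t : T.carrier) :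
    M.spaceMap (T.incl t) = (M.iso t : M.shtuka.Fibre L) :=
  T.lift_incl _ _ M.iso_smul t

theorem spaceMap_coeff_smul (M : ShtukaModel c T) (l : L) (x : T.Space) :
    M.spaceMap (l • x) = l • M.spaceMap x :=
  M.spaceMap.map_smul (C l) x

theorem spaceMap_frob (M : ShtukaModel c T) (x : T.Space) :
    M.spaceMap (T.frob x) = M.shtuka.tauFibre L (M.spaceMap x) :=
  TorsionRep.Space.hom_ext (sigma 𝔽 L) (f := M.spaceMap.toAddMonoidHom.comp T.frob)
    (g := (M.shtuka.tauFibre L).comp M.spaceMap.toAddMonoidHom)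
    (fun l x => by
      simp only [AddMonoidHom.comp_apply, TorsionRep.frob_smul, LinearMap.toAddMonoidHom_coe,
        map_smul])
    (fun l x => by
      simp only [AddMonoidHom.comp_apply, LinearMap.toAddMonoidHom_coe, map_smul,
        TorsionLocalShtuka.tauFibre_powerSeries_smul])
    (fun t => by
      simp only [AddMonoidHom.comp_apply, LinearMap.toAddMonoidHom_coe, TorsionRep.frob_incl,
        spaceMap_incl]
      exact (M.iso t).2.symm) x

theorem spaceMap_gal (M : ShtukaModel c T) (g : L ≃ₐ[K] L) (x : T.Space) :
    M.spaceMap (T.gal g x) = M.shtuka.galAct g (M.spaceMap x) :=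
  TorsionRep.Space.hom_ext (PowerSeries.map (g : L →+* L))
    (f := M.spaceMap.toAddMonoidHom.comp (T.gal g))
    (g := (M.shtuka.galAct g).comp M.spaceMap.toAddMonoidHom)
    (fun l x => by
      simp only [AddMonoidHom.comp_apply, TorsionRep.gal_smul, LinearMap.toAddMonoidHom_coe,
        map_smul])
    (fun l x => by
      simp only [AddMonoidHom.comp_apply, LinearMap.toAddMonoidHom_coe, map_smul,
        TorsionLocalShtuka.galAct_powerSeries_smul])
    (fun t => by
      simp only [AddMonoidHom.comp_apply, LinearMap.toAddMonoidHom_coe, TorsionRep.gal_incl,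
        spaceMap_incl, M.equivariant]) x

/-- Injectivity: an 𝔽-basis of T goes to fixed vectors independent over 𝔽, hence over L.
Surjectivity: by Lang's theorem the Tate module spans the fibre. -/
theorem spaceMap_bijective (M : ShtukaModel c T) : Function.Bijective M.spaceMap := by
  have : IsSepClosed L := IsSepClosure.sep_closed K
  let g : T.Space →ₗ[L] M.shtuka.Fibre L :=
    { toFun := M.spaceMap
      map_add' := map_add _
      map_smul' := M.spaceMap_coeff_smul }
  have hgb : ∀ i, g (T.basis i) =
      (M.iso (Module.Free.chooseBasis 𝔽 T.carrier i) : M.shtuka.Fibre L) := fun i => by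
    rw [TorsionRep.basis_apply]
    exact M.spaceMap_incl _
  constructor
  · let : Module 𝔽 (M.shtuka.Fibre L) := Module.compHom _ (algebraMap 𝔽 L)
    have : IsScalarTower 𝔽 L (M.shtuka.Fibre L) :=
      ⟨fun a l x => by rw [Algebra.smul_def, mul_smul]; rfl⟩
    have hli : LinearIndependent L fun i => g (T.basis i) := by
      refine M.shtuka.isFrobeniusSemilinear_tauFibre.linearIndependent_of_fixed (𝔽 := 𝔽)
        (fun i => ?_) ?_
      · rw [hgb]
        exact (M.iso _).2
      · let h : T.carrier →ₗ[𝔽] M.shtuka.Fibre L :=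
          { toFun := fun t => M.iso t
            map_add' := fun t t' => by rw [map_add]; rfl
            map_smul' := fun a t => by
              have := M.spaceMap_coeff_smul (algebraMap 𝔽 L a) (T.incl t)
              rw [← TorsionRep.incl_field_smul, spaceMap_incl, spaceMap_incl] at this
              exact this }
        have hinj : Function.Injective h := fun t t' htt =>
          M.iso.injective (Subtype.ext htt)
        have := (Module.Free.chooseBasis 𝔽 T.carrier).linearIndependent.map' h
          (LinearMap.ker_eq_bot.2 hinj)
        rw [show (fun i => g (T.basis i)) = h ∘ Module.Free.chooseBasis 𝔽 T.carrier from funext hgb]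
        exact this
    have hinj : Function.Injective g := by
      rw [← LinearMap.ker_eq_bot, LinearMap.ker_eq_bot']
      intro x hx
      have h1 : ∑ i, T.basis.repr x i • g (T.basis i) = 0 := by
        rw [← hx]
        conv_rhs => rw [← T.basis.sum_repr x, map_sum]
        exact Finset.sum_congr rfl fun i _ => (map_smul g _ _).symm
      have h2 := Fintype.linearIndependent_iff.1 hli _ h1
      rw [← T.basis.sum_repr x]
      exact Finset.sum_eq_zero fun i _ => by rw [h2, zero_smul]
    exact hinj
  · have hrange : LinearMap.range g = ⊤ := by
      rw [eq_top_iff, ← M.shtuka.span_tateModule, Submodule.span_le]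
      intro x hx
      refine ⟨T.incl (M.iso.symm ⟨x, hx⟩), ?_⟩
      refine (M.spaceMap_incl _).trans ?_
      rw [LinearEquiv.apply_symm_apply]
    have hsurj : Function.Surjective g := LinearMap.range_eq_top.1 hrange
    exact hsurj

/-- The isomorphism between `L⟦z⟧ ⊗ T` and the fibre of a model of `T`. -/
def spaceEquiv (M : ShtukaModel c T) : T.Space ≃ₗ[L⟦X⟧] M.shtuka.Fibre L :=
  LinearEquiv.ofBijective M.spaceMap M.spaceMap_bijective

theorem spaceEquiv_apply (M : ShtukaModel c T) (x : T.Space) : M.spaceEquiv x = M.spaceMap x := rfl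

theorem spaceEquiv_symm_base_smul (M : ShtukaModel c T) (s : R⟦X⟧) (x : M.shtuka.Fibre L) :
    M.spaceEquiv.symm (s • x) = s • M.spaceEquiv.symm x := by
  rw [TorsionLocalShtuka.base_smul_fibre_def, map_smul, TorsionRep.base_powerSeries_smul_def]

/-- The embedding of a model of `T` into `L⟦z⟧ ⊗ T`. -/
def embed (M : ShtukaModel c T) : M.shtuka.carrier →ₗ[R⟦X⟧] T.Space where
  toFun m := M.spaceEquiv.symm (M.shtuka.fibreIncl L m)
  map_add' m m' := by rw [map_add, map_add]
  map_smul' s m := by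
    rw [TorsionLocalShtuka.fibreIncl_base_smul, spaceEquiv_symm_base_smul, RingHom.id_apply]

theorem spaceMap_embed (M : ShtukaModel c T) (m : M.shtuka.carrier) :
    M.spaceMap (M.embed m) = M.shtuka.fibreIncl L m :=
  M.spaceEquiv.apply_symm_apply _

theorem embed_injective (M : ShtukaModel c T) : Function.Injective M.embed :=
  M.spaceEquiv.symm.injective.comp M.shtuka.fibreIncl_injective

/-- The image of a model of `T` in `L⟦z⟧ ⊗ T`. -/
def lattice (M : ShtukaModel c T) : Submodule R⟦X⟧ T.Space := LinearMap.range M.embed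

theorem fibreMap_spaceMap {M : ShtukaModel c T} {M' : ShtukaModel c T'} {f : T.Hom T'}
    {F : M.shtuka.Hom M'.shtuka} (h : Induces M M' F f.toLinearMap) (x : T.Space) :
    F.fibreMap L (M.spaceMap x) = M'.spaceMap (f.spaceMap x) :=
  TorsionRep.Space.hom_ext (RingHom.id _) (f := (F.fibreMap L).comp M.spaceMap.toAddMonoidHom)
    (g := M'.spaceMap.toAddMonoidHom.comp f.spaceMap.toAddMonoidHom)
    (fun l x => by
      simp only [AddMonoidHom.comp_apply, LinearMap.toAddMonoidHom_coe, map_smul,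
        TorsionLocalShtuka.Hom.fibreMap_powerSeries_smul, RingHom.id_apply])
    (fun l x => by
      simp only [AddMonoidHom.comp_apply, LinearMap.toAddMonoidHom_coe, map_smul,
        RingHom.id_apply])
    (fun t => by
      simp only [AddMonoidHom.comp_apply, LinearMap.toAddMonoidHom_coe, spaceMap_incl,
        TorsionRep.Hom.spaceMap_incl]
      exact h t) x

/-- On fibres the morphism is determined by its effect on T, so on lattices it can only be the
restriction of id ⊗ f. Uniqueness of compatible morphisms follows. -/
theorem embed_of_induces {M : ShtukaModel c T} {M' : ShtukaModel c T'} {f : T.Hom T'}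
    {F : M.shtuka.Hom M'.shtuka} (h : Induces M M' F f.toLinearMap) (m : M.shtuka.carrier) :
    M'.embed (F.toLinearMap m) = f.spaceMap (M.embed m) := by
  apply M'.spaceMap_bijective.1
  rw [← fibreMap_spaceMap h, spaceMap_embed, spaceMap_embed,
    TorsionLocalShtuka.Hom.fibreMap_fibreIncl]

theorem hom_eq_of_induces {M : ShtukaModel c T} {M' : ShtukaModel c T'} {f : T.Hom T'}
    {F G : M.shtuka.Hom M'.shtuka} (hF : Induces M M' F f.toLinearMap)
    (hG : Induces M M' G f.toLinearMap) : F = G := by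
  apply TorsionLocalShtuka.Hom.ext
  ext m
  apply M'.embed_injective
  rw [embed_of_induces hF, embed_of_induces hG]

theorem lattice_le_of_induces {M : ShtukaModel c T} {M' : ShtukaModel c T'} {f : T.Hom T'}
    {F : M.shtuka.Hom M'.shtuka} (h : Induces M M' F f.toLinearMap) :
    M.lattice ≤ M'.lattice.comap (f.baseSpaceMap R) := by
  rintro _ ⟨m, rfl⟩
  exact ⟨F.toLinearMap m, embed_of_induces h m⟩

/-- Restrict id ⊗ f to the lattices. Its base change is id ⊗ f transported to the fibres, and this
commutes with the Frobenius and sends T to T' by f. -/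
theorem exists_induces {M : ShtukaModel c T} {M' : ShtukaModel c T'} {f : T.Hom T'}
    (h : M.lattice ≤ M'.lattice.comap (f.baseSpaceMap R)) :
    ∃ F : M.shtuka.Hom M'.shtuka, Induces M M' F f.toLinearMap := by
  let F₀ : M.shtuka.carrier →ₗ[R⟦X⟧] M'.shtuka.carrier :=
    (LinearEquiv.ofInjective M'.embed M'.embed_injective).symm.toLinearMap ∘ₗ
      (f.baseSpaceMap R ∘ₗ M.embed).codRestrict M'.lattice (fun m => h ⟨m, rfl⟩)
  have hF₀ : ∀ m, M'.embed (F₀ m) = f.spaceMap (M.embed m) := fun m =>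
    congrArg Subtype.val ((LinearEquiv.ofInjective M'.embed M'.embed_injective).apply_symm_apply
      ⟨f.spaceMap (M.embed m), h ⟨m, rfl⟩⟩)
  let G : M.shtuka.Fibre L →ₗ[L⟦X⟧] M'.shtuka.Fibre L := F₀.baseChange L⟦X⟧
  have hG : ∀ x, G x = M'.spaceMap (f.spaceMap (M.spaceEquiv.symm x)) := by
    intro x
    induction x using TorsionLocalShtuka.fibre_induction_on with
    | zero => rw [map_zero, map_zero, map_zero, map_zero]
    | smul_incl l m =>
      rw [map_smul, map_smul, map_smul, map_smul]
      congr 1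
      change _ = M'.spaceMap (f.spaceMap (M.embed m))
      rw [← hF₀, spaceMap_embed]
      rfl
    | add x y hx hy => rw [map_add, map_add, map_add, map_add, hx, hy]
  refine ⟨⟨F₀, TorsionLocalShtuka.comm_of_tauFibre L F₀ fun m => ?_⟩, fun t => ?_⟩
  · change _ = G _
    rw [hG, ← spaceMap_embed, ← spaceMap_embed, hF₀, ← M.spaceMap_frob, ← M'.spaceMap_frob,
      ← M.spaceEquiv_apply, LinearEquiv.symm_apply_apply, f.spaceMap_frob]
  · change G _ = _
    rw [hG, ← spaceMap_incl, ← spaceMap_incl, ← M.spaceEquiv_apply, LinearEquiv.symm_apply_apply,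
      f.spaceMap_incl]

theorem precsim_iff {M M' : ShtukaModel c T} : Precsim M M' ↔ M.lattice ≤ M'.lattice := by
  have h : (TorsionRep.Hom.id T).baseSpaceMap R = LinearMap.id :=
    LinearMap.ext TorsionRep.Hom.spaceMap_id
  constructor
  · rintro ⟨F, hF⟩
    have := lattice_le_of_induces (f := TorsionRep.Hom.id T) hF
    rwa [h, Submodule.comap_id] at this
  · intro hle
    exact exists_induces (f := TorsionRep.Hom.id T) (by rwa [h, Submodule.comap_id])

theorem frob_embed (M : ShtukaModel c T) (m : M.shtuka.carrier) :
    M.spaceMap (T.frob (M.embed m)) = M.shtuka.toFibre L (M.shtuka.semilin m) := by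
  rw [spaceMap_frob, spaceMap_embed, TorsionLocalShtuka.tauFibre_fibreIncl]

theorem isFullLattice_lattice (M : ShtukaModel c T) :
    IsFullLattice L (M.lattice.restrictScalars R) := by
  let g : M.shtuka.Fibre L ≃ₗ[L] T.Space := M.spaceEquiv.symm.restrictScalars L
  let e := (M.shtuka.fibreBasis L).map g
  have hcard : Fintype.card (Module.Free.ChooseBasisIndex R M.shtuka.carrier) =
      Module.finrank L T.Space := (Module.finrank_eq_card_basis e).symm
  refine ⟨e.reindex (Fintype.equivFinOfCardEq hcard), ?_⟩
  rw [Module.Basis.range_reindex]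
  set b := Module.Free.chooseBasis R M.shtuka.carrier
  have he : ∀ i, e i = M.embed (b i) := fun i => by
    rw [Module.Basis.map_apply, TorsionLocalShtuka.fibreBasis_apply]
    rfl
  let E : M.shtuka.carrier →ₗ[R] T.Space := M.embed.restrictScalars R
  have h1 : M.lattice.restrictScalars R = Submodule.map E ⊤ := by
    ext x
    simp [lattice, E]
  rw [h1, ← b.span_eq, Submodule.map_span, ← Set.range_comp]
  congr 2
  ext i
  exact (he i).symm

/-- Galois acts only through L⟦z⟧, so the image of M is fixed; the two inclusions defining the
height are carried from M[1/(z - ζ)] to V through the fibre. -/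
theorem isShtukaLattice_lattice {M : ShtukaModel c T} (hM : M.shtuka.HasHeightLE d) :
    TorsionRep.IsShtukaLattice c d M.lattice where
  fixed g x hx := by
    obtain ⟨m, rfl⟩ := hx
    apply M.spaceMap_bijective.1
    rw [spaceMap_gal, spaceMap_embed, TorsionLocalShtuka.galAct_fibreIncl]
  full := M.isFullLattice_lattice
  frob_mem x hx := by
    obtain ⟨m, rfl⟩ := hx
    obtain ⟨m', hm'⟩ := hM.2 ⟨Pullback.incl _ m, rfl⟩
    refine ⟨m', ?_⟩
    apply M.spaceMap_bijective.1
    rw [frob_embed, spaceMap_embed, ← TorsionLocalShtuka.toFibre_mk, hm']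
    rfl
  height x hx := by
    obtain ⟨m, rfl⟩ := hx
    obtain ⟨y, hy⟩ := hM.1 _ ⟨m, rfl⟩
    have h1 := M.shtuka.toFibre_tau_mem (L := L) y
    have h2 : M.shtuka.tau (LocalizedModule.mkLinearMap (zPowers c) _ y) = _ := hy
    rw [h2, LinearMap.map_smul, TorsionLocalShtuka.toFibre_mk] at h1
    let g : M.shtuka.Fibre L →ₗ[R⟦X⟧] T.Space :=
      { toFun := M.spaceEquiv.symm
        map_add' := map_add _
        map_smul' := M.spaceEquiv_symm_base_smul }
    have h3 := Submodule.mem_map_of_mem (f := g) h1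
    rw [Submodule.map_span, map_smul] at h3
    refine Submodule.span_mono ?_ h3
    rintro _ ⟨_, ⟨m', rfl⟩, rfl⟩
    refine ⟨M.embed m', ⟨m', rfl⟩, ?_⟩
    change _ = M.spaceEquiv.symm _
    rw [LinearEquiv.eq_symm_apply, spaceEquiv_apply, spaceMap_frob, spaceMap_embed]

end ShtukaModel

/-! ### The model of a shtuka lattice -/

section PullbackLift

variable {S : Type u} [CommRing S] {φ : S →+* S} {M M' : Type u} [AddCommGroup M] [Module S M]
  [AddCommGroup M'] [Module S M']

/-- The linear map `φ^* M → M'` attached to a `φ`-semilinear map `M → M'`. -/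
def Pullback.lift (f : M →+ M') (hf : ∀ (s : S) m, f (s • m) = φ s • f m) :
    Pullback φ M →ₗ[S] M' :=
  let g : Pullback φ M →+ M' := TensorProduct.liftAddHom (R := S) (M := Twist φ) (N := M)
    (AddMonoidHom.mk' (fun l => AddMonoidHom.mk' (fun m => (Twist.of φ).symm l • f m)
        (by intro a b; rw [map_add, smul_add]))
      (by intro a b; ext m; simp [add_smul]))
    (by
      intro s l m
      change (Twist.of φ).symm (s • l) • f m = (Twist.of φ).symm l • f (s • m)
      have h : (Twist.of φ).symm (s • l) = (Twist.of φ).symm l * φ s :=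
        (congrArg _ (Algebra.smul_def s l)).trans (mul_comm (φ s) _)
      rw [h, mul_smul, hf])
  { toFun := g
    map_add' := map_add g
    map_smul' := fun s y => by
      rw [RingHom.id_apply]
      have hy := Pullback.mem_span_range_incl y
      induction hy using Submodule.span_induction generalizing s with
      | mem y hy =>
        obtain ⟨m, rfl⟩ := hy
        have h : ∀ s, g (s • Pullback.incl φ m) = s • f m := fun s =>
          (mul_smul s ((Twist.of φ).symm 1) (f m)).trans (congrArg (s • ·) (one_smul S (f m)))
        rw [h, ← one_smul S (Pullback.incl φ m), h, one_smul]
      | zero => rw [smul_zero, map_zero, smul_zero]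
      | add x y _ _ hx hy => rw [smul_add, map_add, map_add, smul_add, hx, hy]
      | smul t y _ hy => rw [← mul_smul, hy, hy, mul_smul] }

theorem Pullback.lift_incl (f : M →+ M') (hf : ∀ (s : S) m, f (s • m) = φ s • f m) (m : M) :
    Pullback.lift f hf (Pullback.incl φ m) = f m :=
  one_smul S (f m)

end PullbackLift

namespace TorsionRep

variable {𝔽 : Type w} [Field 𝔽] [Fintype 𝔽] {R : Type u} [CommRing R] [IsDomain R]
  [IsDiscreteValuationRing R] [Algebra 𝔽 R] {K : Type*} [Field K] [Algebra R K]
  [IsFractionRing R K] {L : Type v} [Field L] [Algebra K L] [IsSepClosure K L] [Algebra R L]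
  [IsScalarTower R K L] [FaithfulSMul R L] [Algebra 𝔽 L] [IsScalarTower 𝔽 R L]
  [GaloisFixes 𝔽 K L] {c : CharPoint R} {d : ℕ} {T : TorsionRep 𝔽 K L}

section Basis

variable {P : Type*} [AddCommGroup P] [Module R⟦X⟧ P] [Module R P] [IsScalarTower R R⟦X⟧ P]
  {Φ : P →ₗ[R⟦X⟧] T.Space}

theorem exists_basis_of_isFullLattice (hΦ : Function.Injective Φ)
    (h : IsFullLattice L ((LinearMap.range Φ).restrictScalars R)) :
    ∃ (b : Module.Basis (Fin (Module.finrank L T.Space)) R P)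
      (e : Module.Basis (Fin (Module.finrank L T.Space)) L T.Space), ∀ i, Φ (b i) = e i := by
  obtain ⟨e, he⟩ := h
  have hb : ∀ i, ∃ p, Φ p = e i := fun i => by
    have : e i ∈ (LinearMap.range Φ).restrictScalars R := he ▸ Submodule.subset_span ⟨i, rfl⟩
    exact this
  choose b hb using hb
  let Ψ : P →ₗ[R] T.Space := Φ.restrictScalars R
  have hΨb : Ψ ∘ b = e := funext hb
  have hli : LinearIndependent R b := by
    apply LinearIndependent.of_comp Ψ
    rw [hΨb]
    exact e.linearIndependent.restrict_scalars' R
  refine ⟨Module.Basis.mk hli fun p _ => ?_, e, fun i => by rw [Module.Basis.mk_apply, hb]⟩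
  have hp : Ψ p ∈ (LinearMap.range Φ).restrictScalars R := ⟨p, rfl⟩
  rw [he, ← hΨb, Set.range_comp, ← Submodule.map_span] at hp
  obtain ⟨p', hp', hpp⟩ := hp
  rwa [← hΦ hpp]

end Basis

variable {P : Type u} [AddCommGroup P] [Module R⟦X⟧ P] {Φ : P →ₗ[R⟦X⟧] T.Space}
  (hΦ : Function.Injective Φ)

/-- The Frobenius of a stable lattice. -/
def latticeFrob (h : ∀ x ∈ LinearMap.range Φ, T.frob x ∈ LinearMap.range Φ) : P →+ P where
  toFun p := (h (Φ p) ⟨p, rfl⟩).choose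
  map_zero' := hΦ (by rw [(h (Φ 0) ⟨0, rfl⟩).choose_spec, map_zero, map_zero])
  map_add' p q := hΦ (by
    refine (h (Φ (p + q)) ⟨_, rfl⟩).choose_spec.trans ?_
    rw [map_add Φ, map_add T.frob, map_add Φ, (h (Φ p) ⟨_, rfl⟩).choose_spec,
      (h (Φ q) ⟨_, rfl⟩).choose_spec])

theorem map_latticeFrob (h : ∀ x ∈ LinearMap.range Φ, T.frob x ∈ LinearMap.range Φ) (p : P) :
    Φ (latticeFrob hΦ h p) = T.frob (Φ p) := (h (Φ p) ⟨p, rfl⟩).choose_spec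

/-- The linearisation of the Frobenius of a stable lattice. -/
def latticeTau (h : ∀ x ∈ LinearMap.range Φ, T.frob x ∈ LinearMap.range Φ) :
    Pullback (sigma 𝔽 R) P →ₗ[R⟦X⟧] P :=
  Pullback.lift (latticeFrob hΦ h) fun s p => hΦ (by
    rw [map_latticeFrob, map_smul Φ, map_smul Φ, map_latticeFrob, frob_base_powerSeries_smul])

theorem map_latticeTau_incl (h : ∀ x ∈ LinearMap.range Φ, T.frob x ∈ LinearMap.range Φ) (p : P) :
    Φ (latticeTau hΦ h (Pullback.incl _ p)) = T.frob (Φ p) := by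
  rw [latticeTau, Pullback.lift_incl, map_latticeFrob]

theorem range_map_latticeTau (h : ∀ x ∈ LinearMap.range Φ, T.frob x ∈ LinearMap.range Φ) :
    LinearMap.range (Φ ∘ₗ latticeTau hΦ h) =
      Submodule.span R⟦X⟧ (T.frob '' (LinearMap.range Φ : Submodule R⟦X⟧ T.Space)) := by
  have h1 : (⊤ : Submodule R⟦X⟧ (Pullback (sigma 𝔽 R) P)) =
      Submodule.span R⟦X⟧ (Set.range (Pullback.incl (sigma 𝔽 R) (M := P))) :=
    (eq_top_iff.2 fun y _ => Pullback.mem_span_range_incl y).symm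
  rw [LinearMap.range_eq_map, h1, Submodule.map_span]
  congr 1
  ext x
  constructor
  · rintro ⟨_, ⟨p, rfl⟩, rfl⟩
    exact ⟨Φ p, ⟨p, rfl⟩, (map_latticeTau_incl hΦ h p).symm⟩
  · rintro ⟨_, ⟨p, rfl⟩, rfl⟩
    exact ⟨_, ⟨p, rfl⟩, map_latticeTau_incl hΦ h p⟩

theorem X_pow_smul_lattice (hΦ : Function.Injective Φ) {n : ℕ} (hn : ∀ x : T.Space, (X : R⟦X⟧) ^ n • x = 0) (p : P) :
    (X : R⟦X⟧) ^ n • p = 0 :=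
  hΦ (by rw [map_smul, hn, map_zero])

/-- For a basis b of P the elements 1 ⊗ bⱼ span σ̂^*P already over R, since z is nilpotent on it.
They go to the vectors φ(eⱼ), independent over L because φ preserves independence. -/
theorem latticeTau_injective (h : ∀ x ∈ LinearMap.range Φ, T.frob x ∈ LinearMap.range Φ)
    (hfull : IsFullLattice L ((LinearMap.range Φ).restrictScalars R)) :
    Function.Injective (latticeTau hΦ h) := by
  let : Module R P := Module.compHom P (algebraMap R R⟦X⟧)
  have : IsScalarTower R R⟦X⟧ P := ⟨fun r s p => by rw [Algebra.smul_def, mul_smul]; rfl⟩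
  let Q := Pullback (sigma 𝔽 R) P
  let : Module R Q := Module.compHom Q (algebraMap R R⟦X⟧)
  have : IsScalarTower R R⟦X⟧ Q := ⟨fun r s p => by rw [Algebra.smul_def, mul_smul]; rfl⟩
  obtain ⟨b, e, hbe⟩ := exists_basis_of_isFullLattice hΦ hfull
  obtain ⟨n, hn⟩ := T.exists_base_X_pow_smul_space R
  let i : P →+ Q := Pullback.incl (sigma 𝔽 R)
  have hi : ∀ (s : R⟦X⟧) p, i (s • p) = sigma 𝔽 R s • i p := Pullback.incl_smul (sigma 𝔽 R)
  have hmem : ∀ p, i p ∈ Submodule.span R (Set.range (i ∘ b)) := by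
    intro p
    have hp : p ∈ Submodule.span R (Set.range b) := b.span_eq ▸ Submodule.mem_top
    induction hp using Submodule.span_induction with
    | mem x hx => obtain ⟨j, rfl⟩ := hx; exact Submodule.subset_span ⟨j, rfl⟩
    | zero => rw [map_zero]; exact zero_mem _
    | add x y _ _ hx hy => rw [map_add]; exact add_mem hx hy
    | smul r x _ hx =>
      have h1 : i (r • x) = r ^ Fintype.card 𝔽 • i x :=
        (hi (C r) x).trans (by rw [sigma_C]; rfl)
      rw [h1]
      exact Submodule.smul_mem _ _ hx
  have hspan : ∀ y : Q, y ∈ Submodule.span R⟦X⟧ (Set.range (i ∘ b)) := by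
    intro y
    have hy : y ∈ Submodule.span R⟦X⟧ (Set.range i) := Pullback.mem_span_range_incl y
    refine Submodule.span_le.2 ?_ hy
    rintro _ ⟨p, rfl⟩
    exact Submodule.span_le_restrictScalars R R⟦X⟧ _ (hmem p)
  have hX : ∀ y : Q, (X : R⟦X⟧) ^ n • y = 0 := by
    intro y
    have hy : y ∈ Submodule.span R⟦X⟧ (Set.range i) := Pullback.mem_span_range_incl y
    induction hy using Submodule.span_induction with
    | mem y hy =>
      obtain ⟨p, rfl⟩ := hy
      rw [← sigma_X (𝔽 := 𝔽), ← map_pow, ← hi, X_pow_smul_lattice hΦ hn, map_zero]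
    | zero => rw [smul_zero]
    | add x y _ _ hx hy => rw [smul_add, hx, hy, add_zero]
    | smul s y _ hy => rw [smul_comm, hy, smul_zero]
  have hR := coe_span_powerSeries_eq hX (s := Set.range (i ∘ b)) (by
    rintro _ ⟨j, rfl⟩
    rw [← sigma_X (𝔽 := 𝔽), Function.comp_apply, ← hi]
    exact hmem _)
  rw [injective_iff_map_eq_zero]
  intro y hy
  have hy1 : y ∈ (Submodule.span R (Set.range (i ∘ b)) : Set Q) := hR ▸ hspan y
  obtain ⟨r, hr⟩ := (Submodule.mem_span_range_iff_exists_fun R).1 hy1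
  have h0 : ∑ j, algebraMap R L (r j) • T.frob (e j) = 0 := by
    have h1 : (Φ ∘ₗ latticeTau hΦ h) (∑ j, (C (r j) : R⟦X⟧) • (i ∘ b) j) = 0 := by
      rw [LinearMap.comp_apply]
      refine (congrArg (fun z => Φ (latticeTau hΦ h z)) hr).trans ?_
      rw [hy, map_zero]
    rw [map_sum] at h1
    rw [← h1]
    refine Finset.sum_congr rfl fun j _ => ?_
    rw [map_smul, C_smul, base_smul_def, ← hbe, ← map_latticeTau_incl hΦ h]
    rfl
  have h2 := Fintype.linearIndependent_iff.1 (linearIndependent_frob e.linearIndependent) _ h0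
  rw [← hr]
  refine Finset.sum_eq_zero fun j _ => ?_
  rw [(FaithfulSMul.algebraMap_eq_zero_iff R L).1 (h2 j), zero_smul]

end TorsionRep

/-! ### The torsion local shtuka attached to a shtuka lattice -/

namespace TorsionRep

variable {𝔽 : Type w} [Field 𝔽] [Fintype 𝔽] {R : Type u} [CommRing R] [IsDomain R]
  [IsDiscreteValuationRing R] [Algebra 𝔽 R] {K : Type*} [Field K] [Algebra R K]
  [IsFractionRing R K] {L : Type v} [Field L] [Algebra K L] [IsSepClosure K L] [Algebra R L]
  [IsScalarTower R K L] [FaithfulSMul R L] [Algebra 𝔽 L] [IsScalarTower 𝔽 R L]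
  [GaloisFixes 𝔽 K L] {c : CharPoint R} {d : ℕ} {T : TorsionRep 𝔽 K L}
  {P : Type u} [AddCommGroup P] [Module R⟦X⟧ P] {Φ : P →ₗ[R⟦X⟧] T.Space}
  (hΦ : Function.Injective Φ) (hN : IsShtukaLattice c d (LinearMap.range Φ))

theorem exists_latticeTau_eq (hN : IsShtukaLattice c d (LinearMap.range Φ)) (p : P) :
    ∃ y, latticeTau hΦ hN.frob_mem y = (X - C c.zeta : R⟦X⟧) ^ d • p := by
  have h := hN.height (Φ p) ⟨p, rfl⟩
  rw [← range_map_latticeTau hΦ hN.frob_mem] at h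
  obtain ⟨y, hy⟩ := h
  exact ⟨y, hΦ (by rw [map_smul]; exact hy)⟩

theorem locMap_latticeTau_bijective (hN : IsShtukaLattice c d (LinearMap.range Φ)) :
    Function.Bijective (locMap (zPowers c) (latticeTau hΦ hN.frob_mem)) := by
  constructor
  · exact IsLocalizedModule.map_injective (zPowers c) _ _ _
      (latticeTau_injective hΦ hN.frob_mem hN.full)
  · intro x
    obtain ⟨⟨p, s⟩, hs⟩ := IsLocalizedModule.surj (zPowers c)
      (LocalizedModule.mkLinearMap (zPowers c) P) x
    obtain ⟨y, hy⟩ := exists_latticeTau_eq hΦ hN p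
    -- With x = p / s and (z - ζ)^d p = τ(y), the preimage is y / ((z - ζ)^d s).
    let t : zPowers c := ⟨(X - C c.zeta) ^ d, d, rfl⟩ * s
    obtain ⟨y', hy'⟩ := ((Module.End.isUnit_iff _).1 (IsLocalizedModule.map_units
      (LocalizedModule.mkLinearMap (zPowers c) (Pullback (sigma 𝔽 R) P)) t)).2
      (LocalizedModule.mkLinearMap (zPowers c) _ y)
    refine ⟨y', IsLocalizedModule.smul_injective (LocalizedModule.mkLinearMap (zPowers c) P) t ?_⟩
    have h1 : (t : R⟦X⟧) • y' = LocalizedModule.mkLinearMap (zPowers c) _ y := hy'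
    have h2 : (s : R⟦X⟧) • x = LocalizedModule.mkLinearMap (zPowers c) _ p := hs
    change (t : R⟦X⟧) • locMap (zPowers c) (latticeTau hΦ hN.frob_mem) y' = (t : R⟦X⟧) • x
    rw [← LinearMap.map_smul, h1, locMap_mk, hy, LinearMap.map_smul, ← h2, ← mul_smul]
    rfl

/-- The torsion local shtuka of a shtuka lattice. -/
def latticeShtuka (hN : IsShtukaLattice c d (LinearMap.range Φ)) : TorsionLocalShtuka 𝔽 c where
  carrier := P
  finitePresentation := by
    let : Module R P := Module.compHom P (algebraMap R R⟦X⟧)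
    have : IsScalarTower R R⟦X⟧ P := ⟨fun r s p => by rw [Algebra.smul_def, mul_smul]; rfl⟩
    obtain ⟨b, -⟩ := exists_basis_of_isFullLattice hΦ hN.full
    have : Module.Finite R P := Module.Finite.of_basis b
    have : Module.Finite R⟦X⟧ P := Module.Finite.of_restrictScalars_finite R R⟦X⟧ P
    exact Module.finitePresentation_of_finite R⟦X⟧ P
  torsion p := by
    obtain ⟨n, hn⟩ := T.exists_base_X_pow_smul_space R
    exact ⟨n, X_pow_smul_lattice hΦ hn p⟩
  free := by
    let : Module R P := Module.compHom P (algebraMap R R⟦X⟧)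
    have : IsScalarTower R R⟦X⟧ P := ⟨fun r s p => by rw [Algebra.smul_def, mul_smul]; rfl⟩
    obtain ⟨b, -⟩ := exists_basis_of_isFullLattice hΦ hN.full
    exact Module.Free.of_basis b
  tau := LinearEquiv.ofBijective _ (locMap_latticeTau_bijective hΦ hN)

theorem latticeShtuka_tau_mk (y : Pullback (sigma 𝔽 R) P) :
    (latticeShtuka hΦ hN).tau (LocalizedModule.mkLinearMap (zPowers c) _ y) =
      LocalizedModule.mkLinearMap (zPowers c) P (latticeTau hΦ hN.frob_mem y) :=
  locMap_mk (zPowers c) (latticeTau hΦ hN.frob_mem) y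

theorem latticeShtuka_hasHeightLE : (latticeShtuka hΦ hN).HasHeightLE d := by
  constructor
  · rintro _ ⟨p, rfl⟩
    obtain ⟨y, hy⟩ := exists_latticeTau_eq hΦ hN p
    refine ⟨y, (latticeShtuka_tau_mk hΦ hN y).trans ?_⟩
    rw [hy]
    exact map_smul _ _ _
  · rintro _ ⟨y, rfl⟩
    exact ⟨latticeTau hΦ hN.frob_mem y, (latticeShtuka_tau_mk hΦ hN y).symm⟩

theorem latticeShtuka_semilin (p : P) : ∃ q : P, (latticeShtuka hΦ hN).semilin p =
    LocalizedModule.mkLinearMap (zPowers c) P q ∧ Φ q = T.frob (Φ p) :=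
  ⟨_, latticeShtuka_tau_mk hΦ hN (Pullback.incl _ p), map_latticeTau_incl hΦ hN.frob_mem p⟩

end TorsionRep

/-! ### Recognising an embedded shtuka as a model of T -/

namespace TorsionLocalShtuka

variable {𝔽 : Type w} [Field 𝔽] [Fintype 𝔽] {R : Type u} [CommRing R] [IsDomain R]
  [IsDiscreteValuationRing R] [Algebra 𝔽 R] {K : Type*} [Field K] [Algebra R K]
  [IsFractionRing R K] {L : Type v} [Field L] [Algebra K L] [IsSepClosure K L] [Algebra R L]
  [IsScalarTower R K L] [FaithfulSMul R L] [Algebra 𝔽 L] [IsScalarTower 𝔽 R L]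
  [TorsionRep.GaloisFixes 𝔽 K L] {c : CharPoint R} {T : TorsionRep 𝔽 K L}
  {M : TorsionLocalShtuka 𝔽 c} (Φ : M.carrier →ₗ[R⟦X⟧] T.Space)

/-- The map from the fibre of `M` to `L⟦z⟧ ⊗ T` given by a linear map from `M`. -/
def fibreLift : M.Fibre L →ₗ[L⟦X⟧] T.Space :=
  Φ.liftBaseChange L⟦X⟧

theorem fibreLift_fibreIncl (m : M.carrier) : fibreLift Φ (M.fibreIncl L m) = Φ m :=
  Φ.liftBaseChange_one_tmul L⟦X⟧ m

variable {Φ}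

/-- An R-basis of M gives an L-basis of the fibre, and it is sent to the L-basis of V that spans the
full lattice. -/
theorem fibreLift_bijective (hΦ : Function.Injective Φ)
    (hfull : IsFullLattice L ((LinearMap.range Φ).restrictScalars R)) :
    Function.Bijective (fibreLift Φ) := by
  let g : M.Fibre L →ₗ[L] T.Space :=
    { toFun := fibreLift Φ
      map_add' := map_add _
      map_smul' := fun l x => (fibreLift Φ).map_smul (C l) x }
  obtain ⟨b, e, hbe⟩ := TorsionRep.exists_basis_of_isFullLattice hΦ hfull
  let B : Module.Basis _ L (M.Fibre L) :=
    PowerSeriesBaseChange.basis M.exists_X_pow_smul.choose_spec b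
  have h : g = (B.equiv e (Equiv.refl _)).toLinearMap := by
    refine B.ext fun i => ?_
    rw [LinearEquiv.coe_coe, Module.Basis.equiv_apply, Equiv.refl_apply, ← hbe]
    refine Eq.trans ?_ (fibreLift_fibreIncl Φ (b i))
    exact congrArg g (PowerSeriesBaseChange.basis_apply _ b i)
  have h2 : Function.Bijective g := by
    rw [h]
    exact (B.equiv e (Equiv.refl _)).bijective
  exact h2

theorem fibreLift_tauFibre (hfrob : ∀ m, ∃ m', M.semilin m =
    LocalizedModule.mkLinearMap (zPowers c) M.carrier m' ∧ Φ m' = T.frob (Φ m))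
    (x : M.Fibre L) : fibreLift Φ (M.tauFibre L x) = T.frob (fibreLift Φ x) := by
  induction x using fibre_induction_on with
  | zero => rw [map_zero, map_zero, map_zero]
  | smul_incl l m =>
    obtain ⟨m', h1, h2⟩ := hfrob m
    rw [tauFibre_smul_fibreIncl, map_smul, map_smul, TorsionRep.frob_smul, fibreLift_fibreIncl,
      ← h2, h1, toFibre_mk, fibreLift_fibreIncl]
  | add x y hx hy => rw [map_add, map_add, map_add, map_add, hx, hy]

theorem fibreLift_galAct (hfix : ∀ (g : L ≃ₐ[K] L) m, T.gal g (Φ m) = Φ m) (g : L ≃ₐ[K] L)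
    (x : M.Fibre L) : fibreLift Φ (M.galAct g x) = T.gal g (fibreLift Φ x) := by
  induction x using fibre_induction_on with
  | zero => rw [map_zero, map_zero, map_zero]
  | smul_incl l m =>
    rw [galAct_smul_fibreIncl, map_smul, map_smul, TorsionRep.gal_smul, fibreLift_fibreIncl, hfix]
  | add x y hx hy => rw [map_add, map_add, map_add, map_add, hx, hy]

/-- A torsion local shtuka embedded as a lattice in `L⟦z⟧ ⊗ T` is a model of `T`. -/
theorem exists_model_of_embedding (hΦ : Function.Injective Φ)
    (hfull : IsFullLattice L ((LinearMap.range Φ).restrictScalars R))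
    (hfix : ∀ (g : L ≃ₐ[K] L) m, T.gal g (Φ m) = Φ m)
    (hfrob : ∀ m, ∃ m', M.semilin m =
      LocalizedModule.mkLinearMap (zPowers c) M.carrier m' ∧ Φ m' = T.frob (Φ m)) :
    ∃ M' : ShtukaModel c T, M'.shtuka = M ∧ M'.lattice = LinearMap.range Φ := by
  have hb := fibreLift_bijective hΦ hfull
  let E : M.Fibre L ≃ₗ[L⟦X⟧] T.Space := LinearEquiv.ofBijective _ hb
  have hE : ∀ x, fibreLift Φ (E.symm x) = x := E.apply_symm_apply
  let j : T.carrier →ₗ[𝔽⟦X⟧] M.tateModule L :=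
    { toFun := fun t => ⟨E.symm (T.incl t), hb.1 (by
        rw [fibreLift_tauFibre hfrob, hE, TorsionRep.frob_incl])⟩
      map_add' := fun t t' => Subtype.ext (by
        change _ = E.symm _ + E.symm _
        rw [← map_add, ← map_add])
      map_smul' := fun s t => Subtype.ext (by
        change _ = s • E.symm _
        rw [coeff_smul_eq, ← map_smul, ← TorsionRep.incl_smul]) }
  have hj : Function.Bijective j := by
    constructor
    · intro t t' h
      exact T.incl_injective (E.symm.injective (congrArg Subtype.val h))
    · rintro ⟨x, hx⟩
      have h1 : T.frob (fibreLift Φ x) = fibreLift Φ x := by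
        rw [← fibreLift_tauFibre hfrob]
        exact congrArg _ hx
      -- The identification with V turns the Tate module into the fixed vectors of φ, which are T.
      obtain ⟨t, ht⟩ := TorsionRep.frob_eq_self_iff.1 h1
      exact ⟨t, Subtype.ext (hb.1 ((hE _).trans ht))⟩
  let M' : ShtukaModel c T :=
    { shtuka := M
      iso := LinearEquiv.ofBijective j hj
      equivariant := fun g t => hb.1 (by
        rw [fibreLift_galAct hfix]
        refine (hE _).trans ?_
        rw [← TorsionRep.gal_incl]
        exact congrArg _ (hE _).symm) }
  refine ⟨M', rfl, ?_⟩
  -- The comparison map of the new model is inverse to `fibreLift Φ`, since both are linear and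
  -- match on T; hence its embedding into V is Φ.
  have h : ∀ x, fibreLift Φ (M'.spaceMap x : M.Fibre L) = x :=
    TorsionRep.Space.hom_ext (RingHom.id _)
      (f := (fibreLift Φ ∘ₗ (M'.spaceMap : T.Space →ₗ[L⟦X⟧] M.Fibre L)).toAddMonoidHom)
      (g := AddMonoidHom.id _) (fun l x =>
        LinearMap.map_smul (fibreLift Φ ∘ₗ (M'.spaceMap : T.Space →ₗ[L⟦X⟧] M.Fibre L)) l x)
      (fun l x => rfl)
      (fun t => (congrArg (fibreLift Φ) (M'.spaceMap_incl t)).trans (hE _))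
  have h2 : ∀ m, M'.embed m = Φ m := fun m =>
    (h (M'.embed m)).symm.trans
      ((congrArg (fibreLift Φ) (M'.spaceMap_embed m)).trans (fibreLift_fibreIncl Φ m))
  exact congrArg LinearMap.range (LinearMap.ext h2)

end TorsionLocalShtuka

/-- Every shtuka lattice is the lattice of an effective model. -/
theorem TorsionRep.IsShtukaLattice.exists_model {𝔽 : Type w} [Field 𝔽] [Fintype 𝔽] {R : Type u}
    [CommRing R] [IsDomain R] [IsDiscreteValuationRing R] [Algebra 𝔽 R] {K : Type*} [Field K]
    [Algebra R K] [IsFractionRing R K] {L : Type v} [Field L] [Algebra K L] [IsSepClosure K L]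
    [Algebra R L] [IsScalarTower R K L] [FaithfulSMul R L] [Algebra 𝔽 L] [IsScalarTower 𝔽 R L]
    [GaloisFixes 𝔽 K L] {c : CharPoint R} {d : ℕ} {T : TorsionRep 𝔽 K L}
    {N : Submodule R⟦X⟧ T.Space} (hN : IsShtukaLattice c d N) :
    ∃ M : ShtukaModel c T, M.shtuka.HasHeightLE d ∧ M.lattice = N := by
  -- The carrier of a shtuka must live in the universe of R, whereas N lives in that of L.
  -- Coordinates in a basis embed N into a finite power of R.
  have : Small.{u} N := by
    obtain ⟨e, he⟩ := hN.full
    have hs : ∀ x : N, ∃ r : Fin _ → R, ∑ i, r i • e i = (x : T.Space) := fun x => by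
      have : (x : T.Space) ∈ N.restrictScalars R := x.2
      rw [he] at this
      exact (Submodule.mem_span_range_iff_exists_fun R).1 this
    choose r hr using hs
    exact small_of_injective (f := r) fun x y h => Subtype.ext (by rw [← hr, h, hr])
  let Φ : Shrink.{u} N →ₗ[R⟦X⟧] T.Space := N.subtype ∘ₗ (Shrink.linearEquiv R⟦X⟧ N).toLinearMap
  have hΦ : Function.Injective Φ :=
    N.subtype_injective.comp (Shrink.linearEquiv R⟦X⟧ N).injective
  have hr : LinearMap.range Φ = N := by
    rw [LinearMap.range_comp, LinearEquiv.range, Submodule.map_top, Submodule.range_subtype]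
  have hN' : IsShtukaLattice c d (LinearMap.range Φ) := hr.symm ▸ hN
  obtain ⟨M, h1, h2⟩ := TorsionLocalShtuka.exists_model_of_embedding (M := latticeShtuka hΦ hN')
    (Φ := Φ) hΦ hN'.full (fun g p => hN'.fixed g _ ⟨p, rfl⟩) (latticeShtuka_semilin hΦ hN')
  exact ⟨M, h1 ▸ latticeShtuka_hasHeightLE hΦ hN', h2.trans hr⟩

/-! ### Equivalence classes of models as lattices -/

section Classes

variable {𝔽 : Type w} [Field 𝔽] [Fintype 𝔽] {R : Type u} [CommRing R] [IsDomain R]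
  [IsDiscreteValuationRing R] [Algebra 𝔽 R] {K : Type*} [Field K] [Algebra R K]
  [IsFractionRing R K] {L : Type v} [Field L] [Algebra K L] [IsSepClosure K L] [Algebra R L]
  [IsScalarTower R K L] [FaithfulSMul R L] [Algebra 𝔽 L] [IsScalarTower 𝔽 R L]

theorem galoisFixes_of_isScalarTower (𝔽 R K L : Type*) [Field 𝔽] [CommRing R] [Algebra 𝔽 R]
    [Field K] [Algebra R K] [Field L] [Algebra K L] [Algebra R L] [IsScalarTower R K L]
    [Algebra 𝔽 L] [IsScalarTower 𝔽 R L] : TorsionRep.GaloisFixes 𝔽 K L where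
  commutes g a := by
    rw [IsScalarTower.algebraMap_apply 𝔽 R L, IsScalarTower.algebraMap_apply R K L, g.commutes]

variable [TorsionRep.GaloisFixes 𝔽 K L] {c : CharPoint R} {d : ℕ} {T T' : TorsionRep 𝔽 K L}

namespace ModelClass

/-- The lattice of an equivalence class of models. -/
def lattice (C : ModelClass c T) : Submodule R⟦X⟧ T.Space :=
  Quotient.lift ShtukaModel.lattice (fun M M' (h : ShtukaModel.Precsim M M' ∧ ShtukaModel.Precsim M' M) =>
    le_antisymm (ShtukaModel.precsim_iff.1 h.1) (ShtukaModel.precsim_iff.1 h.2)) C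

theorem exists_toClass_eq (C : ModelClass c T) : ∃ M : ShtukaModel c T, M.toClass = C :=
  Quotient.exists_rep C

theorem lattice_le_lattice {C C' : ModelClass c T} : C.lattice ≤ C'.lattice ↔ C ≤ C' := by
  obtain ⟨M, rfl⟩ := C.exists_toClass_eq
  obtain ⟨M', rfl⟩ := C'.exists_toClass_eq
  exact ShtukaModel.precsim_iff.symm

theorem lattice_injective : Function.Injective (lattice : ModelClass c T → _) := by
  intro C C' h
  obtain ⟨M, rfl⟩ := C.exists_toClass_eq
  obtain ⟨M', rfl⟩ := C'.exists_toClass_eq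
  exact Quotient.sound ⟨ShtukaModel.precsim_iff.2 h.le, ShtukaModel.precsim_iff.2 h.ge⟩

theorem isPartialOrder (c : CharPoint R) (T : TorsionRep 𝔽 K L) :
    IsPartialOrder (ModelClass c T) (· ≤ ·) where
  refl _ := lattice_le_lattice.1 le_rfl
  trans _ _ _ h h' :=
    lattice_le_lattice.1 ((lattice_le_lattice.2 h).trans (lattice_le_lattice.2 h'))
  antisymm _ _ h h' :=
    lattice_injective (le_antisymm (lattice_le_lattice.2 h) (lattice_le_lattice.2 h'))

theorem isShtukaLattice_lattice_iff {C : ModelClass c T} :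
    TorsionRep.IsShtukaLattice c d C.lattice ↔ C ∈ boundedClasses c T d := by
  constructor
  · intro h
    obtain ⟨M, hM, hC⟩ := h.exists_model
    exact ⟨M, hM, lattice_injective hC⟩
  · rintro ⟨M, hM, rfl⟩
    exact ShtukaModel.isShtukaLattice_lattice hM

theorem exists_lattice_eq {N : Submodule R⟦X⟧ T.Space} (hN : TorsionRep.IsShtukaLattice c d N) :
    ∃ C : ModelClass c T, C ∈ boundedClasses c T d ∧ C.lattice = N := by
  obtain ⟨M, hM, h⟩ := hN.exists_model
  exact ⟨M.toClass, ⟨M, hM, rfl⟩, h⟩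

theorem maximal_lattice_iff {C : ModelClass c T} :
    Maximal (TorsionRep.IsShtukaLattice c d) C.lattice ↔
      Maximal (· ∈ boundedClasses c T d) C := by
  refine and_congr isShtukaLattice_lattice_iff ⟨fun h C' hC' hle => ?_, fun h N hN hle => ?_⟩
  · exact lattice_le_lattice.1
      (h (isShtukaLattice_lattice_iff.2 hC') (lattice_le_lattice.2 hle))
  · obtain ⟨C', hC', rfl⟩ := exists_lattice_eq hN
    exact lattice_le_lattice.2 (h hC' (lattice_le_lattice.1 hle))

theorem minimal_lattice_iff {C : ModelClass c T} :
    Minimal (TorsionRep.IsShtukaLattice c d) C.lattice ↔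
      Minimal (· ∈ boundedClasses c T d) C := by
  refine and_congr isShtukaLattice_lattice_iff ⟨fun h C' hC' hle => ?_, fun h N hN hle => ?_⟩
  · exact lattice_le_lattice.1
      (h (isShtukaLattice_lattice_iff.2 hC') (lattice_le_lattice.2 hle))
  · obtain ⟨C', hC', rfl⟩ := exists_lattice_eq hN
    exact lattice_le_lattice.2 (h hC' (lattice_le_lattice.1 hle))

/-- Two maximal lattices both equal their sum, which is again a shtuka lattice. -/
theorem existsUnique_maximal (h : (boundedClasses c T d).Nonempty) :
    ∃! C : ModelClass c T, Maximal (· ∈ boundedClasses c T d) C := by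
  obtain ⟨C₀, hC₀⟩ := h
  obtain ⟨N, hN⟩ := (isShtukaLattice_lattice_iff.2 hC₀).exists_extremal.1
  obtain ⟨C, -, rfl⟩ := exists_lattice_eq hN.1
  refine ⟨C, maximal_lattice_iff.1 hN, fun C' hC' => lattice_injective ?_⟩
  have hC' := maximal_lattice_iff.2 hC'
  have hsup := hN.1.sup hC'.1
  exact le_antisymm (le_sup_right.trans (hN.2 hsup le_sup_left))
    (le_sup_left.trans (hC'.2 hsup le_sup_right))

/-- Two minimal lattices both equal their intersection, a shtuka lattice by flatness of the
Frobenius. -/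
theorem existsUnique_minimal (h : (boundedClasses c T d).Nonempty) :
    ∃! C : ModelClass c T, Minimal (· ∈ boundedClasses c T d) C := by
  obtain ⟨C₀, hC₀⟩ := h
  obtain ⟨N, hN⟩ := (isShtukaLattice_lattice_iff.2 hC₀).exists_extremal.2
  obtain ⟨C, -, rfl⟩ := exists_lattice_eq hN.1
  refine ⟨C, minimal_lattice_iff.1 hN, fun C' hC' => lattice_injective ?_⟩
  have hC' := minimal_lattice_iff.2 hC'
  have hinf := hN.1.inf hC'.1
  exact le_antisymm ((hC'.2 hinf inf_le_right).trans inf_le_left)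
    ((hN.2 hinf inf_le_left).trans inf_le_right)

theorem finite_boundedClasses [Finite (IsLocalRing.ResidueField R)] (c : CharPoint R)
    (T : TorsionRep 𝔽 K L) (d : ℕ) : (boundedClasses c T d).Finite :=
  Set.Finite.of_finite_image
    ((TorsionRep.IsShtukaLattice.finite_setOf c d T).subset (by
      rintro _ ⟨C, hC, rfl⟩
      exact isShtukaLattice_lattice_iff.2 hC)) lattice_injective.injOn

end ModelClass

namespace ShtukaModel

theorem existsUnique_induces {M : ShtukaModel c T} {M' : ShtukaModel c T'} {f : T.Hom T'}
    (h : M.lattice ≤ M'.lattice.comap (f.baseSpaceMap R)) :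
    ∃! F : M.shtuka.Hom M'.shtuka, Induces M M' F f.toLinearMap := by
  obtain ⟨F, hF⟩ := exists_induces h
  exact ⟨F, hF, fun G hG => hom_eq_of_induces hG hF⟩

/-- f(N) + N' is a shtuka lattice containing the maximal N', hence equals N', so f(N) ⊆ N'. -/
theorem IsMaximal.existsUnique_induces {M : ShtukaModel c T} {M' : ShtukaModel c T'}
    (hM : M.IsMaximal d) (hM' : M'.IsMaximal d) (f : T.Hom T') :
    ∃! F : M.shtuka.Hom M'.shtuka, Induces M M' F f.toLinearMap := by
  have h := ModelClass.maximal_lattice_iff.2 hM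
  have h' := ModelClass.maximal_lattice_iff.2 hM'
  refine ShtukaModel.existsUnique_induces (Submodule.map_le_iff_le_comap.1 ?_)
  exact le_sup_left.trans (h'.2 (h.1.map_sup h'.1 f) le_sup_right)

/-- N ∩ f⁻¹(N') is a shtuka lattice inside the minimal N, hence equals N. -/
theorem IsMinimal.existsUnique_induces {M : ShtukaModel c T} {M' : ShtukaModel c T'}
    (hM : M.IsMinimal d) (hM' : M'.IsMinimal d) (f : T.Hom T') :
    ∃! F : M.shtuka.Hom M'.shtuka, Induces M M' F f.toLinearMap := by
  have h := ModelClass.minimal_lattice_iff.2 hM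
  have h' := ModelClass.minimal_lattice_iff.2 hM'
  refine ShtukaModel.existsUnique_induces ?_
  exact (h.2 (h.1.inf_comap h'.1 f) inf_le_left).trans inf_le_right

/-- Inside V a compatible morphism is an inclusion of lattices, so it is bijective exactly when the
lattices agree. -/
theorem toClass_eq_iff {M M' : ShtukaModel c T} :
    M.toClass = M'.toClass ↔ ∃ F : M.shtuka.Hom M'.shtuka,
      M.Induces M' F id ∧ Function.Bijective F.toLinearMap := by
  have hid : ∀ m, (TorsionRep.Hom.id T).spaceMap m = m := TorsionRep.Hom.spaceMap_id
  constructor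
  · intro h
    have hl : M.lattice = M'.lattice := congrArg ModelClass.lattice h
    obtain ⟨F, hF⟩ := precsim_iff.2 hl.le
    have hFm : ∀ m, M'.embed (F.toLinearMap m) = M.embed m := fun m =>
      (embed_of_induces (f := TorsionRep.Hom.id T) hF m).trans (hid _)
    refine ⟨F, hF, fun m m' hmm => M.embed_injective ?_, fun m' => ?_⟩
    · rw [← hFm, hmm, hFm]
    · obtain ⟨m, hm⟩ : M'.embed m' ∈ M.lattice := hl ▸ ⟨m', rfl⟩
      exact ⟨m, M'.embed_injective ((hFm m).trans hm)⟩
  · rintro ⟨F, hF, hb⟩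
    refine ModelClass.lattice_injective (le_antisymm (precsim_iff.1 ⟨F, hF⟩) ?_)
    rintro _ ⟨m', rfl⟩
    obtain ⟨m, rfl⟩ := hb.2 m'
    exact ⟨m, ((embed_of_induces (f := TorsionRep.Hom.id T) hF m).trans (hid _)).symm⟩

end ShtukaModel

end Classes

end LocalShtuka

end

open LocalShtuka in
theorem mainTheorem10
    {𝔽 : Type*} [Field 𝔽] [Fintype 𝔽]
    {R : Type*} [CommRing R] [IsDomain R] [IsDiscreteValuationRing R]
    [IsAdicComplete (IsLocalRing.maximalIdeal R) R] [Algebra 𝔽 R]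
    {K : Type*} [Field K] [Algebra R K] [IsFractionRing R K]
    {Ksep : Type*} [Field Ksep] [Algebra K Ksep] [IsSepClosure K Ksep]
    [Algebra R Ksep] [IsScalarTower R K Ksep] [FaithfulSMul R Ksep]
    [Algebra 𝔽 Ksep] [IsScalarTower 𝔽 R Ksep]
    (c : CharPoint R) (d : ℕ) :
    -- `≾` is a partial order on equivalence classes; maps witnessing `≾` are unique, and
    -- equivalent models are isomorphic
    (∀ T : TorsionRep 𝔽 K Ksep,
      IsPartialOrder (ModelClass c T) (· ≤ ·) ∧
      ∀ M M' : ShtukaModel c T,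
        (∀ F G : M.shtuka.Hom M'.shtuka, M.Induces M' F id → M.Induces M' G id → F = G) ∧
        (M.toClass = M'.toClass ↔ ∃ F : M.shtuka.Hom M'.shtuka,
          M.Induces M' F id ∧ Function.Bijective F.toLinearMap)) ∧
    -- unique maximal and minimal elements
    (∀ T : TorsionRep 𝔽 K Ksep, (boundedClasses c T d).Nonempty →
      (∃! C : ModelClass c T, Maximal (· ∈ boundedClasses c T d) C) ∧
      (∃! C : ModelClass c T, Minimal (· ∈ boundedClasses c T d) C)) ∧
    -- functoriality of maximal and minimal models
    (∀ (T T' : TorsionRep 𝔽 K Ksep) (f : T.Hom T') (M : ShtukaModel c T) (M' : ShtukaModel c T'),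
      (M.IsMaximal d → M'.IsMaximal d →
        ∃! F : M.shtuka.Hom M'.shtuka, M.Induces M' F f.toLinearMap) ∧
      (M.IsMinimal d → M'.IsMinimal d →
        ∃! F : M.shtuka.Hom M'.shtuka, M.Induces M' F f.toLinearMap)) ∧
    -- finiteness, when the residue field is finite
    (Finite (IsLocalRing.ResidueField R) →
      ∀ T : TorsionRep 𝔽 K Ksep, (boundedClasses c T d).Finite) := by
  have := galoisFixes_of_isScalarTower 𝔽 R K Ksep
  exact ⟨fun T => ⟨ModelClass.isPartialOrder c T, fun M M' =>
      ⟨fun F G hF hG => ShtukaModel.hom_eq_of_induces (f := TorsionRep.Hom.id T) hF hG,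
        ShtukaModel.toClass_eq_iff⟩⟩,
    fun T h => ⟨ModelClass.existsUnique_maximal h, ModelClass.existsUnique_minimal h⟩,
    fun T T' f M M' => ⟨fun hM hM' => hM.existsUnique_induces hM' f,
      fun hM hM' => hM.existsUnique_induces hM' f⟩,
    fun _ T => ModelClass.finite_boundedClasses c T d⟩
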